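/- All graphs are finite and simple. For a graph $G$, the chromatic index $\chi'(G)$ is the least $k$ such that the edges of $G$ can be coloured with $k$ colours so that any two distinct edges sharing an endvertex receive different colours, and $\Delta(G)$ is the maximum degree. $G$ is of Class $2$ if $\chi'(G)=\Delta(G)+1$. For a graph $G$ with at least one edge, the chromatic edge stability index $es_{\chi'}(G)$ is the minimum number of edges of $G$ whose deletion results in a graph $H$ with $\chi'(H)=\chi'(G)-1$. Write $\cup$ for disjoint union, $\overline{H}$ for the complement of $H$, $K_n$ for the complete graph of order $n$, $K_{1,2}$ for the complete bipartite graph with parts of sizes $1$ and $2$, and $K_n^-$ for $K_n$ with one edge deleted. **Theorem.** Let $G$ be a Class $2$ graph of odd order $n$. Then $es_{\chi'}(G)=\frac{n-3}{2}$ if and only if at least one of the following holds: 1. $G\cong K_n^-$; 2. $G\cong K_{n-2}\cup K_2$; 3. $G\cong K_{n-2}\cup\overline{K_2}$; 4. $G\cong\overline{K_2\cup\dots\cup K_2\cup K_{1,2}}$, with at least one copy of $K_2$; 5. $n\ge 5$ and $G$ is $(n-3)$-regular; 6. $G\cong K_{2m+1}\cup K_{2m+1}\cup K_1$ for some positive integer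 $m$; 7. $G\cong K_{2m+1}\cup K_{2m+1}\cup K_{2m+1}$ for some positive integer $m$. -/

import Mathlib

namespace SimpleGraph

/-- An edge labelling is a proper edge coloring if any two distinct edges with a common endpoint
receive different colors. -/
def IsProperEdgeColoring {V : Type*} (G : SimpleGraph V) {k : ℕ}
    (c : G.EdgeLabeling (Fin k)) : Prop :=
  ∀ e f : G.edgeSet, e ≠ f → (∃ v : V, v ∈ (e : Sym2 V) ∧ v ∈ (f : Sym2 V)) → c e ≠ c f

/-- The chromatic index of a finite graph: the least `k` for which `G` admits a proper
`k`-edge coloring. -/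
noncomputable def chromaticIndex {V : Type*} (G : SimpleGraph V) : ℕ :=
  sInf {k : ℕ | ∃ c : G.EdgeLabeling (Fin k), G.IsProperEdgeColoring c}

/-- The chromatic edge stability index of a finite graph with at least one edge: the least number
of edges whose deletion results in a graph with chromatic index one less than that of `G`. -/
noncomputable def chromaticEdgeStabilityIndex {V : Type*} (G : SimpleGraph V) : ℕ :=
  sInf {k : ℕ | ∃ F : Finset (Sym2 V), (F : Set (Sym2 V)) ⊆ G.edgeSet ∧ F.card = k ∧
    (G.deleteEdges (F : Set (Sym2 V))).chromaticIndex + 1 = G.chromaticIndex}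

/-- A finite graph is of Class 2 if its chromatic index is its maximum degree plus one. -/
def IsClassTwo {V : Type*} [Fintype V] (G : SimpleGraph V) [DecidableRel G.Adj] : Prop :=
  G.chromaticIndex = G.maxDegree + 1

/-- The disjoint union of `k` copies of `H`. -/
def disjointCopies {W : Type*} (k : ℕ) (H : SimpleGraph W) : SimpleGraph (Fin k × W) where
  Adj a b := a.1 = b.1 ∧ H.Adj a.2 b.2
  symm := ⟨fun _ _ h => ⟨h.1.symm, h.2.symm⟩⟩
  loopless := ⟨fun _ h => H.loopless.irrefl _ h.2⟩

end SimpleGraph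

/-! Let Δ be the maximum degree, and call a vertex full if its degree is Δ. As n is odd, every
colour class misses a vertex, so a graph that becomes Δ-colourable after deleting es edges satisfies
2|E| ≤ Δ(n-1) + 2es. For es = (n-3)/2 this reads 2|E| + 2 ≤ (Δ+1)(n-1). Under equality the
complement has minimum degree s = n-1-Δ ≤ 2 and almost constant degrees. The values s = 0, 1, 2 give
`K_n` minus an edge, the complement of a matching with a path, and the (n-3)-regular graphs.

Otherwise parity leaves a slack of 4, and some class of a (Δ+1)-colouring is a matching missing
exactly three vertices. The graph is `Stable`: deleting at most (n-5)/2 edges never makes it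
Δ-colourable. Hence deleting any matching that misses at least five vertices leaves a critical
subgraph, whose full vertices are all missed by the matching. Vizing's adjacency lemma
(`Critical.vizing_adjacency`), proved with fans and Kempe chains, gives every non-isolated vertex of
that subgraph two full neighbours. So if a matching misses three vertices that are not a triangle of
full vertices, each matched vertex has a full neighbour among the three (`Stable.exists_full_adj`).

Switching matchings by this domination first makes all matched vertices full
(`Stable.exists_full_matching`), which leaves at most two non-full vertices. With two of them, the
full vertices form a clique, and degree counts and parity disconnect it from the other two. With one
or none, it is shown that no matching misses exactly one vertex (the non-full one, if it exists).
Then the three missed vertices attract disjoint cliques: two cliques and an isolated vertex, or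
three cliques. The obstacle that recurs is a component that splits off. Its other side would be a
balanced complete multipartite graph of even order, which a round robin scheme colours with Δ
colours (`Stable.not_split`).

Conversely, a colour class supplies es ≤ (n-3)/2. The matching lower bound comes from counting edges
against the vertices missed in each odd part: one part for the dense graphs, three for the clique
unions (`sum_inner_le`). -/

namespace EdgeStability

open Classical Finset

set_option linter.unusedSectionVars false

/-! ### Edge colourings as functions on unordered pairs, and missing colours -/

variable {V : Type*} [Fintype V]

/-- The set of neighbours of a vertex. -/
noncomputable def nb (K : SimpleGraph V) (v : V) : Finset V := univ.filter (K.Adj v)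

/-- The degree of a vertex. -/
noncomputable def dg (K : SimpleGraph V) (v : V) : ℕ := (nb K v).card

@[simp] lemma mem_nb {K : SimpleGraph V} {v w : V} : w ∈ nb K v ↔ K.Adj v w := by simp [nb]

lemma nb_mono {K H : SimpleGraph V} (h : K ≤ H) (v : V) : nb K v ⊆ nb H v := fun w hw => by
  rw [mem_nb] at *; exact h hw

lemma dg_mono {K H : SimpleGraph V} (h : K ≤ H) (v : V) : dg K v ≤ dg H v :=
  card_le_card (nb_mono h v)

/-- `φ` restricted to the edges of `K` is a proper edge colouring with colours below `c`. -/
def ProperEdgeLabel (K : SimpleGraph V) (c : ℕ) (φ : Sym2 V → ℕ) : Prop :=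
  (∀ a b, K.Adj a b → φ s(a, b) < c) ∧
    ∀ v a b, K.Adj v a → K.Adj v b → φ s(v, a) = φ s(v, b) → a = b

/-- `K` has a proper edge colouring with `c` colours. -/
def EdgeColorable (K : SimpleGraph V) (c : ℕ) : Prop := ∃ φ, ProperEdgeLabel K c φ

lemma ProperEdgeLabel.mono {K H : SimpleGraph V} {c : ℕ} {φ : Sym2 V → ℕ}
    (h : ProperEdgeLabel H c φ) (hK : K ≤ H) : ProperEdgeLabel K c φ :=
  ⟨fun a b hab => h.1 a b (hK hab), fun v a b ha hb => h.2 v a b (hK ha) (hK hb)⟩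

lemma EdgeColorable.mono {K H : SimpleGraph V} {c : ℕ} (h : EdgeColorable H c) (hK : K ≤ H) :
    EdgeColorable K c := h.imp fun _ hφ => hφ.mono hK

/-- The colours below `c` which do not appear at `v`. -/
noncomputable def missing (K : SimpleGraph V) (c : ℕ) (φ : Sym2 V → ℕ) (v : V) : Finset ℕ :=
  (range c).filter fun β => ∀ a, K.Adj v a → φ s(v, a) ≠ β

lemma mem_missing {K : SimpleGraph V} {c : ℕ} {φ : Sym2 V → ℕ} {v : V} {β : ℕ} :
    β ∈ missing K c φ v ↔ β < c ∧ ∀ a, K.Adj v a → φ s(v, a) ≠ β := by simp [missing]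

lemma card_missing {K : SimpleGraph V} {c : ℕ} {φ : Sym2 V → ℕ} (h : ProperEdgeLabel K c φ)
    (v : V) : (missing K c φ v).card + dg K v = c := by
  have h1 : missing K c φ v = range c \ (nb K v).image (fun a => φ s(v, a)) := by
    ext β; simp [mem_missing]
  have h2 : ((nb K v).image (fun a => φ s(v, a))).card = dg K v :=
    card_image_of_injOn fun a ha b hb => h.2 v a b (by simpa using ha) (by simpa using hb)
  have h3 : (nb K v).image (fun a => φ s(v, a)) ⊆ range c := by
    intro β hβ
    simp only [mem_image, mem_nb, mem_range] at *
    obtain ⟨a, ha, rfl⟩ := hβ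
    exact h.1 _ _ ha
  rw [h1, ← h2, card_sdiff_add_card_eq_card h3, card_range]

/-! ### Fans -/

/-- The vertices `v` reachable in `n` steps along a fan at `x` starting with the uncoloured edge
`xy`. -/
def FanReach (K : SimpleGraph V) (c : ℕ) (φ : Sym2 V → ℕ) (x y : V) : ℕ → V → Prop
  | 0, v => v = y
  | n + 1, v => ∃ u, FanReach K c φ x y n u ∧ K.Adj x v ∧ φ s(x, v) ∈ missing K c φ u

lemma FanReach.ne {K : SimpleGraph V} {c : ℕ} {φ : Sym2 V → ℕ} {x y : V} (hxy : x ≠ y) {n : ℕ}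
    {v : V} (h : FanReach K c φ x y n v) : v ≠ x := by
  cases n with
  | zero => rintro rfl; exact hxy h
  | succ n => obtain ⟨u, -, h, -⟩ := h; exact h.ne'

lemma sym2_eq_left {x a b : V} : s(x, a) = s(x, b) ↔ a = b :=
  Sym2.congr_right

/-- Recolouring an edge with a colour missing at both ends. -/
lemma ProperEdgeLabel.update {K : SimpleGraph V} {c : ℕ} {φ : Sym2 V → ℕ} {x z : V} {α : ℕ}
    (h : ProperEdgeLabel K c φ) (hx : α ∈ missing K c φ x) (hz : α ∈ missing K c φ z) :
    ProperEdgeLabel K c (Function.update φ s(x, z) α) := by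
  rw [mem_missing] at hx hz
  have key : ∀ v a b, K.Adj v a → K.Adj v b → s(v, a) = s(x, z) → φ s(v, b) = α → False := by
    intro v a b ha hb he h1
    rcases Sym2.eq_iff.1 he with ⟨rfl, rfl⟩ | ⟨rfl, rfl⟩
    · exact hx.2 _ hb h1
    · exact hz.2 _ hb h1
  refine ⟨fun a b hab => ?_, fun v a b ha hb hf => ?_⟩
  · rw [Function.update_apply]
    split_ifs
    · exact hx.1
    · exact h.1 _ _ hab
  · rw [Function.update_apply, Function.update_apply] at hf
    split_ifs at hf with h1 h2 h2
    · exact sym2_eq_left.1 (h1.trans h2.symm)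
    · exact (key v a b ha hb h1 hf.symm).elim
    · exact (key v b a hb ha h2 hf).elim
    · exact h.2 v a b ha hb hf

lemma missing_update {K : SimpleGraph V} {c : ℕ} {φ : Sym2 V → ℕ} {x z u : V} {α : ℕ}
    (hx : u ≠ x) (hz : u ≠ z) :
    missing K c (Function.update φ s(x, z) α) u = missing K c φ u := by
  ext β
  rw [mem_missing, mem_missing]
  refine and_congr_right fun _ => forall_congr' fun a => ?_
  rw [Function.update_of_ne]
  intro h
  rcases Sym2.eq_iff.1 h with ⟨rfl, rfl⟩ | ⟨rfl, rfl⟩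
  · exact hx rfl
  · exact hz rfl

/-- This rotates a fan one edge at a time. If α is missing at `x` and at a fan vertex `z`,
recolouring `xz` with α frees the old colour at `x`, where it is shared with the predecessor of `z`.
Taking `n` minimal for `z` keeps the earlier fan intact, so induction applies to the new colouring.
-/
lemma fan_disjoint {K : SimpleGraph V} {c : ℕ} {x y : V} (hxy : x ≠ y)
    (hno : ∀ φ, ProperEdgeLabel K c φ → Disjoint (missing K c φ x) (missing K c φ y)) :
    ∀ (n : ℕ) (φ : Sym2 V → ℕ) (z : V), ProperEdgeLabel K c φ → FanReach K c φ x y n z →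
      Disjoint (missing K c φ x) (missing K c φ z) := by
  intro n
  induction n using Nat.strong_induction_on with
  | _ n ih =>
  intro φ z hφ hz
  by_cases hmin : ∃ k < n, FanReach K c φ x y k z
  · obtain ⟨k, hk, hkz⟩ := hmin
    exact ih k hk φ z hφ hkz
  push Not at hmin
  cases n with
  | zero => cases hz; exact hno φ hφ
  | succ n =>
  obtain ⟨u, hu, hadj, hβ⟩ := hz
  rw [Finset.disjoint_left]
  intro α hαx hαz
  have hφ' := hφ.update hαx hαz
  set φ' := Function.update φ s(x, z) α with hdef
  have hne : ∀ k ≤ n, ∀ v, FanReach K c φ x y k v → v ≠ z := by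
    rintro k hk v hv rfl
    exact hmin k (by omega) hv
  have hpres : ∀ k ≤ n, ∀ v, FanReach K c φ x y k v → FanReach K c φ' x y k v := by
    intro k
    induction k with
    | zero => intro _ v hv; exact hv
    | succ k ihk =>
      rintro hk v ⟨w, hw, hxv, hm⟩
      refine ⟨w, ihk (by omega) w hw, hxv, ?_⟩
      rw [hdef, missing_update (hw.ne hxy) (hne k (by omega) w hw), Function.update_of_ne]
      · exact hm
      · rw [Ne, sym2_eq_left]
        exact hne (k + 1) hk v ⟨w, hw, hxv, hm⟩
  -- The old colour of `xz` is now missing at `x`, and it is still missing at `u`, which is reached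
  -- in one step fewer.
  have hu' := hpres n le_rfl u hu
  have hd := Finset.disjoint_left.1 (ih n (by omega) φ' u hφ' hu')
  refine @hd (φ s(x, z)) ?_ ?_
  · rw [mem_missing]
    refine ⟨hφ.1 _ _ hadj, fun a ha => ?_⟩
    by_cases haz : a = z
    · subst haz
      rw [hdef, Function.update_self]
      exact fun h => (mem_missing.1 hαx).2 _ ha h.symm
    · rw [hdef, Function.update_of_ne (by rwa [Ne, sym2_eq_left])]
      exact fun h => haz (hφ.2 _ _ _ ha hadj h)
  · rw [hdef, missing_update (hu.ne hxy) (hne n le_rfl u hu)]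
    exact hβ

/-! ### Kempe chains -/

/-- The subgraph formed by two colour classes. -/
def kempe (K : SimpleGraph V) (φ : Sym2 V → ℕ) (α β : ℕ) : SimpleGraph V where
  Adj a b := K.Adj a b ∧ (φ s(a, b) = α ∨ φ s(a, b) = β)
  symm := ⟨fun a b h => ⟨h.1.symm, by rw [Sym2.eq_swap]; exact h.2⟩⟩
  loopless := ⟨fun a h => h.1.ne rfl⟩

/-- Interchange of two colours on the edges meeting `C`. -/
noncomputable def kempeSwap (φ : Sym2 V → ℕ) (α β : ℕ) (C : Set V) (e : Sym2 V) : ℕ :=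
  if ∃ v ∈ e, v ∈ C then Equiv.swap α β (φ e) else φ e

section kempe

variable {K : SimpleGraph V} {c : ℕ} {φ : Sym2 V → ℕ} {α β : ℕ} {C : Set V}

lemma kempeSwap_apply (hC : ∀ a b, (kempe K φ α β).Adj a b → (a ∈ C ↔ b ∈ C)) {v a : V}
    (h : K.Adj v a) :
    kempeSwap φ α β C s(v, a) = if v ∈ C then Equiv.swap α β (φ s(v, a)) else φ s(v, a) := by
  rw [kempeSwap]
  by_cases hv : v ∈ C
  · rw [if_pos ⟨v, by simp, hv⟩, if_pos hv]
  · rw [if_neg hv]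
    split_ifs with h1
    · obtain ⟨u, hu, huC⟩ := h1
      rcases Sym2.mem_iff.1 hu with rfl | rfl
      · exact (hv huC).elim
      · rw [Equiv.swap_apply_of_ne_of_ne]
        · intro h2; exact hv ((hC v u ⟨h, Or.inl h2⟩).2 huC)
        · intro h2; exact hv ((hC v u ⟨h, Or.inr h2⟩).2 huC)
    · rfl

lemma ProperEdgeLabel.kempeSwap (hφ : ProperEdgeLabel K c φ) (hα : α < c) (hβ : β < c)
    (hC : ∀ a b, (kempe K φ α β).Adj a b → (a ∈ C ↔ b ∈ C)) :
    ProperEdgeLabel K c (kempeSwap φ α β C) := by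
  refine ⟨fun a b hab => ?_, fun v a b ha hb h => ?_⟩
  · rw [kempeSwap_apply hC hab]
    have := hφ.1 _ _ hab
    split_ifs
    · rw [Equiv.swap_apply_def]; split_ifs <;> assumption
    · exact this
  · rw [kempeSwap_apply hC ha, kempeSwap_apply hC hb] at h
    split_ifs at h
    · exact hφ.2 _ _ _ ha hb ((Equiv.swap α β).injective h)
    · exact hφ.2 _ _ _ ha hb h

lemma mem_missing_kempeSwap (hα : α < c) (hβ : β < c)
    (hC : ∀ a b, (kempe K φ α β).Adj a b → (a ∈ C ↔ b ∈ C)) {v : V} {γ : ℕ} :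
    γ ∈ missing K c (kempeSwap φ α β C) v ↔
      (if v ∈ C then Equiv.swap α β γ else γ) ∈ missing K c φ v := by
  rw [mem_missing, mem_missing]
  by_cases hv : v ∈ C
  · rw [if_pos hv]
    refine and_congr ?_ (forall_congr' fun a => imp_congr_right fun ha => ?_)
    · rw [Equiv.swap_apply_def]; split_ifs <;> simp_all
    · rw [kempeSwap_apply hC ha, if_pos hv, Ne, Ne, Equiv.swap_apply_eq_iff]
  · rw [if_neg hv]
    refine and_congr_right fun _ => forall_congr' fun a => imp_congr_right fun ha => ?_
    rw [kempeSwap_apply hC ha, if_neg hv]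

lemma dg_kempe_le_two (hφ : ProperEdgeLabel K c φ) (v : V) : dg (kempe K φ α β) v ≤ 2 := by
  refine (card_le_card_of_injOn (t := {α, β}) (fun a => φ s(v, a)) ?_ ?_).trans card_le_two
  · intro a ha
    have := (mem_nb.1 ha).2
    simpa using this
  · intro a ha b hb
    exact hφ.2 v a b (mem_nb.1 ha).1 (mem_nb.1 hb).1

lemma dg_kempe_le_one (hφ : ProperEdgeLabel K c φ) {v : V}
    (h : α ∈ missing K c φ v ∨ β ∈ missing K c φ v) : dg (kempe K φ α β) v ≤ 1 := by
  refine card_le_one.2 fun a ha b hb => ?_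
  rw [mem_nb] at ha hb
  refine hφ.2 v a b ha.1 hb.1 ?_
  rcases h with h | h
  · have h1 := (mem_missing.1 h).2 a ha.1
    have h2 := (mem_missing.1 h).2 b hb.1
    rw [ha.2.resolve_left h1, hb.2.resolve_left h2]
  · have h1 := (mem_missing.1 h).2 a ha.1
    have h2 := (mem_missing.1 h).2 b hb.1
    rw [ha.2.resolve_right h1, hb.2.resolve_right h2]

end kempe

lemma dg_eq_degree (H : SimpleGraph V) (v : V) [Fintype (H.neighborSet v)] :
    dg H v = H.degree v := by
  rw [← SimpleGraph.card_neighborFinset_eq_degree, dg]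
  congr 1
  ext; simp

/-- A connected graph of maximum degree at most two has at most two vertices of degree at most
one. -/
lemma three_ends_false {H : SimpleGraph V} (h2 : ∀ v, dg H v ≤ 2) {x y z : V} (hxy : x ≠ y)
    (hxz : x ≠ z) (hyz : y ≠ z) (hry : H.Reachable x y) (hrz : H.Reachable x z)
    (hx : dg H x ≤ 1) (hy : dg H y ≤ 1) (hz : dg H z ≤ 1) : False := by
  set C := H.connectedComponentMk x with hC
  have hyC : y ∈ C.supp := by
    rw [hC, SimpleGraph.ConnectedComponent.mem_supp_iff, SimpleGraph.ConnectedComponent.eq]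
    exact hry.symm
  have hzC : z ∈ C.supp := by
    rw [hC, SimpleGraph.ConnectedComponent.mem_supp_iff, SimpleGraph.ConnectedComponent.eq]
    exact hrz.symm
  have hxC : x ∈ C.supp := rfl
  set L := H.induce C.supp with hL
  have hconn : L.Connected := C.connected_toSimpleGraph
  have hle := hconn.card_vert_le_card_edgeSet_add_one
  have hdeg := L.sum_degrees_eq_twice_card_edges
  rw [Nat.card_eq_fintype_card, Nat.card_eq_fintype_card, ← SimpleGraph.edgeFinset_card] at hle
  have hdl : ∀ v : C.supp, L.degree v ≤ dg H v := by
    intro v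
    rw [← SimpleGraph.card_neighborFinset_eq_degree]
    refine card_le_card_of_injOn (fun a => a.1) ?_ (fun a _ b _ h => Subtype.ext h)
    intro a ha
    have h : L.Adj v a := by simpa using ha
    exact mem_nb.2 h
  -- Three vertices of degree at most one bring the degree sum down to 2|C| - 3, too little for the
  -- |C| - 1 edges of a connected graph.
  have hb : ∀ v : C.supp, L.degree v + (if v.1 = x then 1 else 0) + (if v.1 = y then 1 else 0)
      + (if v.1 = z then 1 else 0) ≤ 2 := by
    intro v
    have h1 := hdl v
    have h3 := h2 v.1
    by_cases hvx : v.1 = x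
    · rw [hvx] at h1; simp [hvx, hxy, hxz]; omega
    by_cases hvy : v.1 = y
    · rw [hvy] at h1; simp [hvy, hxy.symm, hyz]; omega
    by_cases hvz : v.1 = z
    · rw [hvz] at h1; simp [hvz, hxz.symm, hyz.symm]; omega
    simp [hvx, hvy, hvz]; omega
  have hsum := Finset.sum_le_sum (s := univ) (fun v _ => hb v)
  have hone : ∀ w, w ∈ C.supp → ∑ v : C.supp, (if v.1 = w then 1 else 0) = 1 := by
    intro w hw
    rw [Finset.sum_eq_single ⟨w, hw⟩] <;> simp
  simp only [sum_add_distrib, hone x hxC, hone y hyC, hone z hzC, sum_const, card_univ,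
    smul_eq_mul] at hsum
  omega

/-- If the chain through `z` avoided `x`, interchanging α and β on it would make α missing at a fan
vertex while it stays missing at `x`, against `fan_disjoint`. -/
lemma fan_reachable {K : SimpleGraph V} {c : ℕ} {x y : V} (hxy : x ≠ y)
    (hno : ∀ φ, ProperEdgeLabel K c φ → Disjoint (missing K c φ x) (missing K c φ y))
    {φ : Sym2 V → ℕ} (hφ : ProperEdgeLabel K c φ) {n : ℕ} {z : V} (hz : FanReach K c φ x y n z)
    {α β : ℕ} (hα : α ∈ missing K c φ x) (hβ : β ∈ missing K c φ z) :
    (kempe K φ α β).Reachable x z := by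
  by_contra hnr
  set C : Set V := {v | (kempe K φ α β).Reachable z v} with hCdef
  have hC : ∀ a b, (kempe K φ α β).Adj a b → (a ∈ C ↔ b ∈ C) := fun a b hab =>
    ⟨fun h => h.trans hab.reachable, fun h => h.trans hab.symm.reachable⟩
  have hxC : x ∉ C := fun h => hnr h.symm
  have hzC : z ∈ C := SimpleGraph.Reachable.refl z
  have hαc := (mem_missing.1 hα).1
  have hβc := (mem_missing.1 hβ).1
  have hφ' := hφ.kempeSwap hαc hβc hC
  set φ' := kempeSwap φ α β C with hdef
  have hmx : ∀ γ, γ ∈ missing K c φ' x ↔ γ ∈ missing K c φ x := fun γ => by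
    rw [hdef, mem_missing_kempeSwap hαc hβc hC, if_neg hxC]
  have hβα : ∀ u, u ∈ C → β ∈ missing K c φ u → α ∈ missing K c φ' u := fun u hu h => by
    rw [hdef, mem_missing_kempeSwap hαc hβc hC, if_pos hu, Equiv.swap_apply_left]; exact h
  -- Edges at `x` keep their colours. A fan step from `u` is destroyed only when `u` lies on the
  -- chain and the step uses β; then α is missing at `u` after the interchange, which is just as
  -- good.
  have key : ∀ k v, FanReach K c φ x y k v → FanReach K c φ' x y k v ∨
      ∃ j w, FanReach K c φ' x y j w ∧ α ∈ missing K c φ' w := by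
    intro k
    induction k with
    | zero => intro v hv; exact Or.inl hv
    | succ k ih =>
      rintro v ⟨u, hu, hxv, hm⟩
      rcases ih u hu with hu' | h
      · have hcol : φ' s(x, v) = φ s(x, v) := by
          rw [hdef, kempeSwap_apply hC hxv, if_neg hxC]
        have hneα : φ s(x, v) ≠ α := (mem_missing.1 hα).2 v hxv
        by_cases huC : u ∈ C
        · by_cases hγ : φ s(x, v) = β
          · exact Or.inr ⟨k, u, hu', hβα u huC (hγ ▸ hm)⟩
          · refine Or.inl ⟨u, hu', hxv, ?_⟩
            rw [hcol, hdef, mem_missing_kempeSwap hαc hβc hC, if_pos huC,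
              Equiv.swap_apply_of_ne_of_ne hneα hγ]
            exact hm
        · refine Or.inl ⟨u, hu', hxv, ?_⟩
          rw [hcol, hdef, mem_missing_kempeSwap hαc hβc hC, if_neg huC]
          exact hm
      · exact Or.inr h
  have hend : ∃ j w, FanReach K c φ' x y j w ∧ α ∈ missing K c φ' w := by
    rcases key n z hz with h | h
    · exact ⟨n, z, h, hβα z hzC hβ⟩
    · exact h
  obtain ⟨j, w, hw, hαw⟩ := hend
  exact Finset.disjoint_left.1 (fan_disjoint hxy hno j φ' w hφ' hw) ((hmx α).2 hα) hαw

/-- Fan inequality at an uncoloured edge `xy`. -/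
lemma fan_count {K : SimpleGraph V} {c : ℕ} {x y : V} (hxy : x ≠ y) (hnadj : ¬ K.Adj x y)
    (hno : ∀ φ, ProperEdgeLabel K c φ → Disjoint (missing K c φ x) (missing K c φ y))
    {φ : Sym2 V → ℕ} (hφ : ProperEdgeLabel K c φ) (hx : dg K x < c) :
    c ≤ dg K y + ((nb K x).filter fun z => dg K z = c).card := by
  set A : Finset V := univ.filter fun z => ∃ n, FanReach K c φ x y n z with hA
  have hyA : y ∈ A := by rw [hA, mem_filter]; exact ⟨mem_univ _, 0, rfl⟩
  obtain ⟨α, hα⟩ : (missing K c φ x).Nonempty := by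
    rw [← card_pos]; have := card_missing hφ x; omega
  -- A colour β missing at two fan vertices would make both of them, and `x`, ends of one αβ-chain.
  have hdisj : ∀ z ∈ A, ∀ w ∈ A, z ≠ w → Disjoint (missing K c φ z) (missing K c φ w) := by
    intro z hz w hw hzw
    rw [hA, mem_filter] at hz hw
    obtain ⟨-, n, hn⟩ := hz
    obtain ⟨-, m, hm⟩ := hw
    rw [Finset.disjoint_left]
    intro β hβz hβw
    exact three_ends_false (H := kempe K φ α β) (dg_kempe_le_two hφ) (hn.ne hxy).symm
      (hm.ne hxy).symm hzw (fan_reachable hxy hno hφ hn hα hβz)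
      (fan_reachable hxy hno hφ hm hα hβw) (dg_kempe_le_one hφ (Or.inl hα))
      (dg_kempe_le_one hφ (Or.inr hβz)) (dg_kempe_le_one hφ (Or.inr hβw))
  -- A colour missing at a fan vertex occurs at `x`, on an edge that leads to a further fan vertex.
  -- So the disjoint missing sets have at most |A| - 1 colours in total.
  have hsub : A.biUnion (missing K c φ) ⊆ (A.erase y).image fun v => φ s(x, v) := by
    intro β hβ
    rw [mem_biUnion] at hβ
    obtain ⟨z, hz, hβz⟩ := hβ
    obtain ⟨-, n, hn⟩ := mem_filter.1 hz
    have hβx : β ∉ missing K c φ x :=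
      Finset.disjoint_right.1 (fan_disjoint hxy hno n φ z hφ hn) hβz
    have : ∃ v, K.Adj x v ∧ φ s(x, v) = β := by
      by_contra hcon
      push Not at hcon
      exact hβx (mem_missing.2 ⟨(mem_missing.1 hβz).1, hcon⟩)
    obtain ⟨v, hv, rfl⟩ := this
    refine mem_image.2 ⟨v, mem_erase.2 ⟨?_, ?_⟩, rfl⟩
    · rintro rfl; exact hnadj hv
    · rw [hA, mem_filter]; exact ⟨mem_univ _, n + 1, z, hn, hv, hβz⟩
  have hcard := (card_le_card hsub).trans card_image_le
  rw [card_biUnion fun z hz w hw h => hdisj z hz w hw h, ← add_sum_erase _ _ hyA] at hcard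
  have hAx : ∀ z ∈ A.erase y, K.Adj x z := by
    intro z hz
    obtain ⟨hzy, hz⟩ := mem_erase.1 hz
    obtain ⟨-, n, hn⟩ := mem_filter.1 hz
    cases n with
    | zero => exact (hzy hn).elim
    | succ n => obtain ⟨u, -, h, -⟩ := hn; exact h
  -- Every non-full fan vertex contributes at least one missing colour; the deficiency of `y` must
  -- therefore be paid for by full ones.
  have hlow : ((A.erase y).filter fun z => ¬ dg K z = c).card
      ≤ ∑ z ∈ A.erase y, (missing K c φ z).card := by
    rw [card_filter]
    refine sum_le_sum fun z _ => ?_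
    have := card_missing hφ z
    split_ifs <;> omega
  have hsplit := card_filter_add_card_filter_not (s := A.erase y) fun z => dg K z = c
  have hfin : ((A.erase y).filter fun z => dg K z = c).card
      ≤ ((nb K x).filter fun z => dg K z = c).card := by
    refine card_le_card fun z hz => ?_
    rw [mem_filter] at hz ⊢
    exact ⟨mem_nb.2 (hAx z hz.1), hz.2⟩
  have := card_missing hφ y
  omega

/-! ### Critical graphs and Vizing's adjacency lemma -/

/-- `K` is edge-minimal among the graphs without a proper edge colouring with `c` colours. -/
def Critical (K : SimpleGraph V) (c : ℕ) : Prop := Minimal (fun K => ¬ EdgeColorable K c) K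

lemma exists_critical {G : SimpleGraph V} {c : ℕ} (h : ¬ EdgeColorable G c) :
    ∃ K ≤ G, Critical K c :=
  exists_minimal_le_of_wellFoundedLT (fun K => ¬ EdgeColorable K c) G h

/-- Vizing's adjacency lemma. -/
theorem Critical.vizing_adjacency {K : SimpleGraph V} {c : ℕ} (hK : Critical K c)
    (hc : ∀ v, dg K v ≤ c) {x y : V} (hxy : K.Adj x y) :
    c + 1 ≤ dg K y + ((nb K x).filter fun z => z ≠ y ∧ dg K z = c).card := by
  set K0 := K.deleteEdges {s(x, y)} with hK0
  have hadj : ∀ a b, K0.Adj a b ↔ K.Adj a b ∧ s(a, b) ≠ s(x, y) := by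
    intro a b; rw [hK0, SimpleGraph.deleteEdges_adj]; simp
  have hlt : K0 < K := by
    refine lt_of_le_of_ne (SimpleGraph.deleteEdges_le _) fun h => ?_
    have := (hadj x y).1 (h ▸ hxy)
    exact this.2 rfl
  have hcol : EdgeColorable K0 c := by
    by_contra h
    exact absurd (hK.2 h hlt.le) (not_le_of_gt hlt)
  -- A colour missing at both ends would extend the colouring to `xy`.
  have hno : ∀ φ, ProperEdgeLabel K0 c φ →
      Disjoint (missing K0 c φ x) (missing K0 c φ y) := by
    intro φ hφ
    rw [Finset.disjoint_left]
    intro α hx hy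
    refine hK.1 ⟨Function.update φ s(x, y) α, ?_⟩
    have hφ' := hφ.update hx hy
    rw [mem_missing] at hx hy
    have key : ∀ v a b, K.Adj v a → K.Adj v b → s(v, a) = s(x, y) → s(v, b) ≠ s(x, y) →
        φ s(v, b) = α → False := by
      intro v a b ha hb he hne h1
      have hb' := (hadj v b).2 ⟨hb, hne⟩
      rcases Sym2.eq_iff.1 he with ⟨rfl, rfl⟩ | ⟨rfl, rfl⟩
      · exact hx.2 _ hb' h1
      · exact hy.2 _ hb' h1
    refine ⟨fun a b hab => ?_, fun v a b ha hb hf => ?_⟩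
    · rw [Function.update_apply]
      split_ifs with h
      · exact hx.1
      · exact hφ.1 _ _ ((hadj a b).2 ⟨hab, h⟩)
    · rw [Function.update_apply, Function.update_apply] at hf
      split_ifs at hf with h1 h2 h2
      · exact sym2_eq_left.1 (h1.trans h2.symm)
      · exact (key v a b ha hb h1 h2 hf.symm).elim
      · exact (key v b a hb ha h2 h1 hf).elim
      · exact hφ.2 v a b ((hadj v a).2 ⟨ha, h1⟩) ((hadj v b).2 ⟨hb, h2⟩) hf
  have hnbx : nb K0 x = (nb K x).erase y := by
    ext a; simp [hadj, hxy.ne, and_comm]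
  have hnby : nb K0 y = (nb K y).erase x := by
    ext a; simp [hadj, hxy.ne', and_comm]
  have hdx : dg K0 x + 1 = dg K x := by
    rw [dg, hnbx]; exact card_erase_add_one (mem_nb.2 hxy)
  have hdy : dg K0 y + 1 = dg K y := by
    rw [dg, hnby]; exact card_erase_add_one (mem_nb.2 hxy.symm)
  have hdz : ∀ z, z ≠ x → z ≠ y → dg K0 z = dg K z := by
    intro z hzx hzy
    rw [dg, dg]; congr 1; ext a; simp [hadj, hzx, hzy]
  obtain ⟨φ, hφ⟩ := hcol
  have hx := hc x
  -- The deletion of `xy` lowers the degrees of both ends by one: this makes `x` deficient, as the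
  -- fan needs, and turns the bound `c` into `c + 1`.
  have := fan_count hxy.ne (fun h => ((hadj x y).1 h).2 rfl) hno hφ (by omega)
  have hsub : ((nb K0 x).filter fun z => dg K0 z = c) ⊆
      ((nb K x).filter fun z => z ≠ y ∧ dg K z = c) := by
    intro z hz
    rw [mem_filter, hnbx, mem_erase, mem_nb] at hz
    rw [mem_filter, mem_nb]
    refine ⟨hz.1.2, hz.1.1, ?_⟩
    rw [← hdz z hz.1.2.ne' hz.1.1, hz.2]
  have := card_le_card hsub
  omega

/-! ### Perfect matchings of vertex sets -/

variable {V : Type*} [Fintype V]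

/-- `μ` is an involution of `S` along edges of `G`, that is, a perfect matching of `G[S]`. -/
def IsPM (G : SimpleGraph V) (S : Finset V) (μ : V → V) : Prop :=
  ∀ v ∈ S, μ v ∈ S ∧ μ (μ v) = v ∧ G.Adj v (μ v)

/-- `G[S]` has a perfect matching. -/
def HasPM (G : SimpleGraph V) (S : Finset V) : Prop := ∃ μ, IsPM G S μ

/-- The edges of a perfect matching. -/
noncomputable def pmEdges (S : Finset V) (μ : V → V) : Finset (Sym2 V) :=
  S.image fun v => s(v, μ v)

/-- The graph `G` without the edges of a matching. -/
noncomputable def cut (G : SimpleGraph V) (S : Finset V) (μ : V → V) : SimpleGraph V :=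
  G.deleteEdges (pmEdges S μ : Set (Sym2 V))

section matching

variable {G : SimpleGraph V} {S : Finset V} {μ : V → V}

lemma cut_adj (h : IsPM G S μ) {a b : V} :
    (cut G S μ).Adj a b ↔ G.Adj a b ∧ ¬ (a ∈ S ∧ μ a = b) := by
  rw [cut, SimpleGraph.deleteEdges_adj]
  refine and_congr_right fun _ => not_congr ?_
  rw [pmEdges, mem_coe, mem_image]
  constructor
  · rintro ⟨v, hv, he⟩
    rcases Sym2.eq_iff.1 he with ⟨rfl, rfl⟩ | ⟨rfl, rfl⟩
    · exact ⟨hv, rfl⟩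
    · exact ⟨(h v hv).1, (h v hv).2.1⟩
  · rintro ⟨ha, rfl⟩
    exact ⟨a, ha, rfl⟩

lemma cut_le : cut G S μ ≤ G := SimpleGraph.deleteEdges_le _

lemma two_mul_card_pmEdges_le (h : IsPM G S μ) : 2 * (pmEdges S μ).card ≤ S.card := by
  refine mul_card_image_le_card_of_maps_to (f := fun v => s(v, μ v)) ?_ 2 ?_
  · intro v hv; exact mem_image_of_mem _ hv
  · intro e he
    obtain ⟨v, hv, rfl⟩ := mem_image.1 he
    obtain ⟨h1, h2, h3⟩ := h v hv
    refine one_lt_card.2 ⟨v, ?_, μ v, ?_, h3.ne⟩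
    · simp [hv]
    · simp [h1, h2]

lemma IsPM.ne (h : IsPM G S μ) {v : V} (hv : v ∈ S) : μ v ≠ v := (h v hv).2.2.ne'

lemma IsPM.inj (h : IsPM G S μ) {v w : V} (hv : v ∈ S) (hw : w ∈ S) (he : μ v = μ w) : v = w := by
  rw [← (h v hv).2.1, he, (h w hw).2.1]

lemma IsPM.mono (h : IsPM G S μ) {T : Finset V} (hT : T ⊆ S) (hc : ∀ v ∈ T, μ v ∈ T) :
    IsPM G T μ := fun v hv => ⟨hc v hv, (h v (hT hv)).2⟩

lemma IsPM.erase_pair (h : IsPM G S μ) {v : V} (hv : v ∈ S) : IsPM G (S \ {v, μ v}) μ := by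
  refine h.mono sdiff_subset fun x hx => ?_
  simp only [mem_sdiff, mem_insert, mem_singleton, not_or] at hx ⊢
  refine ⟨(h x hx.1).1, fun he => hx.2.2 ?_, fun he => hx.2.1 (h.inj hx.1 hv he)⟩
  rw [← he, (h x hx.1).2.1]

lemma HasPM.congr (h : HasPM G S) {T : Finset V} (hT : S = T) : HasPM G T := hT ▸ h

lemma HasPM.add_edge (h : HasPM G S) {a b : V} (hab : G.Adj a b) (ha : a ∉ S) (hb : b ∉ S) :
    HasPM G (insert a (insert b S)) := by
  obtain ⟨μ, hμ⟩ := h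
  refine ⟨fun v => if v = a then b else if v = b then a else μ v, fun v hv => ?_⟩
  rw [mem_insert, mem_insert] at hv
  by_cases hva : v = a
  · subst hva; simp [hab, hab.ne']
  by_cases hvb : v = b
  · subst hvb; simp [hab.symm, hab.ne']
  have hvS := (hv.resolve_left hva).resolve_left hvb
  obtain ⟨h1, h2, h3⟩ := hμ v hvS
  have h4 : μ v ≠ a := fun h => ha (h ▸ h1)
  have h5 : μ v ≠ b := fun h => hb (h ▸ h1)
  simp [hva, hvb, h4, h5, h1, h2, h3]

lemma HasPM.union {T : Finset V} (h : HasPM G S) (h' : HasPM G T) (hd : Disjoint S T) :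
    HasPM G (S ∪ T) := by
  obtain ⟨μ, hμ⟩ := h
  obtain ⟨ν, hν⟩ := h'
  refine ⟨fun v => if v ∈ S then μ v else ν v, fun v hv => ?_⟩
  by_cases hvS : v ∈ S
  · obtain ⟨h1, h2, h3⟩ := hμ v hvS
    simp [hvS, h1, h2, h3]
  · have hvT := (mem_union.1 hv).resolve_left hvS
    obtain ⟨h1, h2, h3⟩ := hν v hvT
    have := Finset.disjoint_right.1 hd h1
    simp [hvS, this, h1, h2, h3]

lemma hasPM_empty : HasPM G ∅ := ⟨id, fun v hv => by simp at hv⟩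

lemma IsPM.even_card (h : IsPM G S μ) : Even S.card := by
  have : ∑ v ∈ S, (1 : ZMod 2) = 0 := by
    refine Finset.sum_involution (fun v _ => μ v) ?_ ?_ ?_ ?_
    · intro v _; decide
    · intro v hv _; exact h.ne hv
    · intro v hv; exact (h v hv).1
    · intro v hv; exact (h v hv).2.1
  rw [sum_const, nsmul_eq_mul, mul_one] at this
  exact (ZMod.natCast_eq_zero_iff_even).1 this

end matching

/-! ### Full vertices of critical graphs -/

section critical

variable {K G : SimpleGraph V} {Δ : ℕ}

lemma Critical.exists_adj (hK : Critical K Δ) : ∃ x y, K.Adj x y := by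
  by_contra h
  push Not at h
  exact hK.1 ⟨fun _ => 0, fun a b hab => (h a b hab).elim, fun v a b hab => (h v a hab).elim⟩

/-- The adjacency lemma at `xy` gives a full neighbour `z` of `x`; applied again at `xz` it gives
one different from `z`. -/
lemma Critical.two_full (hK : Critical K Δ) (hΔ : ∀ v, dg K v ≤ Δ) {x y : V} (hxy : K.Adj x y) :
    ∃ z₁ z₂, z₁ ≠ z₂ ∧ K.Adj x z₁ ∧ K.Adj x z₂ ∧ dg K z₁ = Δ ∧ dg K z₂ = Δ := by
  have h1 := hK.vizing_adjacency hΔ hxy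
  have := hΔ y
  obtain ⟨z, hz⟩ : ((nb K x).filter fun z => z ≠ y ∧ dg K z = Δ).Nonempty := by
    rw [← card_pos]; omega
  rw [mem_filter, mem_nb] at hz
  have h2 := hK.vizing_adjacency hΔ hz.1
  obtain ⟨z', hz'⟩ : ((nb K x).filter fun z' => z' ≠ z ∧ dg K z' = Δ).Nonempty := by
    rw [← card_pos]; omega
  rw [mem_filter, mem_nb] at hz'
  exact ⟨z, z', hz'.2.1.symm, hz.1, hz'.1, hz.2.2, hz'.2.2⟩

lemma full_of_le (hΔ : ∀ v, dg G v ≤ Δ) (hKG : K ≤ G) {z : V} (hz : dg K z = Δ) :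
    dg G z = Δ ∧ ∀ a, G.Adj z a → K.Adj z a := by
  have h1 := dg_mono hKG z
  have h2 := hΔ z
  have h3 : nb K z = nb G z := eq_of_subset_of_card_le (nb_mono hKG z) (by
    change dg G z ≤ dg K z; omega)
  refine ⟨by omega, fun a ha => ?_⟩
  rw [← mem_nb, h3, mem_nb]; exact ha

/-- A vertex with degree Δ in a subgraph keeps all its edges, hence lost none to the deleted
matching. -/
lemma not_mem_of_full {S : Finset V} {μ : V → V} (hμ : IsPM G S μ) (hΔ : ∀ v, dg G v ≤ Δ)
    (hKG : K ≤ cut G S μ) {z : V} (hz : dg K z = Δ) : z ∉ S := fun hzS => by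
  have h := hKG ((full_of_le hΔ (hKG.trans cut_le) hz).2 _ (hμ z hzS).2.2)
  exact ((cut_adj hμ).1 h).2 ⟨hzS, rfl⟩

/-- If the vertices of full degree of a critical graph lie in a set `T` of three vertices, then
they are exactly `T`, which spans a triangle. -/
lemma Critical.triangle (hK : Critical K Δ) (hΔ : ∀ v, dg K v ≤ Δ) {T : Finset V}
    (hT : T.card ≤ 3) (hfull : ∀ z, dg K z = Δ → z ∈ T) :
    ∀ u ∈ T, dg K u = Δ ∧ ∀ v ∈ T, u ≠ v → K.Adj u v := by
  obtain ⟨x, y, hxy⟩ := hK.exists_adj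
  obtain ⟨a, -, -, hxa, -, ha, -⟩ := hK.two_full hΔ hxy
  obtain ⟨b, c, hbc, hab, hac, hb, hc⟩ := hK.two_full hΔ hxa.symm
  have hTeq : T = {a, b, c} := by
    symm
    apply eq_of_subset_of_card_le
    · intro z hz
      simp only [mem_insert, mem_singleton] at hz
      rcases hz with rfl | rfl | rfl
      exacts [hfull _ ha, hfull _ hb, hfull _ hc]
    · rw [card_eq_three.2 ⟨a, b, c, hab.ne, hac.ne, hbc, rfl⟩]; exact hT
  -- Both full neighbours of `b` lie in `T` and differ from `b`, so they are `a` and `c`.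
  have hbc' : K.Adj b c := by
    obtain ⟨z₁, z₂, hne, h1, h2, hz1, hz2⟩ := hK.two_full hΔ hab.symm
    have m1 := hfull _ hz1
    have m2 := hfull _ hz2
    rw [hTeq] at m1 m2
    simp only [mem_insert, mem_singleton] at m1 m2
    have := h1.ne; have := h2.ne
    rcases m1 with rfl | rfl | rfl <;> rcases m2 with rfl | rfl | rfl <;> first | assumption | simp_all
  rw [hTeq]
  intro u hu
  simp only [mem_insert, mem_singleton] at hu ⊢
  refine ⟨by rcases hu with rfl | rfl | rfl <;> assumption, fun v hv huv => ?_⟩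
  have := hab.symm; have := hac.symm; have := hbc'.symm
  rcases hu with rfl | rfl | rfl <;> rcases hv with rfl | rfl | rfl <;>
    first | assumption | exact (huv rfl).elim

end critical

/-! ### Stable graphs: domination by the missed vertices -/

/-- The maximum degree of `G` is at most `Δ`, and no set of at most `(|V| - 5) / 2` edges meets all
colourings with `Δ` colours. -/
structure Stable (G : SimpleGraph V) (Δ : ℕ) : Prop where
  dg_le : ∀ v, dg G v ≤ Δ
  not_colorable : ∀ F : Finset (Sym2 V), 2 * F.card + 5 ≤ Fintype.card V →
    ¬ EdgeColorable (G.deleteEdges (F : Set (Sym2 V))) Δ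

section stable

variable {G : SimpleGraph V} {Δ : ℕ} {S : Finset V} {μ : V → V}

lemma Stable.exists_critical (hG : Stable G Δ) (hμ : IsPM G S μ)
    (hS : S.card + 5 ≤ Fintype.card V) : ∃ K ≤ cut G S μ, Critical K Δ ∧ ∀ v, dg K v ≤ Δ := by
  have := two_mul_card_pmEdges_le hμ
  obtain ⟨K, hK, hc⟩ := EdgeStability.exists_critical (hG.not_colorable (pmEdges S μ) (by omega))
  exact ⟨K, hK, hc, fun v => (dg_mono (hK.trans cut_le) v).trans (hG.dg_le v)⟩

lemma card_erase_pair (hμ : IsPM G S μ) {p : V} (hp : p ∈ S) :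
    (S \ {p, μ p}).card + 2 = S.card := by
  have h : ({p, μ p} : Finset V) ⊆ S := by
    intro x hx
    simp only [mem_insert, mem_singleton] at hx
    rcases hx with rfl | rfl
    exacts [hp, (hμ _ hp).1]
  rw [← card_sdiff_add_card_eq_card h, card_pair (hμ.ne hp).symm]

/-- A critical subgraph avoiding the matching would have all its full vertices among the three
missed ones, and `Critical.triangle` would make these a triangle of full vertices. -/
lemma colorable_of_not_triangle (hΔ : ∀ v, dg G v ≤ Δ) (hμ : IsPM G S μ)
    (hS : S.card + 3 = Fintype.card V)
    (hnt : ¬ ∀ u ∉ S, dg G u = Δ ∧ ∀ v ∉ S, u ≠ v → G.Adj u v) :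
    EdgeColorable (cut G S μ) Δ := by
  by_contra hcol
  obtain ⟨K, hK, hc⟩ := EdgeStability.exists_critical hcol
  have hKΔ : ∀ v, dg K v ≤ Δ := fun v => (dg_mono (hK.trans cut_le) v).trans (hΔ v)
  have hT : (Sᶜ).card ≤ 3 := by rw [card_compl]; omega
  have := hc.triangle hKΔ hT fun z hz => mem_compl.2 (not_mem_of_full hμ hΔ hK hz)
  refine hnt fun u hu => ?_
  obtain ⟨h1, h2⟩ := this u (mem_compl.2 hu)
  exact ⟨(full_of_le hΔ (hK.trans cut_le) h1).1, fun v hv huv =>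
    (hK.trans cut_le) (h2 v (mem_compl.2 hv) huv)⟩

/-- The edge from `p` to its partner is put back into the colourable graph. By stability the result
contains a critical subgraph, which must use this edge; the adjacency lemma there counts full
neighbours of `p`, all of them missed by the matching. -/
lemma Stable.dominated (hG : Stable G Δ) (hμ : IsPM G S μ) (hS : S.card + 3 = Fintype.card V)
    (hcol : EdgeColorable (cut G S μ) Δ) {p : V} (hp : p ∈ S) :
    Δ + 1 ≤ dg G (μ p) + ((nb G p).filter fun z => z ∉ S ∧ dg G z = Δ).card := by
  have hcard := card_erase_pair hμ hp
  have hμ' := hμ.erase_pair hp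
  obtain ⟨K, hK, hc, hKΔ⟩ := hG.exists_critical hμ' (by omega)
  have hpr : K.Adj p (μ p) := by
    by_contra hpr
    refine hc.1 (hcol.mono fun a b hab => ?_)
    have h1 := (cut_adj hμ').1 (hK hab)
    refine (cut_adj hμ).2 ⟨h1.1, fun h2 => h1.2 ⟨?_, h2.2⟩⟩
    simp only [mem_sdiff, mem_insert, mem_singleton, not_or]
    refine ⟨h2.1, ?_, ?_⟩
    · rintro rfl; exact hpr (h2.2 ▸ hab)
    · rintro rfl
      rw [(hμ p hp).2.1] at h2
      exact hpr (h2.2 ▸ hab.symm)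
  have h1 := hc.vizing_adjacency hKΔ hpr
  have h2 : ((nb K p).filter fun z => z ≠ μ p ∧ dg K z = Δ) ⊆
      ((nb G p).filter fun z => z ∉ S ∧ dg G z = Δ) := by
    intro z hz
    rw [mem_filter, mem_nb] at hz ⊢
    have h3 := not_mem_of_full hμ' hG.dg_le hK hz.2.2
    refine ⟨(hK.trans cut_le) hz.1, fun hzS => h3 ?_,
      (full_of_le hG.dg_le (hK.trans cut_le) hz.2.2).1⟩
    simp only [mem_sdiff, mem_insert, mem_singleton, not_or]
    exact ⟨hzS, hz.1.ne', hz.2.1⟩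
  have h3 := card_le_card h2
  have h4 := dg_mono (hK.trans cut_le) (μ p)
  omega

/-- A perfect matching missing three vertices that do not form a triangle of full vertices: every
other vertex has a full neighbour among these three. -/
lemma Stable.exists_full_adj (hG : Stable G Δ) (h : HasPM G S) (hS : S.card + 3 = Fintype.card V)
    (hnt : ¬ ∀ u ∉ S, dg G u = Δ ∧ ∀ v ∉ S, u ≠ v → G.Adj u v) {p : V} (hp : p ∈ S) :
    ∃ z ∉ S, dg G z = Δ ∧ G.Adj p z := by
  obtain ⟨μ, hμ⟩ := h
  have h1 := hG.dominated hμ hS (colorable_of_not_triangle hG.dg_le hμ hS hnt) hp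
  have h2 := hG.dg_le (μ p)
  obtain ⟨z, hz⟩ : ((nb G p).filter fun z => z ∉ S ∧ dg G z = Δ).Nonempty := by
    rw [← card_pos]; omega
  rw [mem_filter, mem_nb] at hz
  exact ⟨z, hz.2.1, hz.2.2, hz.1⟩

/-- The structure forced by a vertex `p` without neighbours among the three vertices missed by a
perfect matching. -/
lemma Stable.undominated (hG : Stable G Δ) (hμ : IsPM G S μ) (hS : S.card + 3 = Fintype.card V)
    {p : V} (hp : p ∈ S) (hpU : ∀ u ∉ S, ¬ G.Adj p u) :
    ∃ Y : Finset V, p ∉ Y ∧ (∀ u ∉ S, u ∈ Y) ∧ (∀ y ∈ Y, dg G y = Δ) ∧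
      (∀ u ∉ S, ∀ x, G.Adj u x → x ∈ Y) ∧ (∀ u ∉ S, ∀ v ∉ S, u ≠ v → G.Adj u v) ∧
      (∀ v ∈ Y, v ∈ S → ∀ x, G.Adj v x → x ∈ Y ∨ x = μ v) ∧
      (∀ v ∈ Y, v ∈ S → ∃ u₁ u₂, u₁ ∉ S ∧ u₂ ∉ S ∧ u₁ ≠ u₂ ∧ G.Adj v u₁ ∧ G.Adj v u₂) := by
  have hcard := card_erase_pair hμ hp
  have hμ' := hμ.erase_pair hp
  obtain ⟨K, hK, hc, hKΔ⟩ := hG.exists_critical hμ' (by omega)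
  have hKG : K ≤ G := hK.trans cut_le
  have hmem : ∀ z, dg K z = Δ → z ∈ S → z = p ∨ z = μ p := by
    intro z hz hzS
    have := not_mem_of_full hμ' hG.dg_le hK hz
    simp only [mem_sdiff, mem_insert, mem_singleton] at this
    tauto
  -- The only possible full neighbour of `p` in `K` is its partner, while a non-isolated vertex of
  -- `K` has two.
  have hiso : ∀ y, ¬ K.Adj p y := by
    intro y hy
    obtain ⟨z₁, z₂, hne, h1, h2, hz1, hz2⟩ := hc.two_full hKΔ hy
    have key : ∀ z, K.Adj p z → dg K z = Δ → z = μ p := by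
      intro z hz hzf
      by_cases hzS : z ∈ S
      · exact (hmem z hzf hzS).resolve_left hz.ne'
      · exact (hpU z hzS (hKG hz)).elim
    exact hne ((key _ h1 hz1).trans (key _ h2 hz2).symm)
  -- If `p` or its partner were full in `K`, the edge joining them would belong to `K`.
  have hfullS : ∀ z, dg K z = Δ → z ∉ S := by
    intro z hz hzS
    have h1 := (full_of_le hG.dg_le hKG hz).2
    rcases hmem z hz hzS with rfl | rfl
    · exact hiso _ (h1 _ (hμ _ hp).2.2)
    · exact hiso _ (h1 _ (hμ _ hp).2.2.symm).symm
  have hKcut : K ≤ cut G S μ := by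
    intro a b hab
    have h1 := (cut_adj hμ').1 (hK hab)
    refine (cut_adj hμ).2 ⟨h1.1, fun h2 => h1.2 ⟨?_, h2.2⟩⟩
    simp only [mem_sdiff, mem_insert, mem_singleton, not_or]
    refine ⟨h2.1, ?_, ?_⟩
    · rintro rfl; exact hiso _ hab
    · rintro rfl
      rw [(hμ p hp).2.1] at h2
      have h3 := hab.symm
      rw [← h2.2] at h3
      exact hiso _ h3
  have hT : (Sᶜ).card ≤ 3 := by rw [card_compl]; omega
  have htri := hc.triangle hKΔ hT fun z hz => mem_compl.2 (hfullS z hz)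
  simp only [mem_compl] at htri
  -- The set sought consists of the non-isolated vertices of the critical subgraph.
  set Y : Finset V := univ.filter fun x => ∃ y, K.Adj x y with hY
  have hYm : ∀ x, x ∈ Y ↔ ∃ y, K.Adj x y := by intro x; simp [hY]
  have htwo : ∀ v ∈ Y, ∃ u₁ u₂, u₁ ∉ S ∧ u₂ ∉ S ∧ u₁ ≠ u₂ ∧ K.Adj v u₁ ∧ K.Adj v u₂ := by
    intro v hv
    obtain ⟨y, hy⟩ := (hYm v).1 hv
    obtain ⟨z₁, z₂, hne, h1, h2, hz1, hz2⟩ := hc.two_full hKΔ hy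
    exact ⟨z₁, z₂, hfullS _ hz1, hfullS _ hz2, hne, h1, h2⟩
  have hUY : ∀ u ∉ S, u ∈ Y := by
    intro u hu
    obtain ⟨x, y, hxy⟩ := hc.exists_adj
    obtain ⟨u₁, u₂, h1, h2, hne, -, -⟩ := htwo x ((hYm x).2 ⟨y, hxy⟩)
    rw [hYm]
    by_cases h : u = u₁
    · exact ⟨u₂, (htri u hu).2 u₂ h2 (h ▸ hne)⟩
    · exact ⟨u₁, (htri u hu).2 u₁ h1 h⟩
  have hUadj : ∀ u ∉ S, ∀ x, G.Adj u x → K.Adj u x := fun u hu =>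
    (full_of_le hG.dg_le hKG (htri u hu).1).2
  -- At an edge `uv` at most two full vertices other than `u` are available, so `v` has degree at
  -- least Δ - 1 in `K`. Since its matching edge is absent from `K`, that is the only edge it loses.
  have hout : ∀ v ∈ Y, v ∈ S → dg G v = Δ ∧ ∀ x, G.Adj v x → K.Adj v x ∨ x = μ v := by
    intro v hv hvS
    obtain ⟨u, -, hu, -, -, hvu, -⟩ := htwo v hv
    have h1 := hc.vizing_adjacency hKΔ hvu.symm
    have h2 : ((nb K u).filter fun z => z ≠ v ∧ dg K z = Δ) ⊆ Sᶜ.erase u := by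
      intro z hz
      rw [mem_filter, mem_nb] at hz
      exact mem_erase.2 ⟨hz.1.ne', mem_compl.2 (hfullS z hz.2.2)⟩
    have h3 := card_le_card h2
    have h4 := card_erase_add_one (mem_compl.2 hu)
    have h5 : nb K v ⊆ (nb G v).erase (μ v) := by
      intro z hz
      rw [mem_nb] at hz
      have := (cut_adj hμ).1 (hKcut hz)
      refine mem_erase.2 ⟨?_, mem_nb.2 this.1⟩
      rintro rfl; exact this.2 ⟨hvS, rfl⟩
    have h6 := card_erase_add_one (mem_nb.2 (hμ v hvS).2.2)
    have h7 := hG.dg_le v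
    have h8 := card_le_card h5
    have h9 : dg K v = (nb K v).card := rfl
    have h10 : dg G v = (nb G v).card := rfl
    refine ⟨by omega, fun x hx => ?_⟩
    have h11 := eq_of_subset_of_card_le h5 (by omega)
    by_cases hxv : x = μ v
    · exact Or.inr hxv
    · left
      rw [← mem_nb, h11]
      exact mem_erase.2 ⟨hxv, mem_nb.2 hx⟩
  refine ⟨Y, fun h => ?_, hUY, ?_, ?_, ?_, ?_, ?_⟩
  · obtain ⟨y, hy⟩ := (hYm p).1 h
    exact hiso y hy
  · intro y hy
    by_cases hyS : y ∈ S
    · exact (hout y hy hyS).1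
    · exact (full_of_le hG.dg_le hKG (htri y hyS).1).1
  · intro u hu x hx
    exact (hYm x).2 ⟨u, (hUadj u hu x hx).symm⟩
  · intro u hu v hv huv
    exact hKG ((htri u hu).2 v hv huv)
  · intro v hv hvS x hx
    rcases (hout v hv hvS).2 x hx with h | h
    · exact Or.inl ((hYm x).2 ⟨v, h.symm⟩)
    · exact Or.inr h
  · intro v hv _
    obtain ⟨u₁, u₂, h1, h2, h3, h4, h5⟩ := htwo v hv
    exact ⟨u₁, u₂, h1, h2, h3, hKG h4, hKG h5⟩

end stable

/-! ### Switching matchings, and transitivity of non-adjacency -/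

variable {V : Type*} [Fintype V]

lemma IsPM.sdiff {G : SimpleGraph V} {S T : Finset V} {μ : V → V} (h : IsPM G S μ)
    (hT : ∀ v ∈ T, μ v ∈ T) : IsPM G (S \ T) μ := by
  refine h.mono sdiff_subset fun x hx => ?_
  rw [mem_sdiff] at hx ⊢
  refine ⟨(h x hx.1).1, fun he => hx.2 ?_⟩
  rw [← (h x hx.1).2.1]; exact hT _ he

/-- The common form of all switching arguments: a union `T` of matched pairs is removed and a
matching of `T'` is put in. The sets are given by membership conditions so that only a case check on
the named vertices remains. -/
lemma IsPM.exchange {G : SimpleGraph V} {S T T' S' : Finset V} {μ : V → V} (hμ : IsPM G S μ)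
    (hT : ∀ v, v ∈ T → μ v ∈ T) (hT' : HasPM G T') (hd : ∀ x, x ∈ T' → x ∈ S → x ∈ T)
    (hS' : ∀ x, x ∈ S' ↔ (x ∈ S ∧ x ∉ T) ∨ x ∈ T') : HasPM G S' := by
  have h1 : HasPM G (S \ T) := ⟨μ, hμ.sdiff hT⟩
  refine (h1.union hT' ?_).congr ?_
  · rw [Finset.disjoint_left]
    intro x hx hx'
    rw [mem_sdiff] at hx
    exact hx.2 (hd x hx' hx.1)
  · ext x; rw [hS' x, mem_union, mem_sdiff]

lemma hasPM_pair {G : SimpleGraph V} {a b : V} (h : G.Adj a b) : HasPM G {a, b} :=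
  (hasPM_empty.add_edge h (by simp) (by simp)).congr (by simp)

lemma hasPM_four {G : SimpleGraph V} {a b c d : V} (h : G.Adj a b) (h' : G.Adj c d)
    (hac : a ≠ c) (had : a ≠ d) (hbc : b ≠ c) (hbd : b ≠ d) : HasPM G {a, b, c, d} :=
  ((hasPM_pair h').add_edge h (by simp [*]) (by simp [*]))

lemma hasPM_six {G : SimpleGraph V} {a b c d e f : V} (h : G.Adj a b) (h' : HasPM G {c, d, e, f})
    (hac : a ≠ c) (had : a ≠ d) (hae : a ≠ e) (haf : a ≠ f)
    (hbc : b ≠ c) (hbd : b ≠ d) (hbe : b ≠ e) (hbf : b ≠ f) : HasPM G {a, b, c, d, e, f} :=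
  (h'.add_edge h (by simp [*]) (by simp [*]))

/-- Any two vertices of `W` whose deletion leaves a perfect matching dominate `W`. -/
def PairDominated (G : SimpleGraph V) (W : Finset V) : Prop :=
  ∀ x ∈ W, ∀ y ∈ W, x ≠ y → HasPM G (W \ {x, y}) →
    ∀ v ∈ W, v ≠ x → v ≠ y → G.Adj v x ∨ G.Adj v y

/-- In a pair dominated graph with a perfect matching non-adjacency is transitive. -/
lemma nonadj_trans {G : SimpleGraph V} {W : Finset V} (hW : HasPM G W)
    (hE : PairDominated G W)
    {p q q₂ : V} (hp : p ∈ W) (hq : q ∈ W) (hq₂ : q₂ ∈ W) (hpq : p ≠ q) (hpq₂ : p ≠ q₂)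
    (hqq₂ : q ≠ q₂) (h1 : ¬ G.Adj p q) (h2 : ¬ G.Adj p q₂) : ¬ G.Adj q q₂ := by
  intro hadj
  obtain ⟨μ, hμ⟩ := hW
  obtain ⟨hr, hrr, hpr⟩ := hμ p hp
  obtain ⟨hq', hqq', hqa⟩ := hμ q hq
  obtain ⟨hq₂', hqq₂', hqa₂⟩ := hμ q₂ hq₂
  have hrq : μ p ≠ q := fun h => h1 (h ▸ hpr)
  have hrq₂ : μ p ≠ q₂ := fun h => h2 (h ▸ hpr)
  have e1 := hqa.ne
  have e2 := hqa₂.ne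
  have e3 := hpr.ne
  -- If `q` and `q₂` are partners, their deletion leaves a matching, and they fail to dominate `p`.
  by_cases hm : μ q = q₂
  · have : HasPM G (W \ {q, q₂}) := ⟨μ, hμ.sdiff (by grind)⟩
    rcases hE q hq q₂ hq₂ hqq₂ this p hp hpq hpq₂ with h | h
    exacts [h1 h, h2 h]
  have f1 : μ q ≠ p := by grind
  have f2 : μ q₂ ≠ p := by grind
  have f3 : μ q ≠ μ q₂ := by grind
  have f4 : μ q ≠ μ p := by grind
  have f5 : μ q₂ ≠ μ p := by grind
  have f6 : μ q₂ ≠ q := by grind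
  -- The matched pair of `q` must dominate `p`.
  have a1 : G.Adj p (μ q) := by
    have : HasPM G (W \ {q, μ q}) := ⟨μ, hμ.sdiff (by grind)⟩
    exact (hE q hq _ hq' e1 this p hp hpq f1.symm).resolve_left h1
  have a2 : G.Adj p (μ q₂) := by
    have : HasPM G (W \ {q₂, μ q₂}) := ⟨μ, hμ.sdiff (by grind)⟩
    exact (hE q₂ hq₂ _ hq₂' e2 this p hp hpq₂ f2.symm).resolve_left h2
  have hT : ∀ v, v ∈ ({p, μ p, q, μ q, q₂, μ q₂} : Finset V) →
      μ v ∈ ({p, μ p, q, μ q, q₂, μ q₂} : Finset V) := by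
    simp only [mem_insert, mem_singleton]; grind
  -- Such an edge, together with the edge from `p` to `μ q`, would give a matching missing `q` and
  -- `q₂`, which do not dominate `p`.
  have n1 : ¬ G.Adj (μ p) (μ q₂) := fun h => by
    have : HasPM G (W \ {q, q₂}) :=
      hμ.exchange hT (hasPM_four a1 h (by grind) (by grind) (by grind) (by grind))
        (by simp only [mem_insert, mem_singleton]; grind)
        (by simp only [mem_insert, mem_singleton, mem_sdiff]; grind)
    rcases hE q hq q₂ hq₂ hqq₂ this p hp hpq hpq₂ with h | h
    exacts [h1 h, h2 h]
  have n2 : ¬ G.Adj (μ p) (μ q) := fun h => by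
    have : HasPM G (W \ {q, q₂}) :=
      hμ.exchange hT (hasPM_four a2 h (by grind) (by grind) (by grind) (by grind))
        (by simp only [mem_insert, mem_singleton]; grind)
        (by simp only [mem_insert, mem_singleton, mem_sdiff]; grind)
    rcases hE q hq q₂ hq₂ hqq₂ this p hp hpq hpq₂ with h | h
    exacts [h1 h, h2 h]
  -- The edge `q q₂` itself frees `μ q` and `μ q₂`, and these do not dominate `μ p`.
  have : HasPM G (W \ {μ q, μ q₂}) :=
    hμ.exchange hT (hasPM_four hpr hadj (by grind) (by grind) (by grind) (by grind))
      (by simp only [mem_insert, mem_singleton]; grind)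
      (by simp only [mem_insert, mem_singleton, mem_sdiff]; grind)
  rcases hE _ hq' _ hq₂' f3 this (μ p) hr f4.symm f5.symm with h | h
  exacts [n2 h, n1 h]

/-! ### Round robin colourings of balanced complete multipartite graphs -/

variable {V : Type*} [Fintype V]

/-- Addition modulo `m` of residues. -/
def addMod (m i j : ℕ) : ℕ := if i + j < m then i + j else i + j - m

/-- The round robin colouring of the edges of the complete graph on `{0, …, m}`, `m` odd. -/
def roundRobin (m i j : ℕ) : ℕ :=
  if i = m then addMod m j j else if j = m then addMod m i i else addMod m i j

lemma roundRobin_comm (m i j : ℕ) : roundRobin m i j = roundRobin m j i := by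
  unfold roundRobin addMod
  split_ifs <;> omega

lemma roundRobin_lt {N i j : ℕ} (hi : i < 2 * N) (hj : j < 2 * N) (hij : i ≠ j) :
    roundRobin (2 * N - 1) i j < 2 * N - 1 := by
  unfold roundRobin addMod
  split_ifs <;> omega

lemma roundRobin_inj {N i j k : ℕ} (hi : i < 2 * N) (hj : j < 2 * N) (hk : k < 2 * N)
    (hij : i ≠ j) (hik : i ≠ k)
    (h : roundRobin (2 * N - 1) i j = roundRobin (2 * N - 1) i k) : j = k := by
  unfold roundRobin addMod at h
  split_ifs at h <;> omega

lemma roundRobin_ne_zero {N i j : ℕ} (hi : i < 2 * N) (hj : j < 2 * N) (hij : i ≠ j)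
    (h : i + j ≠ 2 * N - 1) : roundRobin (2 * N - 1) i j ≠ 0 := by
  unfold roundRobin addMod
  split_ifs <;> omega

/-- A proper edge colouring of a blow-up. -/
lemma edgeColorable_blowup {K : SimpleGraph V} {k h : ℕ} (f a : V → ℕ) (c : ℕ → ℕ → ℕ)
    (hc : ∀ i j, c i j = c j i) (hlt : ∀ u v, K.Adj u v → c (f u) (f v) < k)
    (hinj : ∀ u v w, K.Adj u v → K.Adj u w → c (f u) (f v) = c (f u) (f w) → f v = f w)
    (ha : ∀ u v, K.Adj u v → a u < h)
    (hfa : ∀ u v w, K.Adj u v → K.Adj u w → f v = f w → a v = a w → v = w) :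
    EdgeColorable K (k * h) := by
  have hmod : ∀ u v, K.Adj u v → addMod h (a u) (a v) < h := by
    intro u v huv
    have h1 := ha u v huv
    have h2 := ha v u huv.symm
    unfold addMod; split_ifs <;> omega
  -- The colour encodes a pair: the colour of the two classes, and the sum modulo `h` of the
  -- positions inside them.
  refine ⟨Sym2.lift ⟨fun u v => c (f u) (f v) * h + addMod h (a u) (a v), fun u v => ?_⟩,
    fun u v huv => ?_, fun u v w hv hw he => ?_⟩
  · simp only [hc (f u) (f v), addMod, add_comm (a u) (a v)]
  · rw [Sym2.lift_mk]
    have h1 := hmod u v huv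
    have h2 := hlt u v huv
    calc c (f u) (f v) * h + addMod h (a u) (a v) < (c (f u) (f v) + 1) * h := by
          rw [add_mul]; omega
      _ ≤ k * h := Nat.mul_le_mul_right h h2
  · rw [Sym2.lift_mk, Sym2.lift_mk] at he
    simp only at he
    have h1 := hmod u v hv
    have h2 := hmod u w hw
    have hpos : 0 < h := by omega
    have h3 := congrArg (· / h) he
    have h4 := congrArg (· % h) he
    simp only [mul_comm _ h, Nat.mul_add_div hpos, Nat.div_eq_of_lt h1, Nat.div_eq_of_lt h2,
      Nat.mul_add_mod, Nat.mod_eq_of_lt h1, Nat.mod_eq_of_lt h2, add_zero] at h3 h4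
    refine hfa u v w hv hw (hinj u v w hv hw h3) ?_
    have h5 := ha u v hv
    have h6 := ha v u hv.symm
    have h7 := ha w u hw.symm
    unfold addMod at h4
    split_ifs at h4 <;> omega

/-- A balanced complete multipartite graph of even order has chromatic index at most its degree. -/
lemma edgeColorable_multipartite {G K : SimpleGraph V} {W : Finset V} {Δ : ℕ} (hKG : K ≤ G)
    (hKW : ∀ a b, K.Adj a b → a ∈ W) (hW : Even W.card) (hdeg : ∀ v ∈ W, dg G v = Δ)
    (hcl : ∀ v ∈ W, ∀ x, G.Adj v x → x ∈ W)
    (htr : ∀ p ∈ W, ∀ q ∈ W, ∀ r ∈ W, ¬ G.Adj p q → ¬ G.Adj p r → ¬ G.Adj q r) :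
    EdgeColorable K Δ := by
  set cls : V → Finset V := fun v => W.filter fun x => ¬ G.Adj v x with hcls
  have hmem : ∀ v x, x ∈ cls v ↔ x ∈ W ∧ ¬ G.Adj v x := fun v x => by rw [hcls, mem_filter]
  have hself : ∀ v ∈ W, v ∈ cls v := fun v hv => (hmem v v).2 ⟨hv, G.irrefl⟩
  have heq : ∀ u ∈ W, ∀ v ∈ W, (cls u = cls v ↔ ¬ G.Adj u v) := by
    intro u hu v hv
    constructor
    · intro h
      have := hself v hv
      rw [← h, hmem] at this
      exact this.2
    · intro h
      ext x
      rw [hmem, hmem]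
      refine and_congr_right fun hx => ⟨fun h1 => htr u hu v hv x hx h h1, fun h1 =>
        htr v hv u hu x hx (fun h2 => h h2.symm) h1⟩
  -- Non-adjacency is an equivalence on `W`, and regularity makes all classes the same size.
  set h := W.card - Δ with hh
  have hcard : ∀ v ∈ W, (cls v).card = h := by
    intro v hv
    have h1 := card_filter_add_card_filter_not (s := W) fun x => G.Adj v x
    have h2 : W.filter (fun x => G.Adj v x) = nb G v := by
      ext x; rw [mem_filter, mem_nb]; exact ⟨fun h => h.2, fun h => ⟨hcl v hv x h, h⟩⟩
    have h3 := hdeg v hv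
    rw [h2] at h1
    change dg G v + (cls v).card = W.card at h1
    omega
  set 𝒞 := W.image cls with h𝒞
  set m := 𝒞.card with hm
  have hWm : W.card = m * h := by
    rw [card_eq_sum_card_image cls W, sum_const_nat (m := h)]
    intro C hC
    obtain ⟨v, hv, rfl⟩ := mem_image.1 hC
    rw [← hcard v hv]
    congr 1
    ext x
    rw [mem_filter, hmem]
    refine and_congr_right fun hx => ?_
    rw [eq_comm, heq v hv x hx]
  have hpos : ∃ pos : V → ℕ, ∀ u ∈ W, pos u < h ∧ ∀ v ∈ W, cls u = cls v → pos u = pos v →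
      u = v := by
    refine ⟨fun u => if hu : u ∈ cls u then ((cls u).equivFin ⟨u, hu⟩ : ℕ) else 0,
      fun u hu => ⟨?_, fun v hv huv hp => ?_⟩⟩
    · dsimp only
      rw [dif_pos (hself u hu)]
      exact (Fin.is_lt _).trans_eq (hcard u hu)
    · dsimp only at hp
      rw [dif_pos (hself u hu), dif_pos (hself v hv)] at hp
      have key : ∀ (C D : Finset V) (hC : u ∈ C) (hD : v ∈ D), C = D →
          (C.equivFin ⟨u, hC⟩ : ℕ) = D.equivFin ⟨v, hD⟩ → u = v := by
        rintro C _ hC hD rfl he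
        simpa using C.equivFin.injective (Fin.ext he)
      exact key _ _ (hself u hu) (hself v hv) huv hp
  obtain ⟨pos, hpos⟩ := hpos
  have hm𝒞 : ∀ u ∈ W, cls u ∈ 𝒞 := fun u hu => mem_image_of_mem _ hu
  have hidx : ∃ idx : V → ℕ, ∀ u ∈ W, idx u < m ∧ ∀ v ∈ W, idx u = idx v → cls u = cls v := by
    refine ⟨fun u => if hu : cls u ∈ 𝒞 then (𝒞.equivFin ⟨cls u, hu⟩ : ℕ) else 0,
      fun u hu => ⟨?_, fun v hv hp => ?_⟩⟩
    · dsimp only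
      rw [dif_pos (hm𝒞 u hu)]
      exact Fin.is_lt _
    · dsimp only at hp
      rw [dif_pos (hm𝒞 u hu), dif_pos (hm𝒞 v hv)] at hp
      simpa using 𝒞.equivFin.injective (Fin.ext hp)
  obtain ⟨idx, hidx⟩ := hidx
  have hKW' : ∀ a b, K.Adj a b → a ∈ W ∧ b ∈ W := fun a b hab => ⟨hKW a b hab, hKW b a hab.symm⟩
  have hidxne : ∀ a b, K.Adj a b → idx a ≠ idx b := by
    intro a b hab he
    obtain ⟨h1, h2⟩ := hKW' a b hab
    exact (heq a h1 b h2).1 ((hidx a h1).2 b h2 he) (hKG hab)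
  have hΔ : K.Adj = ⊥ ∨ Δ = (m - 1) * h := by
    by_cases hne : ∃ a b, K.Adj a b
    · right
      obtain ⟨a, b, hab⟩ := hne
      have h1 := hKW a b hab
      have h2 := hcard a h1
      have h3 := card_pos.2 ⟨a, hself a h1⟩
      rw [Nat.sub_mul, one_mul, ← hWm]
      omega
    · left
      push Not at hne
      ext a b; simpa using hne a b
  rcases hΔ with hΔ | hΔ
  · exact ⟨fun _ => 0, fun a b hab => by simp [hΔ] at hab, fun v a b hab => by simp [hΔ] at hab⟩
  rw [hΔ]
  -- For an even number of classes the round robin runs on the classes themselves.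
  rcases Nat.even_or_odd m with ⟨N, hN⟩ | hmodd
  · have hm2 : m = 2 * N := by omega
    refine edgeColorable_blowup idx pos (roundRobin (2 * N - 1)) (roundRobin_comm _) ?_ ?_ ?_ ?_
    · intro u v huv
      obtain ⟨h1, h2⟩ := hKW' u v huv
      rw [hm2]
      exact roundRobin_lt (hm2 ▸ (hidx u h1).1) (hm2 ▸ (hidx v h2).1) (hidxne u v huv)
    · intro u v w hv hw he
      obtain ⟨h1, h2⟩ := hKW' u v hv
      obtain ⟨-, h3⟩ := hKW' u w hw
      exact roundRobin_inj (hm2 ▸ (hidx u h1).1) (hm2 ▸ (hidx v h2).1) (hm2 ▸ (hidx w h3).1)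
        (hidxne u v hv) (hidxne u w hw) he
    · intro u v huv
      exact (hpos u (hKW u v huv)).1
    · intro u v w hv hw he hp
      obtain ⟨h1, h2⟩ := hKW' u v hv
      obtain ⟨-, h3⟩ := hKW' u w hw
      exact (hpos v h2).2 w h3 ((hidx v h2).2 w h3 he) hp
  -- For odd `m` the class size is even, and every class is halved. The halves of class `i` are
  -- labelled `i` and `2m-1-i`; the round robin on `2m` labels gives colour 0 exactly to the pairs
  -- with sum `2m-1`, that is, to halves of one class. This colour is never used, and shifting by
  -- one leaves `2m-2` colours.
  · have hheven : Even h := by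
      rw [hWm, Nat.even_mul] at hW
      exact hW.resolve_left (Nat.not_even_iff_odd.2 hmodd)
    obtain ⟨h', hh'⟩ := hheven
    set f : V → ℕ := fun v => if pos v % 2 = 0 then idx v else 2 * m - 1 - idx v with hf
    have hflt : ∀ u ∈ W, f u < 2 * m := by
      intro u hu
      have := (hidx u hu).1
      rw [hf]; dsimp only; split_ifs <;> omega
    have hfne : ∀ u v, K.Adj u v → f u ≠ f v ∧ f u + f v ≠ 2 * m - 1 := by
      intro u v huv
      obtain ⟨h1, h2⟩ := hKW' u v huv
      have h3 := (hidx u h1).1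
      have h4 := (hidx v h2).1
      have h5 := hidxne u v huv
      rw [hf]; dsimp only; split_ifs <;> omega
    have hmul : (m - 1) * h = (2 * m - 2) * h' := by
      rw [hh', ← two_mul, ← mul_assoc, mul_comm _ 2, Nat.mul_sub, mul_one]
    rw [hmul]
    refine edgeColorable_blowup f (fun v => pos v / 2)
      (fun i j => roundRobin (2 * m - 1) i j - 1) (fun i j => by rw [roundRobin_comm]) ?_ ?_ ?_ ?_
    · intro u v huv
      obtain ⟨h1, h2⟩ := hKW' u v huv
      obtain ⟨h3, h4⟩ := hfne u v huv
      have h5 := roundRobin_lt (hflt u h1) (hflt v h2) h3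
      have h6 := roundRobin_ne_zero (hflt u h1) (hflt v h2) h3 h4
      omega
    · intro u v w hv hw he
      obtain ⟨h1, h2⟩ := hKW' u v hv
      obtain ⟨-, h3⟩ := hKW' u w hw
      obtain ⟨h4, h5⟩ := hfne u v hv
      obtain ⟨h6, h7⟩ := hfne u w hw
      have h8 := roundRobin_ne_zero (hflt u h1) (hflt v h2) h4 h5
      have h9 := roundRobin_ne_zero (hflt u h1) (hflt w h3) h6 h7
      exact roundRobin_inj (hflt u h1) (hflt v h2) (hflt w h3) h4 h6 (by omega)
    · intro u v huv
      have := (hpos u (hKW u v huv)).1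
      omega
    · intro u v w hv hw he hp
      obtain ⟨h1, h2⟩ := hKW' u v hv
      obtain ⟨-, h3⟩ := hKW' u w hw
      have h4 := (hidx v h2).1
      have h5 := (hidx w h3).1
      rw [hf] at he
      dsimp only at he hp
      have h6 : idx v = idx w ∧ pos v = pos w := by
        split_ifs at he <;> omega
      exact (hpos v h2).2 w h3 ((hidx v h2).2 w h3 h6.1) h6.2

/-- A stable graph cannot split off a part of full vertices with a perfect matching. -/
lemma Stable.not_split {G : SimpleGraph V} {Δ : ℕ} (hG : Stable G Δ) {Y : Finset V} {c : V}
    (hc : c ∈ Y) (hcl : ∀ y ∈ Y, ∀ x, G.Adj y x → x ∈ Y) (hY : HasPM G (Y.erase c))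
    (hW : HasPM G Yᶜ) (hcard : 4 ≤ (Yᶜ).card) (hfull : ∀ v ∉ Y, dg G v = Δ) : False := by
  have hcl' : ∀ v ∉ Y, ∀ x, G.Adj v x → x ∉ Y := fun v hv x hx hxY =>
    hv (hcl x hxY v hx.symm)
  -- The vertex `c` serves as the third missed vertex. It has no neighbour outside `Y`, so the
  -- triple is no triangle and `c` dominates nothing there.
  have hE : PairDominated G Yᶜ := by
    intro x hx y hy hxy hm v hv hvx hvy
    rw [mem_compl] at hx hy hv
    have hcx : c ≠ x := fun h => hx (h ▸ hc)
    have hcy : c ≠ y := fun h => hy (h ▸ hc)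
    have hm' : HasPM G ({c, x, y}ᶜ) := by
      refine (hY.union hm ?_).congr ?_
      · rw [Finset.disjoint_left]
        intro a ha ha'
        rw [mem_sdiff, mem_compl] at ha'
        exact ha'.1 (mem_of_mem_erase ha)
      · ext a
        simp only [mem_union, mem_erase, mem_sdiff, mem_compl, mem_insert, mem_singleton]
        grind
    have h3 : ({c, x, y} : Finset V).card = 3 := card_eq_three.2 ⟨c, x, y, hcx, hcy, hxy, rfl⟩
    obtain ⟨z, hz, -, hvz⟩ := hG.exists_full_adj hm' (p := v) (by
        have := card_compl ({c, x, y} : Finset V)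
        have := card_le_univ ({c, x, y} : Finset V)
        omega) (fun h => by
        have := (h c (by simp)).2 x (by simp) hcx
        exact hx (hcl c hc x this)) (by
        simp only [mem_compl, mem_insert, mem_singleton, not_or]
        exact ⟨fun h => hv (h ▸ hc), hvx, hvy⟩)
    simp only [mem_compl, mem_insert, mem_singleton, not_not] at hz
    rcases hz with rfl | rfl | rfl
    · exact (hv (hcl _ hc v hvz.symm)).elim
    · exact Or.inl hvz
    · exact Or.inr hvz
  have htr : ∀ p ∈ Yᶜ, ∀ q ∈ Yᶜ, ∀ r ∈ Yᶜ, ¬ G.Adj p q → ¬ G.Adj p r → ¬ G.Adj q r := by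
    intro p hp q hq r hr h1 h2
    by_cases hpq : p = q
    · exact hpq ▸ h2
    by_cases hpr : p = r
    · subst hpr; exact fun h => h1 h.symm
    by_cases hqr : q = r
    · subst hqr; exact G.irrefl
    exact nonadj_trans hW hE hp hq hr hpq hpr hqr h1 h2
  obtain ⟨μ, hμ⟩ := hY
  have hYc : (Y.erase c).card + 5 ≤ Fintype.card V := by
    have h1 := card_erase_add_one hc
    have h2 := card_add_card_compl Y
    omega
  -- With the matching of `Y.erase c` deleted, a non-isolated vertex of `K` in `Y` would have `c` as
  -- its only full neighbour. So `K` lives outside `Y`, in a multipartite graph that is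
  -- Δ-colourable.
  obtain ⟨K, hK, hKc, hKΔ⟩ := hG.exists_critical hμ hYc
  have hKG := hK.trans cut_le
  have heven : Even (Yᶜ).card := by
    obtain ⟨ν, hν⟩ := hW
    exact hν.even_card
  refine hKc.1 (edgeColorable_multipartite hKG (fun a b hab => ?_) heven
    (fun v hv => hfull v (mem_compl.1 hv))
    (fun v hv x hx => mem_compl.2 (hcl' v (mem_compl.1 hv) x hx)) htr)
  rw [mem_compl]
  intro haY
  obtain ⟨z₁, z₂, hne, h1, h2, hz1, hz2⟩ := hKc.two_full hKΔ hab
  have key : ∀ z, K.Adj a z → dg K z = Δ → z = c := by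
    intro z hz hzf
    have := not_mem_of_full hμ hG.dg_le hK hzf
    by_contra hzc
    exact this (mem_erase.2 ⟨hzc, hcl a haY z (hKG hz)⟩)
  exact hne ((key _ h1 hz1).trans (key _ h2 hz2).symm)

/-! ### Regular stable graphs: missed triples dominate -/

variable {V : Type*} [Fintype V] {G : SimpleGraph V} {Δ : ℕ} {S : Finset V}

lemma exists_third {U : Finset V} (hU : U.card = 3) {a b : V} (ha : a ∈ U) (hb : b ∈ U)
    (hab : a ≠ b) : ∃ c ∈ U, c ≠ a ∧ c ≠ b ∧ ∀ z ∈ U, z = a ∨ z = b ∨ z = c := by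
  have h1 : b ∈ U.erase a := mem_erase.2 ⟨hab.symm, hb⟩
  have h2 : ((U.erase a).erase b).card = 1 := by
    rw [card_erase_of_mem h1, card_erase_of_mem ha, hU]
  obtain ⟨c, hc⟩ := card_eq_one.1 h2
  have h3 : ∀ z, z ∈ (U.erase a).erase b ↔ z = c := fun z => by rw [hc, mem_singleton]
  simp only [mem_erase] at h3
  obtain ⟨h4, h5, h6⟩ := (h3 c).2 rfl
  refine ⟨c, h6, h5, h4, fun z hz => ?_⟩
  by_contra hcon
  push Not at hcon
  exact hcon.2.2 ((h3 z).1 ⟨hcon.2.1, hcon.1, hz⟩)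

/-- A vertex undominated by the three vertices missed by a perfect matching has at most one common
neighbour with them. -/
lemma Stable.common_adj_unique (hG : Stable G Δ) (h : HasPM G S)
    (hS : S.card + 3 = Fintype.card V) {p : V} (hp : p ∈ S) (hpU : ∀ u ∉ S, ¬ G.Adj p u)
    {x₁ x₂ u₁ u₂ : V} (hu₁ : u₁ ∉ S) (hu₂ : u₂ ∉ S) (h1 : G.Adj p x₁) (h2 : G.Adj p x₂)
    (h3 : G.Adj u₁ x₁) (h4 : G.Adj u₂ x₂) : x₁ = x₂ := by
  obtain ⟨μ, hμ⟩ := h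
  obtain ⟨Y, hpY, -, -, hUN, -, hout, -⟩ := hG.undominated hμ hS hp hpU
  -- A neighbour of `u` lies in `Y` while `p` does not, so the edge to `p` can only be a matching
  -- edge.
  have key : ∀ u ∉ S, ∀ x, G.Adj p x → G.Adj u x → x ∈ S ∧ p = μ x := by
    intro u hu x hpx hux
    have hxS : x ∈ S := by
      by_contra hxS
      exact hpU x hxS hpx
    exact ⟨hxS, (hout x (hUN u hu x hux) hxS p hpx.symm).resolve_left hpY⟩
  obtain ⟨m1, e1⟩ := key u₁ hu₁ x₁ h1 h3
  obtain ⟨m2, e2⟩ := key u₂ hu₂ x₂ h2 h4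
  exact hμ.inj m1 m2 (e1.symm.trans e2)

/-- In a regular stable graph the three vertices missed by a perfect matching dominate. -/
lemma Stable.exists_adj_of_regular (hG : Stable G Δ) (hreg : ∀ v, dg G v = Δ) (hΔ : 2 ≤ Δ)
    (h : HasPM G S) (hS : S.card + 3 = Fintype.card V) {p : V} (hp : p ∈ S) :
    ∃ u ∉ S, G.Adj p u := by
  by_contra hpU
  push Not at hpU
  obtain ⟨μ, hμ⟩ := h
  obtain ⟨Y, hpY, hUY, -, hUN, htri, hout, htwo⟩ := hG.undominated hμ hS hp hpU
  have hUcard : (Sᶜ).card = 3 := by rw [card_compl]; omega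
  have hYS : ∀ w, w ∉ Y → w ∈ S := fun w hw => by
    by_contra h; exact hw (hUY w h)
  have hcardn := card_add_card_compl Y
  -- Only matching edges leave `Y`. If none does, `Y` splits off, matched inside apart from one
  -- missed vertex because the missed vertices form a triangle.
  by_cases hclosed : ∀ v ∈ Y, v ∈ S → μ v ∈ Y
  · obtain ⟨c, a, b, hca, hcb, hab, hU⟩ := card_eq_three.1 hUcard
    have hUm : ∀ z, z ∉ S ↔ z = c ∨ z = a ∨ z = b := by
      intro z; rw [← mem_compl, hU]; simp
    have hcl : ∀ y ∈ Y, ∀ x, G.Adj y x → x ∈ Y := by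
      intro y hy x hx
      by_cases hyS : y ∈ S
      · rcases hout y hy hyS x hx with h | rfl
        · exact h
        · exact hclosed y hy hyS
      · exact hUN y hyS x hx
    have hcS := (hUm c).2 (Or.inl rfl)
    have haS := (hUm a).2 (Or.inr (Or.inl rfl))
    have hbS := (hUm b).2 (Or.inr (Or.inr rfl))
    have hW : IsPM G Yᶜ μ := by
      refine hμ.mono (fun w hw => hYS w (mem_compl.1 hw)) fun w hw => ?_
      rw [mem_compl] at hw ⊢
      obtain ⟨h1, h2, -⟩ := hμ w (hYS w hw)
      intro h3
      exact hw (h2 ▸ hclosed _ h3 h1)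
    refine hG.not_split (Y := Y) (c := c) (hUY c hcS) hcl ?_ ⟨μ, hW⟩ ?_ (fun v _ => hreg v)
    · have h1 : HasPM G (Y ∩ S) := ⟨μ, hμ.mono inter_subset_right fun v hv => by
        rw [mem_inter] at hv ⊢
        exact ⟨hclosed v hv.1 hv.2, (hμ v hv.2).1⟩⟩
      refine (h1.add_edge (htri a haS b hbS hab) (by simp [haS]) (by simp [hbS])).congr ?_
      ext z
      have h2 := hUm z
      have h3 := hUY z
      have h4 := hUY a haS
      have h5 := hUY b hbS
      simp only [mem_insert, mem_inter, mem_erase]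
      grind
    · have h1 : insert p (nb G p) ⊆ Yᶜ := by
        intro x hx
        rw [mem_compl]
        rcases mem_insert.1 hx with rfl | hx
        · exact hpY
        · exact fun h => hpY (hcl x h p (mem_nb.1 hx).symm)
      have h2 := card_le_card h1
      rw [card_insert_of_notMem (by simp)] at h2
      have h3 := hreg p
      unfold dg at h3
      obtain ⟨k, hk⟩ := hW.even_card
      omega
  push Not at hclosed
  obtain ⟨v₀, hv₀, hv₀S, hw₀⟩ := hclosed
  obtain ⟨hw₀S, hw₀v, hvw₀⟩ := hμ v₀ hv₀S
  set w₀ := μ v₀ with hw₀def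
  have hadjY : ∀ w ∉ Y, ∀ y ∈ Y, G.Adj w y → y = μ w := by
    intro w hw y hy hwy
    have hyS : y ∈ S := by
      by_contra hyS; exact hw (hUN y hyS w hwy.symm)
    have := (hout y hy hyS w hwy.symm).resolve_left hw
    rw [this, (hμ y hyS).2.1]
  -- consequence of a perfect matching missing `w` and two vertices outside `S`
  have hdom : ∀ w ∉ Y, ∀ u ∉ S, HasPM G (insert u (S.erase w)) → ∀ x ∉ Y, x ≠ w → G.Adj x w := by
    intro w hw u hu hm x hx hxw
    have hwS := hYS w hw
    have hcard : (insert u (S.erase w)).card + 3 = Fintype.card V := by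
      rw [card_insert_of_notMem (by simp [hu]), card_erase_add_one hwS, hS]
    obtain ⟨u', hu', hne⟩ : ∃ u' ∈ Sᶜ, u' ≠ u :=
      exists_mem_ne (by omega) u
    rw [mem_compl] at hu'
    obtain ⟨z, hz, -, hxz⟩ := hG.exists_full_adj hm hcard (p := x) (fun h => by
        have h1 : w ∉ insert u (S.erase w) := by
          simp only [mem_insert, mem_erase]; grind
        have h2 : u' ∉ insert u (S.erase w) := by
          simp only [mem_insert, mem_erase]; grind
        have h3 : u' ≠ w := fun h => hu' (h ▸ hwS)
        exact hw (hUN u' hu' w ((h u' h2).2 w h1 h3)))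
      (by simp only [mem_insert, mem_erase]; exact Or.inr ⟨hxw, hYS x hx⟩)
    by_cases hzw : z = w
    · exact hzw ▸ hxz
    · have hzS : z ∉ S := fun h => hz (mem_insert_of_mem (mem_erase.2 ⟨hzw, h⟩))
      exact (hx (hUN z hzS x hxz.symm)).elim
  have hPM1 : ∀ w ∉ Y, μ w ∈ Y → ∃ u ∉ S, HasPM G (insert u (S.erase w)) := by
    intro w hw hv
    have hwS := hYS w hw
    obtain ⟨hvS, hvw, hwv⟩ := hμ w hwS
    obtain ⟨u, -, hu, -, -, hvu, -⟩ := htwo _ hv hvS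
    refine ⟨u, hu, hμ.exchange (T := {w, μ w}) ?_ (hasPM_pair hvu) ?_ ?_⟩
    · simp only [mem_insert, mem_singleton]; grind
    · simp only [mem_insert, mem_singleton]; grind
    · have := hwv.ne
      simp only [mem_insert, mem_singleton, mem_erase]; grind
  have hclique0 : ∀ x ∉ Y, x ≠ w₀ → G.Adj x w₀ := by
    obtain ⟨u, hu, hm⟩ := hPM1 w₀ hw₀ (by rw [hw₀v]; exact hv₀)
    exact hdom w₀ hw₀ u hu hm
  have hclique : ∀ w ∉ Y, ∀ x ∉ Y, x ≠ w → G.Adj x w := by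
    intro w hw
    by_cases hv : μ w ∈ Y
    · obtain ⟨u, hu, hm⟩ := hPM1 w hw hv
      exact hdom w hw u hu hm
    have hwS := hYS w hw
    obtain ⟨hvS, hvw, hwv⟩ := hμ w hwS
    obtain ⟨u, -, hu, -, -, hvu, -⟩ := htwo _ hv₀ hv₀S
    have hne1 : w ≠ w₀ := by rintro rfl; rw [hw₀v] at hv; exact hv hv₀
    have hne2 : μ w ≠ w₀ := by
      intro h
      have := hμ.inj hwS hv₀S h
      exact hw (this ▸ hv₀)
    have ha := hclique0 (μ w) hv hne2
    have hne3 : μ w ≠ v₀ := fun h => hv (h ▸ hv₀)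
    have hne4 : w ≠ v₀ := fun h => hw (h ▸ hv₀)
    have hne5 : u ≠ w₀ := fun h => hu (h ▸ hw₀S)
    have hne6 : u ≠ μ w := fun h => hu (h ▸ hvS)
    have hne7 := hwv.ne
    have hne8 := hvw₀.ne
    -- When the partner of `w` is also outside `Y`, it is rematched with `w₀`, and the partner `v₀`
    -- of `w₀` is rematched with a missed vertex.
    refine hdom w hw u hu (hμ.exchange (T := {w, μ w, v₀, w₀})
      ?_ (hasPM_four hvu ha ?_ ?_ ?_ ?_) ?_ ?_)
    · simp only [mem_insert, mem_singleton]; grind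
    · exact hne3.symm
    · exact hne8
    · exact hne6
    · exact hne5
    · simp only [mem_insert, mem_singleton]; grind
    · simp only [mem_insert, mem_singleton, mem_erase]; grind
  have hnbw : ∀ w ∉ Y, nb G w = (Yᶜ).erase w ∪ (if μ w ∈ Y then {μ w} else ∅) := by
    intro w hw
    ext x
    have h1 := hadjY w hw x
    have h2 := fun h : x ∉ Y => hclique w hw x h
    have h3 := (hμ w (hYS w hw)).2.2
    simp only [mem_nb, mem_union, mem_erase, mem_compl]
    constructor
    · intro h
      by_cases hx : x ∈ Y
      · right
        have := h1 hx h
        rw [if_pos (this ▸ hx)]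
        simp [this]
      · exact Or.inl ⟨h.ne', hx⟩
    · rintro (⟨h, hx⟩ | h)
      · exact (h2 hx h).symm
      · split_ifs at h
        · rw [mem_singleton.1 h]; exact h3
        · simp at h
  have hdegw : ∀ w ∉ Y, μ w ∈ Y → (Yᶜ).card = Δ := by
    intro w hw hv
    have h1 := hreg w
    rw [dg, hnbw w hw, if_pos hv, card_union_of_disjoint (by simp [hv]),
      card_singleton, card_erase_add_one (mem_compl.2 hw)] at h1
    exact h1
  -- The complement of `Y` is a clique, and `w₀` has exactly one neighbour outside it. By regularity
  -- every vertex of the clique then has its partner in `Y`.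
  have hWcard : (Yᶜ).card = Δ := hdegw w₀ hw₀ (by rw [hw₀v]; exact hv₀)
  have hmatch : ∀ w ∉ Y, μ w ∈ Y := by
    intro w hw
    by_contra hv
    have h1 := hreg w
    rw [dg, hnbw w hw, if_neg hv, union_empty] at h1
    have := card_erase_add_one (mem_compl.2 hw)
    omega
  have hYcard : Δ + 3 ≤ Y.card := by
    have h1 : Disjoint Sᶜ ((Yᶜ).image μ) := by
      rw [Finset.disjoint_right]
      intro x hx
      obtain ⟨w, hw, rfl⟩ := mem_image.1 hx
      rw [mem_compl, not_not]
      exact (hμ w (hYS w (mem_compl.1 hw))).1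
    have h2 : Sᶜ ∪ (Yᶜ).image μ ⊆ Y := by
      intro x hx
      rcases mem_union.1 hx with hx | hx
      · exact hUY x (mem_compl.1 hx)
      · obtain ⟨w, hw, rfl⟩ := mem_image.1 hx
        exact hmatch w (mem_compl.1 hw)
    have h3 := card_le_card h2
    rw [card_union_of_disjoint h1, card_image_of_injOn, hUcard, hWcard] at h3
    · omega
    · intro x hx y hy
      exact hμ.inj (hYS x (by simpa using hx)) (hYS y (by simpa using hy))
  -- Rematching the partners of `w₁` and `w₂` with `u₁` and `u₂` leaves `w₁`, `w₂`, `u₃` missed.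
  -- Inside `Y` the vertices `w₁` and `w₂` dominate only their partners, so `u₃` dominates the rest;
  -- as |Y| ≥ Δ + 3, this is the whole neighbourhood of `u₃`.
  have hkey : ∀ w₁ ∉ Y, ∀ w₂ ∉ Y, w₁ ≠ w₂ → ∀ u₁ ∉ S, ∀ u₂ ∉ S, ∀ u₃ ∉ S, u₁ ≠ u₂ → u₃ ≠ u₁ →
      u₃ ≠ u₂ → (∀ z ∉ S, z = u₁ ∨ z = u₂ ∨ z = u₃) → G.Adj (μ w₁) u₁ → G.Adj (μ w₂) u₂ →
      ∀ y, G.Adj u₃ y ↔ y ∈ Y ∧ y ≠ μ w₁ ∧ y ≠ μ w₂ ∧ y ≠ u₃ := by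
    intro w₁ hw₁ w₂ hw₂ hne u₁ hu₁ u₂ hu₂ u₃ hu₃ h12 h31 h32 hall hv₁ hv₂
    have hw₁S := hYS w₁ hw₁
    have hw₂S := hYS w₂ hw₂
    obtain ⟨m1, m2, m3⟩ := hμ w₁ hw₁S
    obtain ⟨m4, m5, m6⟩ := hμ w₂ hw₂S
    have hne1 : μ w₁ ≠ μ w₂ := fun h => hne (hμ.inj hw₁S hw₂S h)
    have hne2 : μ w₁ ≠ u₂ := fun h => hu₂ (h ▸ m1)
    have hne3 : u₁ ≠ μ w₂ := fun h => hu₁ (h ▸ m4)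
    have hy1 := hmatch w₁ hw₁
    have hy2 := hmatch w₂ hw₂
    have hm : HasPM G ({w₁, w₂, u₃}ᶜ) := by
      refine hμ.exchange (T := {w₁, μ w₁, w₂, μ w₂}) ?_ (hasPM_four hv₁ hv₂ hne1 hne2 hne3 h12) ?_ ?_
      · simp only [mem_insert, mem_singleton]; grind
      · simp only [mem_insert, mem_singleton]; grind
      · intro x
        have := hall x
        simp only [mem_insert, mem_singleton, mem_compl]
        grind
    have hw₁u : w₁ ≠ u₃ := fun h => hu₃ (h ▸ hw₁S)
    have hw₂u : w₂ ≠ u₃ := fun h => hu₃ (h ▸ hw₂S)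
    have h3 : ({w₁, w₂, u₃} : Finset V).card = 3 :=
      card_eq_three.2 ⟨w₁, w₂, u₃, hne, hw₁u, hw₂u, rfl⟩
    have h4 := card_add_card_compl ({w₁, w₂, u₃} : Finset V)
    have hsub : ((Y.erase (μ w₁)).erase (μ w₂)).erase u₃ ⊆ nb G u₃ := by
      intro y hy
      simp only [mem_erase] at hy
      obtain ⟨hyu, hyw₂, hyw₁, hyY⟩ := hy
      obtain ⟨z, hz, -, hyz⟩ := hG.exists_full_adj hm (p := y) (by omega) (fun h => by
          have := (h u₃ (by simp)).2 w₁ (by simp) hw₁u.symm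
          exact hw₁ (hUN u₃ hu₃ w₁ this)) (by
          simp only [mem_compl, mem_insert, mem_singleton, not_or]
          exact ⟨fun h => hw₁ (h ▸ hyY), fun h => hw₂ (h ▸ hyY), hyu⟩)
      simp only [mem_compl, mem_insert, mem_singleton, not_not] at hz
      rcases hz with rfl | rfl | rfl
      · exact (hyw₁ (hadjY _ hw₁ y hyY hyz.symm)).elim
      · exact (hyw₂ (hadjY _ hw₂ y hyY hyz.symm)).elim
      · exact mem_nb.2 hyz.symm
    have hc1 := card_erase_add_one hy1
    have hc2 := card_erase_add_one (mem_erase.2 ⟨hne1.symm, hy2⟩)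
    have hc3 := card_erase_add_one (mem_erase.2 ⟨fun h => hu₃ (h ▸ m4), mem_erase.2
      ⟨fun h => hu₃ (h ▸ m1), hUY u₃ hu₃⟩⟩ : u₃ ∈ (Y.erase (μ w₁)).erase (μ w₂))
    have hc4 := hreg u₃
    unfold dg at hc4
    have heq := eq_of_subset_of_card_le hsub (by omega)
    intro y
    rw [← mem_nb, ← heq]
    simp only [mem_erase]
    tauto
  have hΔ3 : 3 ≤ Δ := by
    obtain ⟨u, -, hu, -, -, hvu, -⟩ := htwo _ hv₀ hv₀S
    have h1 : insert v₀ (Sᶜ.erase u) ⊆ nb G u := by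
      intro x hx
      rw [mem_nb]
      rcases mem_insert.1 hx with rfl | hx
      · exact hvu.symm
      · rw [mem_erase, mem_compl] at hx
        exact htri u hu x hx.2 hx.1.symm
    have h2 := card_le_card h1
    rw [card_insert_of_notMem (by simp [hv₀S])] at h2
    have h3 := card_erase_add_one (mem_compl.2 hu)
    have h4 := hreg u
    unfold dg at h4
    omega
  obtain ⟨w₁, w₂, w₃, hw₁, hw₂, hw₃, h12, h13, h23⟩ :=
    two_lt_card_iff.1 (show 2 < (Yᶜ).card by omega)
  rw [mem_compl] at hw₁ hw₂ hw₃
  have hSw : ∀ w ∉ Y, μ w ∈ S := fun w hw => (hμ w (hYS w hw)).1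
  have hinj : ∀ w ∉ Y, ∀ w' ∉ Y, w ≠ w' → μ w ≠ μ w' := fun w hw w' hw' hne h =>
    hne (hμ.inj (hYS w hw) (hYS w' hw') h)
  obtain ⟨a₁, a₂, ha₁, ha₂, ha, hva₁, hva₂⟩ := htwo _ (hmatch w₁ hw₁) (hSw w₁ hw₁)
  obtain ⟨u₂, -, hu₂, -, -, hvu₂, -⟩ := htwo _ (hmatch w₂ hw₂) (hSw w₂ hw₂)
  obtain ⟨u₁, hu₁, hu12, hvu₁⟩ : ∃ u₁ ∉ S, u₁ ≠ u₂ ∧ G.Adj (μ w₁) u₁ := by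
    by_cases h : a₁ = u₂
    · exact ⟨a₂, ha₂, fun h' => ha (h.trans h'.symm), hva₂⟩
    · exact ⟨a₁, ha₁, h, hva₁⟩
  obtain ⟨u₃, hu₃, hu31, hu32, hall⟩ :=
    exists_third hUcard (mem_compl.2 hu₁) (mem_compl.2 hu₂) hu12
  simp only [mem_compl] at hu₃ hall
  have hk := hkey w₁ hw₁ w₂ hw₂ h12 u₁ hu₁ u₂ hu₂ u₃ hu₃ hu12 hu31 hu32 hall hvu₁ hvu₂
  have h3 : G.Adj u₃ (μ w₃) := (hk _).2 ⟨hmatch w₃ hw₃, (hinj _ hw₁ _ hw₃ h13).symm,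
    (hinj _ hw₂ _ hw₃ h23).symm, fun h => hu₃ (h ▸ hSw w₃ hw₃)⟩
  have hk' := hkey w₁ hw₁ w₃ hw₃ h13 u₁ hu₁ u₃ hu₃ u₂ hu₂ hu31.symm hu12.symm hu32.symm
    (fun z hz => by have := hall z hz; tauto) hvu₁ h3.symm
  -- The two neighbourhoods just computed exclude `μ w₁`, which leaves it one neighbour among the
  -- missed vertices instead of the two required.
  have key : ∀ a ∉ S, G.Adj (μ w₁) a → a = u₁ := by
    intro a ha hva
    rcases hall a ha with h | rfl | rfl
    · exact h
    · exact absurd rfl ((hk' _).1 hva.symm).2.1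
    · exact absurd rfl ((hk _).1 hva.symm).2.1
  exact ha ((key a₁ ha₁ hva₁).trans (key a₂ ha₂ hva₂).symm)

/-! ### Three cliques, when no matching misses exactly one vertex -/

variable {V : Type*} [Fintype V] {G : SimpleGraph V} {Δ : ℕ} {S : Finset V}

/-- Any three vertices whose deletion leaves a perfect matching dominate the graph. -/
def TripleDominated (G : SimpleGraph V) : Prop :=
  ∀ a b c p, a ≠ b → a ≠ c → b ≠ c → p ≠ a → p ≠ b → p ≠ c → HasPM G ({a, b, c}ᶜ) →
    G.Adj p a ∨ G.Adj p b ∨ G.Adj p c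

lemma card_compl_triple {a b c : V} (hab : a ≠ b) (hac : a ≠ c) (hbc : b ≠ c) :
    (({a, b, c} : Finset V)ᶜ).card + 3 = Fintype.card V := by
  have h3 : ({a, b, c} : Finset V).card = 3 := card_eq_three.2 ⟨a, b, c, hab, hac, hbc, rfl⟩
  have := card_add_card_compl ({a, b, c} : Finset V)
  omega

lemma Stable.tripleDominated (hG : Stable G Δ) (hreg : ∀ v, dg G v = Δ) (hΔ : 2 ≤ Δ) :
    TripleDominated G := by
  intro a b c p hab hac hbc hpa hpb hpc hm
  obtain ⟨u, hu, hpu⟩ := hG.exists_adj_of_regular hreg hΔ hm (card_compl_triple hab hac hbc)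
    (p := p) (by simp [*])
  simp only [mem_compl, mem_insert, mem_singleton, not_not] at hu
  rcases hu with rfl | rfl | rfl <;> simp [hpu]

/-- If the graph without three vertices has a perfect matching, but the graph without any one
vertex has not, then the graph is a union of three cliques. -/
lemma three_cliques_of_forall_not_hasPM (hreg : ∀ v, dg G v = Δ) (hT : TripleDominated G)
    (hS : S.card + 3 = Fintype.card V) (h : HasPM G S) (hno : ∀ p, ¬ HasPM G {p}ᶜ) :
    ∃ π : V → Fin 3, (∀ x y, G.Adj x y ↔ x ≠ y ∧ π x = π y) ∧
      ∀ i, (univ.filter fun x => π x = i).card = Δ + 1 := by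
  obtain ⟨μ, hμ⟩ := h
  have hUcard : (Sᶜ).card = 3 := by rw [card_compl]; omega
  obtain ⟨U, hUinj, hUS⟩ : ∃ U : Fin 3 → V, Function.Injective U ∧ ∀ z, z ∉ S ↔ ∃ i, z = U i := by
    obtain ⟨a, b, c, hab, hac, hbc, hU⟩ := card_eq_three.1 hUcard
    refine ⟨![a, b, c], ?_, fun z => ?_⟩
    · intro i j
      fin_cases i <;> fin_cases j <;> simp [hab, hac, hbc, hab.symm, hac.symm, hbc.symm]
    · rw [← mem_compl, hU]
      simp [Fin.exists_fin_succ]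
  have hUn : ∀ i, U i ∉ S := fun i => (hUS _).2 ⟨i, rfl⟩
  have hthird : ∀ i j : Fin 3, i ≠ j → ∃ k, U i ≠ U j ∧ U i ≠ U k ∧ U j ≠ U k ∧
      ∀ z, z ∉ S ↔ z = U i ∨ z = U j ∨ z = U k := by
    intro i j hij
    obtain ⟨k, hk, hk', hall⟩ : ∃ k, k ≠ i ∧ k ≠ j ∧ ∀ l, l = i ∨ l = j ∨ l = k := by
      revert i j; decide
    refine ⟨k, hUinj.ne hij, hUinj.ne hk.symm, hUinj.ne hk'.symm, fun z => ?_⟩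
    rw [hUS]
    constructor
    · rintro ⟨l, rfl⟩
      rcases hall l with rfl | rfl | rfl <;> simp
    · rintro (rfl | rfl | rfl) <;> exact ⟨_, rfl⟩
  -- Any alternating path joining two missed vertices would leave only the third missed. This
  -- excludes paths of length one here, of length three in `hA`, and of length five in `hB`.
  have hind : ∀ i j, ¬ G.Adj (U i) (U j) := by
    intro i j hadj
    have hij : i ≠ j := by rintro rfl; exact hadj.ne rfl
    obtain ⟨k, h1, h2, h3, hall⟩ := hthird i j hij
    refine hno (U k) (hμ.exchange (T := ∅) (by simp) (hasPM_pair hadj) ?_ ?_)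
    · intro x
      have := hall x
      simp only [mem_insert, mem_singleton]; grind
    · intro x
      have := hall x
      simp only [mem_insert, mem_singleton, mem_compl, notMem_empty]; grind
  have hA : ∀ i j, i ≠ j → ∀ x ∈ S, G.Adj x (U i) → ¬ G.Adj (μ x) (U j) := by
    intro i j hij x hx hxi hxj
    obtain ⟨k, h1, h2, h3, hall⟩ := hthird i j hij
    obtain ⟨m1, m2, m3⟩ := hμ x hx
    have e1 := m3.ne
    have hi := hUn i
    have hj := hUn j
    refine hno (U k) (hμ.exchange (T := {x, μ x}) ?_ (hasPM_four hxi hxj e1 ?_ ?_ h1) ?_ ?_)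
    · simp only [mem_insert, mem_singleton]; grind
    · grind
    · grind
    · intro z
      have := hall z
      simp only [mem_insert, mem_singleton]; grind
    · intro z
      have := hall z
      simp only [mem_insert, mem_singleton, mem_compl]; grind
  have hdom : ∀ x ∈ S, ∃ i, G.Adj x (U i) := by
    intro x hx
    obtain ⟨k, h1, h2, h3, hall⟩ := hthird 0 1 (by decide)
    have hx1 : ∀ i, x ≠ U i := fun i h => hUn i (h ▸ hx)
    rcases hT _ _ _ x h1 h2 h3 (hx1 _) (hx1 _) (hx1 _) (HasPM.congr ⟨μ, hμ⟩ (by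
      ext z
      have := hall z
      simp only [mem_insert, mem_singleton, mem_compl]; grind)) with h | h | h
    exacts [⟨_, h⟩, ⟨_, h⟩, ⟨_, h⟩]
  -- Domination forces partners to attach to the same missed vertex, so every vertex belongs to
  -- exactly one `U i`.
  have hpartner : ∀ i, ∀ x ∈ S, G.Adj x (U i) → G.Adj (μ x) (U i) := by
    intro i x hx hxi
    obtain ⟨j, hj⟩ := hdom _ (hμ x hx).1
    by_cases hij : i = j
    · exact hij ▸ hj
    · exact (hA i j hij x hx hxi hj).elim
  have huniq : ∀ i j, ∀ x ∈ S, G.Adj x (U i) → G.Adj x (U j) → i = j := by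
    intro i j x hx hi hj
    by_contra hij
    exact hA i j hij x hx hi (hpartner j x hx hj)
  have hB : ∀ i j, i ≠ j → ∀ x ∈ S, ∀ y ∈ S, G.Adj x (U i) → G.Adj y (U j) → ¬ G.Adj x y := by
    intro i j hij x hx y hy hxi hyj hxy
    obtain ⟨k, h1, h2, h3, hall⟩ := hthird i j hij
    have hx' := hpartner i x hx hxi
    have hy' := hpartner j y hy hyj
    obtain ⟨m1, m2, m3⟩ := hμ x hx
    obtain ⟨m4, m5, m6⟩ := hμ y hy
    have e1 := m3.ne
    have e2 := m6.ne
    have e3 := hxy.ne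
    have e4 : μ x ≠ y := fun h => hij (huniq i j y hy (h ▸ hx') hyj)
    have e5 : μ y ≠ x := by grind
    have e6 : μ x ≠ μ y := by grind
    have hi := hUn i
    have hj := hUn j
    refine hno (U k) (hμ.exchange (T := {x, μ x, y, μ y}) ?_
      (hasPM_six hxy (hasPM_four hx' hy' e6 ?_ ?_ h1) ?_ ?_ ?_ ?_ ?_ ?_ ?_ ?_) ?_ ?_)
    · simp only [mem_insert, mem_singleton]; grind
    any_goals grind
    · intro z
      have := hall z
      simp only [mem_insert, mem_singleton]; grind
    · intro z
      have := hall z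
      simp only [mem_insert, mem_singleton, mem_compl]; grind
  have hex : ∀ x, ∃ i, x = U i ∨ G.Adj x (U i) := by
    intro x
    by_cases hx : x ∈ S
    · obtain ⟨i, hi⟩ := hdom x hx
      exact ⟨i, Or.inr hi⟩
    · obtain ⟨i, hi⟩ := (hUS x).1 hx
      exact ⟨i, Or.inl hi⟩
  have hSadj : ∀ x i, G.Adj x (U i) → x ∈ S := by
    intro x i h
    by_contra hx
    obtain ⟨j, rfl⟩ := (hUS x).1 hx
    exact hind j i h
  have huniq' : ∀ x i j, (x = U i ∨ G.Adj x (U i)) → (x = U j ∨ G.Adj x (U j)) → i = j := by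
    rintro x i j (rfl | h1) (h2 | h2)
    · exact hUinj h2
    · exact (hind i j h2).elim
    · subst h2; exact (hind j i h1).elim
    · exact huniq i j x (hSadj x i h1) h1 h2
  choose π hπ using hex
  have hadjπ : ∀ x y, G.Adj x y → π x = π y := by
    intro x y hxy
    rcases hπ x with h1 | h1
    · exact huniq' y _ _ (Or.inr (h1 ▸ hxy.symm)) (hπ y)
    · rcases hπ y with h2 | h2
      · exact huniq' x _ _ (hπ x) (Or.inr (h2 ▸ hxy))
      · by_contra hne
        exact hB _ _ hne x (hSadj _ _ h1) y (hSadj _ _ h2) h1 h2 hxy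
  have hfib : ∀ i, (univ.filter fun x => π x = i) = insert (U i) (nb G (U i)) := by
    intro i
    ext x
    simp only [mem_filter, mem_univ, true_and, mem_insert, mem_nb]
    constructor
    · rintro rfl
      exact (hπ x).imp id fun h => h.symm
    · intro h
      exact huniq' x _ _ (hπ x) (h.imp id fun h => h.symm)
  have hcard : ∀ i, (univ.filter fun x => π x = i).card = Δ + 1 := by
    intro i
    rw [hfib, card_insert_of_notMem (by simp)]
    exact congrArg (· + 1) (hreg (U i))
  refine ⟨π, fun x y => ⟨fun h => ⟨h.ne, hadjπ x y h⟩, fun h => ?_⟩, hcard⟩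
  have h1 : nb G x ⊆ (univ.filter fun z => π z = π x).erase x := by
    intro z hz
    rw [mem_nb] at hz
    rw [mem_erase, mem_filter]
    exact ⟨hz.ne', mem_univ _, (hadjπ x z hz).symm⟩
  -- Each part has Δ + 1 vertices and contains all neighbours of its vertices; regularity makes it a
  -- clique.
  have h2 := eq_of_subset_of_card_le h1 (by
    have h3 := card_erase_add_one (s := univ.filter fun z => π z = π x) (a := x) (by simp)
    have h4 := hcard (π x)
    have h5 := hreg x
    unfold dg at h5
    omega)
  rw [← mem_nb, h2, mem_erase, mem_filter]
  exact ⟨h.1.symm, mem_univ _, h.2.symm⟩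

/-! ### Matchings missing one vertex -/

/-- The vertices different from `p` which are not adjacent to `p`. -/
noncomputable def nonNb (G : SimpleGraph V) (p : V) : Finset V :=
  univ.filter fun x => x ≠ p ∧ ¬ G.Adj p x

@[simp] lemma mem_nonNb {p x : V} : x ∈ nonNb G p ↔ x ≠ p ∧ ¬ G.Adj p x := by simp [nonNb]

lemma card_nonNb (G : SimpleGraph V) (p : V) :
    (nonNb G p).card + dg G p + 1 = Fintype.card V := by
  have h1 : nonNb G p = (insert p (nb G p))ᶜ := by
    ext x; simp
  have h2 := card_add_card_compl (insert p (nb G p))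
  rw [← h1, card_insert_of_notMem (by simp)] at h2
  unfold dg
  omega

/-- A perfect matching missing only `p`, where `p` has at least four non-neighbours, and no perfect
matching misses exactly three of them. -/
structure NearPM (G : SimpleGraph V) (p : V) (μ : V → V) : Prop where
  pm : IsPM G {p}ᶜ μ
  four_le : 4 ≤ (nonNb G p).card
  triple_false {a b c : V} : a ∈ nonNb G p → b ∈ nonNb G p → c ∈ nonNb G p → a ≠ b → a ≠ c →
    b ≠ c → HasPM G ({a, b, c}ᶜ) → False

/-- A perfect matching missing only `p` without edges joining two non-neighbours of `p`. -/
structure CrossNearPM (G : SimpleGraph V) (p : V) (μ : V → V) : Prop extends NearPM G p μ where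
  cross {q : V} : q ∈ nonNb G p → μ q ∉ nonNb G p

namespace NearPM

variable {p : V} {μ : V → V}

lemma mu_spec (h : NearPM G p μ) {x : V} (hx : x ≠ p) :
    μ x ≠ p ∧ μ (μ x) = x ∧ G.Adj x (μ x) ∧ x ≠ μ x := by
  obtain ⟨h1, h2, h3⟩ := h.pm x (by simpa using hx)
  exact ⟨by simpa using h1, h2, h3, h3.ne⟩

/-- If the partner of `q₂` were adjacent to `p`, matching these two would leave exactly the three
non-neighbours `q₁`, `μ q₁`, `q₂` missed. -/
lemma mu_mem_nonNb (h : NearPM G p μ) {q₁ q₂ : V} (h1 : q₁ ∈ nonNb G p)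
    (h1' : μ q₁ ∈ nonNb G p) (h2 : q₂ ∈ nonNb G p) : μ q₂ ∈ nonNb G p := by
  by_contra h2'
  have n1 := (mem_nonNb.1 h1).1
  have n2 := (mem_nonNb.1 h2).1
  obtain ⟨a1, a2, a3, a4⟩ := h.mu_spec n1
  obtain ⟨b1, b2, b3, b4⟩ := h.mu_spec n2
  have hadj : G.Adj p (μ q₂) := by
    rw [mem_nonNb] at h2'; tauto
  have e1 : q₂ ≠ q₁ := by rintro rfl; exact h2' h1'
  have e2 : q₂ ≠ μ q₁ := by rintro rfl; rw [a2] at h2'; exact h2' h1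
  refine h.triple_false h1 h1' h2 a4 e1.symm e2.symm
    (h.pm.exchange (T := {q₁, μ q₁, q₂, μ q₂}) ?_ (hasPM_pair hadj) ?_ ?_)
  · simp only [mem_insert, mem_singleton]; grind
  · simp only [mem_insert, mem_singleton, mem_compl]; grind
  · simp only [mem_insert, mem_singleton, mem_compl]; grind

lemma exists_ne_ne (h : NearPM G p μ) (a b : V) :
    ∃ q ∈ nonNb G p, q ≠ a ∧ q ≠ b := by
  have h1 := h.four_le
  have h2 := pred_card_le_card_erase (s := nonNb G p) (a := a)
  have h3 := pred_card_le_card_erase (s := (nonNb G p).erase a) (a := b)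
  obtain ⟨q, hq⟩ : (((nonNb G p).erase a).erase b).Nonempty := by
    rw [← card_pos]; omega
  simp only [mem_erase] at hq
  exact ⟨q, hq.2.2, hq.2.1, hq.1⟩

/-- If the matching joins non-neighbours of `p`, then it joins neighbours of `p`. -/
lemma adj_mu_of_mem (h : NearPM G p μ) (hall : ∀ q ∈ nonNb G p, μ q ∈ nonNb G p) {z : V}
    (hz : G.Adj p z) : G.Adj p (μ z) := by
  obtain ⟨a1, a2, a3, a4⟩ := h.mu_spec hz.ne'
  by_contra hcon
  have := hall (μ z) (mem_nonNb.2 ⟨a1, hcon⟩)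
  rw [a2, mem_nonNb] at this
  exact this.2 hz

/-- If the matching joins non-neighbours of `p`, then there are no edges between neighbours and
non-neighbours of `p`. -/
lemma not_adj_of_mem (h : NearPM G p μ) (hall : ∀ q ∈ nonNb G p, μ q ∈ nonNb G p) {z x : V}
    (hz : G.Adj p z) (hx : x ∈ nonNb G p) : ¬ G.Adj z x := by
  intro hzx
  have hz' := h.adj_mu_of_mem hall hz
  have hx' := hall x hx
  obtain ⟨q, hq, hqx, hqx'⟩ := h.exists_ne_ne x (μ x)
  have hq' := hall q hq
  obtain ⟨a1, a2, a3, a4⟩ := h.mu_spec hz.ne'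
  obtain ⟨b1, b2, b3, b4⟩ := h.mu_spec (mem_nonNb.1 hx).1
  obtain ⟨c1, c2, c3, c4⟩ := h.mu_spec (mem_nonNb.1 hq).1
  have d1 := hz.ne
  have hne : ∀ y, y ∈ nonNb G p → y ≠ z ∧ y ≠ μ z ∧ y ≠ p := by
    intro y hy
    rw [mem_nonNb] at hy
    exact ⟨fun e => hy.2 (e ▸ hz), fun e => hy.2 (e ▸ hz'), hy.1⟩
  obtain ⟨e1, e2, e3⟩ := hne x hx
  obtain ⟨e4, e5, e6⟩ := hne _ hx'
  obtain ⟨e7, e8, e9⟩ := hne q hq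
  obtain ⟨e10, e11, e12⟩ := hne _ hq'
  clear hne hall
  have f1 : μ q ≠ μ x := by grind
  -- The edges from `p` to `μ z` and from `z` to `x` leave the non-neighbours `q`, `μ q`, `μ x`
  -- missed.
  refine h.triple_false hq hq' hx' c4 hqx' f1
    (h.pm.exchange (T := {q, μ q, x, μ x, z, μ z}) ?_
      (hasPM_four hz' hzx d1 e3.symm a4.symm e2.symm) ?_ ?_)
  · simp only [mem_insert, mem_singleton]; grind
  · simp only [mem_insert, mem_singleton, mem_compl]; grind
  · simp only [mem_insert, mem_singleton, mem_compl]; grind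

end NearPM

namespace CrossNearPM

variable {p : V} {μ : V → V}

lemma adj_mu (h : CrossNearPM G p μ) {q : V} (hq : q ∈ nonNb G p) : G.Adj p (μ q) := by
  have h1 := h.cross hq
  have h2 := (h.mu_spec (mem_nonNb.1 hq).1).1
  rw [mem_nonNb] at h1
  tauto

lemma ne_mu (h : CrossNearPM G p μ) {q q' : V} (hq : q ∈ nonNb G p) (hq' : q' ∈ nonNb G p) :
    q ≠ μ q' := by
  rintro rfl; exact h.cross hq' hq

lemma mu_inj (h : CrossNearPM G p μ) {x y : V} (hx : x ≠ p) (hy : y ≠ p) (hxy : x ≠ y) :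
    μ x ≠ μ y := fun e => hxy (h.pm.inj (by simpa using hx) (by simpa using hy) e)

/-- The partners of the non-neighbours are independent. -/
lemma not_adj_mu_mu (h : CrossNearPM G p μ) {q₁ q₂ : V} (h1 : q₁ ∈ nonNb G p)
    (h2 : q₂ ∈ nonNb G p) : ¬ G.Adj (μ q₁) (μ q₂) := by
  intro hadj
  have h12 : q₁ ≠ q₂ := by rintro rfl; exact hadj.ne rfl
  obtain ⟨q₃, h3, h31, h32⟩ := h.exists_ne_ne q₁ q₂
  have hp3 := h.adj_mu h3
  have n1 := (mem_nonNb.1 h1).1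
  have n2 := (mem_nonNb.1 h2).1
  have n3 := (mem_nonNb.1 h3).1
  obtain ⟨a1, a2, a3, a4⟩ := h.mu_spec n1
  obtain ⟨b1, b2, b3, b4⟩ := h.mu_spec n2
  obtain ⟨c1, c2, c3, c4⟩ := h.mu_spec n3
  have d1 := h.ne_mu h1 h2
  have d2 := h.ne_mu h1 h3
  have d3 := h.ne_mu h2 h1
  have d4 := h.ne_mu h2 h3
  have d5 := h.ne_mu h3 h1
  have d6 := h.ne_mu h3 h2
  have e1 := h.mu_inj n1 n2 h12
  have e2 := h.mu_inj n1 n3 h31.symm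
  have e3 := h.mu_inj n2 n3 h32.symm
  -- The supposed edge and the edge from `p` to `μ q₃` leave `q₁`, `q₂`, `q₃` missed.
  refine h.triple_false h1 h2 h3 h12 h31.symm h32.symm
    (h.pm.exchange (T := {q₁, μ q₁, q₂, μ q₂, q₃, μ q₃}) ?_
      (hasPM_four hadj hp3 a1 e2 b1 e3) ?_ ?_)
  · simp only [mem_insert, mem_singleton]; grind
  · simp only [mem_insert, mem_singleton, mem_compl]; grind
  · simp only [mem_insert, mem_singleton, mem_compl]; grind

end CrossNearPM

/-! ### Regular graphs with a cross matching missing one vertex -/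

/-- A regular stable graph with a perfect matching missing only `p`. -/
structure RegularNearPM (G : SimpleGraph V) (Δ : ℕ) (p : V) (μ : V → V) : Prop
    extends CrossNearPM G p μ where
  regular : ∀ v, dg G v = Δ
  triple : TripleDominated G

namespace RegularNearPM

variable {p : V} {μ : V → V}

lemma card_nonNb (h : RegularNearPM G Δ p μ) : (nonNb G p).card + Δ + 1 = Fintype.card V := by
  have := EdgeStability.card_nonNb G p
  rw [h.regular p] at this
  exact this

end RegularNearPM

variable {V : Type*} [Fintype V] {G : SimpleGraph V} {Δ : ℕ} {S : Finset V}

namespace RegularNearPM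

variable {p : V} {μ : V → V}

/-- There are no two disjoint edges between non-neighbours. -/
lemma not_two_edges (h : RegularNearPM G Δ p μ) {q₁ q₂ q₃ q₄ : V} (h1 : q₁ ∈ nonNb G p)
    (h2 : q₂ ∈ nonNb G p) (h3 : q₃ ∈ nonNb G p) (h4 : q₄ ∈ nonNb G p) (h12 : G.Adj q₁ q₂)
    (h34 : G.Adj q₃ q₄) (h13 : q₁ ≠ q₃) (h14 : q₁ ≠ q₄) (h23 : q₂ ≠ q₃) (h24 : q₂ ≠ q₄) :
    False := by
  have n1 := (mem_nonNb.1 h1).1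
  have n2 := (mem_nonNb.1 h2).1
  have n3 := (mem_nonNb.1 h3).1
  have n4 := (mem_nonNb.1 h4).1
  have e12 := h12.ne
  have e34 := h34.ne
  obtain ⟨a1, a2, a3, a4⟩ := h.mu_spec n1
  obtain ⟨b1, b2, b3, b4⟩ := h.mu_spec n2
  obtain ⟨c1, c2, c3, c4⟩ := h.mu_spec n3
  obtain ⟨d1, d2, d3, d4⟩ := h.mu_spec n4
  have f12 := h.mu_inj n1 n2 e12
  have f13 := h.mu_inj n1 n3 h13
  have f14 := h.mu_inj n1 n4 h14
  have f23 := h.mu_inj n2 n3 h23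
  have f24 := h.mu_inj n2 n4 h24
  have f34 := h.mu_inj n3 n4 e34
  have g12 := h.ne_mu h1 h2
  have g13 := h.ne_mu h1 h3
  have g14 := h.ne_mu h1 h4
  have g21 := h.ne_mu h2 h1
  have g23 := h.ne_mu h2 h3
  have g24 := h.ne_mu h2 h4
  have g31 := h.ne_mu h3 h1
  have g32 := h.ne_mu h3 h2
  have g34 := h.ne_mu h3 h4
  have g41 := h.ne_mu h4 h1
  have g42 := h.ne_mu h4 h2
  have g43 := h.ne_mu h4 h3
  -- The two edges, and the edge from `p` to `μ q₁`, leave three partners missed; partners are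
  -- independent, so these do not dominate `μ q₁`.
  have hPM : HasPM G ({μ q₂, μ q₃, μ q₄}ᶜ) := by
    refine h.pm.exchange (T := {q₁, μ q₁, q₂, μ q₂, q₃, μ q₃, q₄, μ q₄}) ?_
      (hasPM_six (h.adj_mu h1) (hasPM_four h12 h34 h13 h14 h23 h24) n1.symm n2.symm n3.symm n4.symm
        a4.symm g21.symm g31.symm g41.symm) ?_ ?_
    · simp only [mem_insert, mem_singleton]; grind
    · simp only [mem_insert, mem_singleton, mem_compl]; grind
    · simp only [mem_insert, mem_singleton, mem_compl]; grind
  rcases h.triple _ _ _ (μ q₁) f23 f24 f34 f12 f13 f14 hPM with h5 | h5 | h5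
  exacts [h.not_adj_mu_mu h1 h2 h5, h.not_adj_mu_mu h1 h3 h5, h.not_adj_mu_mu h1 h4 h5]

/-- Both adjacencies, with the edge from `p` to the partner of a third non-neighbour, would give a
matching missing three non-neighbours of `p`. -/
lemma not_adj_of_adj (h : RegularNearPM G Δ p μ) {l q₁ q₂ : V} (hl : G.Adj p l)
    (hl' : G.Adj p (μ l)) (h1 : q₁ ∈ nonNb G p) (h2 : q₂ ∈ nonNb G p) (h12 : q₁ ≠ q₂)
    (hlq : G.Adj (μ q₁) l) : ¬ G.Adj (μ q₂) (μ l) := by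
  intro hlq'
  obtain ⟨q₃, h3, h31, h32⟩ := h.exists_ne_ne q₁ q₂
  have n1 := (mem_nonNb.1 h1).1
  have n2 := (mem_nonNb.1 h2).1
  have n3 := (mem_nonNb.1 h3).1
  obtain ⟨a1, a2, a3, a4⟩ := h.mu_spec n1
  obtain ⟨b1, b2, b3, b4⟩ := h.mu_spec n2
  obtain ⟨c1, c2, c3, c4⟩ := h.mu_spec n3
  obtain ⟨d1, d2, d3, d4⟩ := h.mu_spec hl.ne'
  have hne : ∀ q, q ∈ nonNb G p → q ≠ l ∧ q ≠ μ l ∧ μ q ≠ l ∧ μ q ≠ μ l := by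
    intro q hq
    have h6 : q ≠ l := by rintro rfl; exact (mem_nonNb.1 hq).2 hl
    have h7 : q ≠ μ l := by rintro rfl; exact (mem_nonNb.1 hq).2 hl'
    refine ⟨h6, h7, ?_, h.mu_inj (mem_nonNb.1 hq).1 hl.ne' h6⟩
    rintro rfl
    exact h7 (h.mu_spec (mem_nonNb.1 hq).1).2.1.symm
  obtain ⟨e1, e2, e3, e4⟩ := hne q₁ h1
  obtain ⟨e5, e6, e7, e8⟩ := hne q₂ h2
  obtain ⟨e9, e10, e11, e12⟩ := hne q₃ h3
  clear hne
  have f12 := h.mu_inj n1 n2 h12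
  have f13 := h.mu_inj n1 n3 h31.symm
  have f23 := h.mu_inj n2 n3 h32.symm
  have g12 := h.ne_mu h1 h2
  have g13 := h.ne_mu h1 h3
  have g21 := h.ne_mu h2 h1
  have g23 := h.ne_mu h2 h3
  have g31 := h.ne_mu h3 h1
  have g32 := h.ne_mu h3 h2
  have n4 := hl.ne
  refine h.triple_false h1 h2 h3 h12 h31.symm h32.symm
    (h.pm.exchange (T := {q₁, μ q₁, q₂, μ q₂, q₃, μ q₃, l, μ l}) ?_
      (hasPM_six (h.adj_mu h3) (hasPM_four hlq hlq' f12 e4 e7.symm d4)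
        a1.symm n4 b1.symm d1.symm f13.symm e11 f23.symm e12) ?_ ?_)
  · simp only [mem_insert, mem_singleton]; grind
  · simp only [mem_insert, mem_singleton, mem_compl]; grind
  · simp only [mem_insert, mem_singleton, mem_compl]; grind

/-- The set of partners of the non-neighbours of the missed vertex. -/
noncomputable def partners (G : SimpleGraph V) (p : V) (μ : V → V) : Finset V := (nonNb G p).image μ

lemma card_partners (h : RegularNearPM G Δ p μ) :
    (partners G p μ).card = (nonNb G p).card :=
  card_image_of_injOn fun x hx y hy => h.pm.inj (by simpa using (mem_nonNb.1 hx).1)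
    (by simpa using (mem_nonNb.1 hy).1)

/-- Each partner has exactly one non-neighbour which is not a partner. -/
lemma exists_unique_nonadj (h : RegularNearPM G Δ p μ) {q : V} (hq : q ∈ nonNb G p) :
    ∃ f, f ∉ partners G p μ ∧ ¬ G.Adj (μ q) f ∧
      ∀ x ∉ partners G p μ, ¬ G.Adj (μ q) x → x = f := by
  have hqR : μ q ∈ partners G p μ := mem_image_of_mem _ hq
  -- By regularity a partner has as many non-neighbours as `p`, namely as many as there are
  -- partners. The other partners account for all but one.
  have hsub : (partners G p μ).erase (μ q) ⊆ nonNb G (μ q) := by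
    intro x hx
    obtain ⟨hxq, hx⟩ := mem_erase.1 hx
    obtain ⟨q', hq', rfl⟩ := mem_image.1 hx
    exact mem_nonNb.2 ⟨hxq, h.not_adj_mu_mu hq hq'⟩
  have h1 := card_sdiff_add_card_eq_card hsub
  have h2 := card_erase_add_one hqR
  have h3 := EdgeStability.card_nonNb G (μ q)
  have h4 := h.card_nonNb
  rw [h.regular] at h3
  rw [h.card_partners] at h2
  obtain ⟨f, hf⟩ := card_eq_one.1 (show (nonNb G (μ q) \ (partners G p μ).erase (μ q)).card = 1 by
    omega)
  have h5 : ∀ x, x ∈ nonNb G (μ q) \ (partners G p μ).erase (μ q) ↔ x = f := fun x => by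
    rw [hf, mem_singleton]
  simp only [mem_sdiff, mem_nonNb, mem_erase, not_and] at h5
  obtain ⟨⟨h6, h7⟩, h8⟩ := (h5 f).2 rfl
  refine ⟨f, h8 h6, h7, fun x hx hxq => (h5 x).1 ⟨⟨?_, hxq⟩, fun _ => hx⟩⟩
  rintro rfl; exact hx hqR

/-- If both `l` and `μ l` were adjacent to partners, `not_adj_of_adj` would allow only one common
partner `μ q₁`. A different partner is not adjacent to `μ l`, hence is adjacent to `l` by uniqueness
of its exceptional non-neighbour, and it conflicts with `μ q₁`. -/
lemma nonadj_all_of_adj (h : RegularNearPM G Δ p μ) {l : V} (hl : G.Adj p l)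
    (hl' : G.Adj p (μ l)) :
    (∀ q ∈ nonNb G p, ¬ G.Adj (μ q) l) ∨ ∀ q ∈ nonNb G p, ¬ G.Adj (μ q) (μ l) := by
  obtain ⟨d1, d2, d3, d4⟩ := h.mu_spec hl.ne'
  have hlR : l ∉ partners G p μ := by
    intro hcon
    obtain ⟨q, hq, rfl⟩ := mem_image.1 hcon
    rw [(h.mu_spec (mem_nonNb.1 hq).1).2.1] at hl'
    exact (mem_nonNb.1 hq).2 hl'
  have hlR' : μ l ∉ partners G p μ := by
    intro hcon
    obtain ⟨q, hq, he⟩ := mem_image.1 hcon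
    have : q = l := h.pm.inj (by simpa using (mem_nonNb.1 hq).1) (by simpa using hl.ne') he
    exact (mem_nonNb.1 hq).2 (this ▸ hl)
  by_contra hcon
  push Not at hcon
  obtain ⟨⟨q₁, h1, h1l⟩, q, hq, hql⟩ := hcon
  have h2 : ∀ q' ∈ nonNb G p, q' ≠ q₁ → ¬ G.Adj (μ q') (μ l) := fun q' hq' hne =>
    h.not_adj_of_adj hl hl' h1 hq' hne.symm h1l
  obtain ⟨q₂, hq₂, hne, -⟩ := h.exists_ne_ne q₁ q₁
  have h3 := h2 q₂ hq₂ hne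
  obtain ⟨f, -, -, hf⟩ := h.exists_unique_nonadj hq₂
  have h4 : G.Adj (μ q₂) l := by
    by_contra h4
    exact d4 ((hf l hlR h4).trans (hf _ hlR' h3).symm)
  have hqq : q = q₁ := by
    by_contra hne'
    exact h2 q hq hne' hql
  exact h.not_adj_of_adj hl hl' hq₂ hq (hqq ▸ hne) h4 hql

/-- No vertex adjacent to the missed vertex has its partner adjacent to the missed vertex. -/
lemma not_adj_mu (h : RegularNearPM G Δ p μ) {l : V} (hl : G.Adj p l) : ¬ G.Adj p (μ l) := by
  intro hl'
  wlog hall : ∀ q ∈ nonNb G p, ¬ G.Adj (μ q) l generalizing l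
  · have h1 := (h.nonadj_all_of_adj hl hl').resolve_left hall
    exact this hl' (by rwa [(h.mu_spec hl.ne').2.1]) h1
  have hnR : ∀ l, G.Adj p l → G.Adj p (μ l) → l ∉ partners G p μ := by
    intro l hl hl' hcon
    obtain ⟨q, hq, rfl⟩ := mem_image.1 hcon
    rw [(h.mu_spec (mem_nonNb.1 hq).1).2.1] at hl'
    exact (mem_nonNb.1 hq).2 hl'
  obtain ⟨d1, d2, d3, d4⟩ := h.mu_spec hl.ne'
  have hlR := hnR l hl hl'
  -- Here `l` is the exceptional non-neighbour of every partner, so partners are joined to all other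
  -- non-partners.
  have hadjR : ∀ q ∈ nonNb G p, ∀ x ∉ partners G p μ, x ≠ l → G.Adj (μ q) x := by
    intro q hq x hx hxl
    obtain ⟨f, -, -, hf⟩ := h.exists_unique_nonadj hq
    by_contra hcon
    exact hxl ((hf x hx hcon).trans (hf l hlR (hall q hq)).symm)
  obtain ⟨q₀, hq₀, -, -⟩ := h.exists_ne_ne l l
  have huniq : ∀ l', G.Adj p l' → G.Adj p (μ l') → l' = l ∨ l' = μ l := by
    intro l' h1 h2
    obtain ⟨e1, e2, e3, e4⟩ := h.mu_spec h1.ne'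
    rcases h.nonadj_all_of_adj h1 h2 with h3 | h3
    · left
      by_contra hne
      exact h3 q₀ hq₀ (hadjR q₀ hq₀ l' (hnR l' h1 h2) hne)
    · right
      by_contra hne
      refine h3 q₀ hq₀ (hadjR q₀ hq₀ (μ l') (hnR _ h2 (by rwa [e2])) fun he => hne ?_)
      rw [← he, e2]
  have hcN := h.card_nonNb
  have hcR := h.card_partners
  have h4 := h.four_le
  have hlR' := hnR (μ l) hl' (by rwa [d2])
  -- the degree is `|nonNb| + 2`
  have hΔ : Δ = (nonNb G p).card + 2 := by
    have h1 : nb G p = insert l (insert (μ l) (partners G p μ)) := by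
      ext x
      rw [mem_nb, mem_insert, mem_insert]
      constructor
      · intro hx
        by_cases hx' : G.Adj p (μ x)
        · have := huniq x hx hx'
          tauto
        · obtain ⟨e1, e2, e3, e4⟩ := h.mu_spec hx.ne'
          right; right
          exact mem_image.2 ⟨μ x, mem_nonNb.2 ⟨e1, hx'⟩, e2⟩
      · rintro (rfl | rfl | hx)
        · exact hl
        · exact hl'
        · obtain ⟨q, hq, rfl⟩ := mem_image.1 hx
          exact h.adj_mu hq
    have h2 := h.regular p
    rw [dg, h1, card_insert_of_notMem (by simp [hlR, d4]), card_insert_of_notMem hlR', hcR] at h2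
    exact h2.symm
  -- `l` is adjacent to all vertices which are not partners
  have hadjl : ∀ x ∉ partners G p μ, x ≠ l → G.Adj l x := by
    have h1 : partners G p μ ⊆ nonNb G l := by
      intro x hx
      obtain ⟨q, hq, rfl⟩ := mem_image.1 hx
      exact mem_nonNb.2 ⟨fun e => hlR (e ▸ hx), fun e => hall q hq e.symm⟩
    have h2 := EdgeStability.card_nonNb G l
    rw [h.regular] at h2
    have h3 := eq_of_subset_of_card_le h1 (by omega)
    intro x hx hxl
    by_contra hcon
    exact hx (h3 ▸ mem_nonNb.2 ⟨hxl, hcon⟩)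
  have hpR : p ∉ partners G p μ := by
    intro hcon
    obtain ⟨q, hq, he⟩ := mem_image.1 hcon
    exact (h.adj_mu hq).ne he.symm
  have hQR : ∀ q ∈ nonNb G p, q ∉ partners G p μ := by
    intro q hq hcon
    obtain ⟨q', hq', he⟩ := mem_image.1 hcon
    exact h.ne_mu hq hq' he.symm
  have hQl : ∀ q ∈ nonNb G p, q ≠ l ∧ q ≠ μ l := by
    intro q hq
    exact ⟨fun e => (mem_nonNb.1 hq).2 (e ▸ hl), fun e => (mem_nonNb.1 hq).2 (e ▸ hl')⟩
  have hm : nb G (μ l) = insert p (insert l (partners G p μ)) := by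
    symm
    refine eq_of_subset_of_card_le ?_ ?_
    · intro x hx
      rw [mem_nb]
      simp only [mem_insert] at hx
      rcases hx with rfl | rfl | hx
      · exact hl'.symm
      · exact d3.symm
      · obtain ⟨q, hq, rfl⟩ := mem_image.1 hx
        exact (hadjR q hq (μ l) hlR' d4.symm).symm
    · rw [card_insert_of_notMem (by simp [hpR, hl.ne]), card_insert_of_notMem hlR, hcR]
      have := h.regular (μ l)
      unfold dg at this
      omega
  -- The neighbours of `q` include `l` and all partners; the degree `|nonNb| + 2` leaves exactly one
  -- inside the non-neighbours of `p`.
  have hQ1 : ∀ q ∈ nonNb G p, ((nonNb G p).filter fun x => G.Adj q x).card = 1 := by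
    intro q hq
    have h1 : nb G q = insert l (partners G p μ) ∪ (nonNb G p).filter fun x => G.Adj q x := by
      ext x
      simp only [mem_nb, mem_union, mem_insert, mem_filter]
      constructor
      · intro hx
        by_cases hxp : x = p
        · subst hxp; exact absurd hx.symm (mem_nonNb.1 hq).2
        by_cases hxQ : x ∈ nonNb G p
        · exact Or.inr ⟨hxQ, hx⟩
        left
        have hpx : G.Adj p x := by rw [mem_nonNb] at hxQ; tauto
        by_cases hx' : G.Adj p (μ x)
        · rcases huniq x hpx hx' with h5 | h5
          · exact Or.inl h5
          · exfalso
            have h6 : q ∈ nb G (μ l) := mem_nb.2 (h5 ▸ hx.symm)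
            rw [hm] at h6
            simp only [mem_insert] at h6
            rcases h6 with h6 | h6 | h6
            exacts [(mem_nonNb.1 hq).1 h6, (hQl q hq).1 h6, hQR q hq h6]
        · obtain ⟨e1, e2, e3, e4⟩ := h.mu_spec hpx.ne'
          exact Or.inr (mem_image.2 ⟨μ x, mem_nonNb.2 ⟨e1, hx'⟩, e2⟩)
      · rintro ((rfl | hx) | hx)
        · exact (hadjl q (hQR q hq) (hQl q hq).1).symm
        · obtain ⟨q', hq', rfl⟩ := mem_image.1 hx
          exact (hadjR q' hq' q (hQR q hq) (hQl q hq).1).symm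
        · exact hx.2
    have h2 := h.regular q
    rw [dg, h1, card_union_of_disjoint, card_insert_of_notMem hlR, hcR] at h2
    · omega
    · rw [Finset.disjoint_right]
      intro x hx hx'
      rw [mem_filter] at hx
      rcases mem_insert.1 hx' with h5 | h5
      exacts [(hQl x hx.1).1 h5, hQR x hx.1 h5]
  have hQex : ∀ q ∈ nonNb G p, ∃ q' ∈ nonNb G p, G.Adj q q' ∧ ∀ x ∈ nonNb G p, G.Adj q x → x = q' := by
    intro q hq
    obtain ⟨q', hq'⟩ := card_eq_one.1 (hQ1 q hq)
    have h5 : ∀ x, x ∈ ((nonNb G p).filter fun x => G.Adj q x) ↔ x = q' := fun x => by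
      rw [hq', mem_singleton]
    simp only [mem_filter] at h5
    exact ⟨q', ((h5 q').2 rfl).1, ((h5 q').2 rfl).2, fun x hx hqx => (h5 x).1 ⟨hx, hqx⟩⟩
  -- The at least four non-neighbours of `p` thus induce a perfect matching, which has two disjoint
  -- edges.
  obtain ⟨q₁, hq₁, h01, hu0⟩ := hQex q₀ hq₀
  obtain ⟨q₂, hq₂, h20, h21⟩ := h.exists_ne_ne q₀ q₁
  obtain ⟨q₃, hq₃, h23, hu2⟩ := hQex q₂ hq₂
  obtain ⟨q₄, hq₄, h14, hu1⟩ := hQex q₁ hq₁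
  refine h.not_two_edges hq₀ hq₁ hq₂ hq₃ h01 h23 h20.symm ?_ h21.symm ?_
  · rintro rfl
    exact h21 (hu0 q₂ hq₂ h23.symm)
  · rintro rfl
    exact h20 ((hu1 q₂ hq₂ h23.symm).trans (hu1 q₀ hq₀ h01.symm).symm)

/-- Otherwise the edges `cy` and from `p` to `μ c` give a matching missing `μ y`, `f`, `μ f`, none
of which is adjacent to `μ q₀`. -/
lemma nonadj_eq_of_edge (h : RegularNearPM G Δ p μ) {c y q₀ f : V} (hc : c ∈ nonNb G p)
    (hy : y ∈ nonNb G p) (hq₀ : q₀ ∈ nonNb G p) (hf : f ∈ nonNb G p) (hcy : G.Adj c y)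
    (hqf : ¬ G.Adj (μ q₀) f) (hq₀y : q₀ ≠ y) : f = c ∨ f = y := by
  by_contra hcon
  push Not at hcon
  obtain ⟨hfc, hfy⟩ := hcon
  have n1 := (mem_nonNb.1 hc).1
  have n2 := (mem_nonNb.1 hy).1
  have n3 := (mem_nonNb.1 hf).1
  have n4 := (mem_nonNb.1 hq₀).1
  obtain ⟨a1, a2, a3, a4⟩ := h.mu_spec n1
  obtain ⟨b1, b2, b3, b4⟩ := h.mu_spec n2
  obtain ⟨c1, c2, c3, c4⟩ := h.mu_spec n3
  obtain ⟨d1, d2, d3, d4⟩ := h.mu_spec n4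
  have h0f : q₀ ≠ f := by rintro rfl; exact hqf d3.symm
  have e1 := hcy.ne
  have f12 := h.mu_inj n1 n2 e1
  have f13 := h.mu_inj n1 n3 hfc.symm
  have f23 := h.mu_inj n2 n3 hfy.symm
  have g12 := h.ne_mu hc hy
  have g13 := h.ne_mu hc hf
  have g21 := h.ne_mu hy hc
  have g23 := h.ne_mu hy hf
  have g31 := h.ne_mu hf hc
  have g32 := h.ne_mu hf hy
  have g34 := h.ne_mu hf hq₀
  have hPM : HasPM G ({μ y, f, μ f}ᶜ) := by
    refine h.pm.exchange (T := {c, μ c, y, μ y, f, μ f}) ?_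
      (hasPM_four hcy (h.adj_mu hc) n1 a4 n2 g21) ?_ ?_
    · simp only [mem_insert, mem_singleton]; grind
    · simp only [mem_insert, mem_singleton, mem_compl]; grind
    · simp only [mem_insert, mem_singleton, mem_compl]; grind
  rcases h.triple _ _ _ (μ q₀) g32.symm f23 c4 (h.mu_inj n4 n2 hq₀y) g34.symm
    (h.mu_inj n4 n3 h0f) hPM with h5 | h5 | h5
  exacts [h.not_adj_mu_mu hq₀ hy h5, hqf h5, h.not_adj_mu_mu hq₀ hf h5]

/-- The neighbours of `p` are now exactly the partners, Δ in number. Each partner has a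
non-neighbour among the non-neighbours of `p`, so these cannot be independent. Given an edge `cy`
among them, every such exception is `c` or `y`; each of these two misses only one partner, so there
are at most two partners instead of at least four. -/
protected lemma false (h : RegularNearPM G Δ p μ) : False := by
  have hcN := h.card_nonNb
  have hcR := h.card_partners
  have h4 := h.four_le
  have hnbp : nb G p = partners G p μ := by
    ext x
    rw [mem_nb]
    constructor
    · intro hx
      obtain ⟨e1, e2, e3, e4⟩ := h.mu_spec hx.ne'
      exact mem_image.2 ⟨μ x, mem_nonNb.2 ⟨e1, h.not_adj_mu hx⟩, e2⟩
    · intro hx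
      obtain ⟨q, hq, rfl⟩ := mem_image.1 hx
      exact h.adj_mu hq
  have hΔ : Δ = (nonNb G p).card := by
    rw [← hcR, ← hnbp]; exact (h.regular p).symm
  have hnonadj : ∀ q ∈ nonNb G p, ∃ f ∈ nonNb G p, ¬ G.Adj (μ q) f := by
    intro q hq
    obtain ⟨f, hfR, hqf, -⟩ := h.exists_unique_nonadj hq
    refine ⟨f, ?_, hqf⟩
    rw [← hnbp, mem_nb] at hfR
    exact mem_nonNb.2 ⟨fun e => hqf (e ▸ (h.adj_mu hq).symm), hfR⟩
  have hpart : ∀ x, x ≠ p → x ∉ nonNb G p → x ∈ partners G p μ := by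
    intro x hx hxQ
    rw [← hnbp, mem_nb]
    rw [mem_nonNb] at hxQ
    tauto
  have hQR : ∀ q ∈ nonNb G p, q ∉ partners G p μ := by
    intro q hq
    rw [← hnbp, mem_nb]
    exact (mem_nonNb.1 hq).2
  obtain ⟨c, y, hc, hy, hcy⟩ : ∃ c y, c ∈ nonNb G p ∧ y ∈ nonNb G p ∧ G.Adj c y := by
    by_contra hcon
    push Not at hcon
    obtain ⟨q, hq, -, -⟩ := h.exists_ne_ne p p
    obtain ⟨f, hf, hqf⟩ := hnonadj q hq
    have h1 : nb G f ⊆ partners G p μ := by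
      intro x hx
      rw [mem_nb] at hx
      refine hpart x ?_ fun hxQ => hcon f x hf hxQ hx
      rintro rfl; exact (mem_nonNb.1 hf).2 hx.symm
    have h2 := eq_of_subset_of_card_le h1 (by
      have := h.regular f
      unfold dg at this
      omega)
    have h3 : μ q ∈ nb G f := h2 ▸ mem_image_of_mem _ hq
    exact hqf (mem_nb.1 h3).symm
  have hf : ∀ q ∈ nonNb G p, ∀ f ∈ nonNb G p, ¬ G.Adj (μ q) f → f = c ∨ f = y := by
    intro q hq f hf hqf
    by_cases hqy : q = y
    · have hqc : q ≠ c := fun e => hcy.ne (e.symm.trans hqy)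
      exact (h.nonadj_eq_of_edge hy hc hq hf hcy.symm hqf hqc).symm
    · exact h.nonadj_eq_of_edge hc hy hq hf hcy hqf hqy
  have hiso : ∀ q ∈ nonNb G p, q ≠ c → q ≠ y → nb G q = partners G p μ := by
    intro q hq hqc hqy
    symm
    refine eq_of_subset_of_card_le ?_ ?_
    · intro x hx
      obtain ⟨q', hq', rfl⟩ := mem_image.1 hx
      rw [mem_nb]
      by_contra hcon
      rcases hf q' hq' q hq (fun h => hcon h.symm) with h5 | h5
      exacts [hqc h5, hqy h5]
    · have := h.regular q
      unfold dg at this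
      omega
  -- One of the Δ neighbours of `a` is `b` and the others are partners, of which there are Δ.
  have hone : ∀ a b, a ∈ nonNb G p → b ∈ nonNb G p → G.Adj a b →
      (∀ q ∈ nonNb G p, q ≠ a → q ≠ b → nb G q = partners G p μ) →
      ((partners G p μ) \ nb G a).card = 1 := by
    intro a b ha hb hab hiso
    have h1 : (nb G a).erase b ⊆ partners G p μ := by
      intro x hx
      rw [mem_erase, mem_nb] at hx
      refine hpart x ?_ fun hxQ => ?_
      · rintro rfl; exact (mem_nonNb.1 ha).2 hx.2.symm
      · have h2 := hiso x hxQ hx.2.ne' hx.1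
        have h3 : a ∈ nb G x := mem_nb.2 hx.2.symm
        rw [h2] at h3
        exact hQR a ha h3
    have h2 : partners G p μ \ nb G a = partners G p μ \ (nb G a).erase b := by
      ext x
      have := hQR b hb
      simp only [mem_sdiff, mem_erase]
      constructor
      · rintro ⟨h1, h2⟩; exact ⟨h1, fun h3 => h2 h3.2⟩
      · rintro ⟨h1, h2⟩; exact ⟨h1, fun h3 => h2 ⟨fun e => this (e ▸ h1), h3⟩⟩
    have h3 := card_sdiff_add_card_eq_card h1
    have h5 := card_erase_add_one (mem_nb.2 hab)
    have h6 := h.regular a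
    unfold dg at h6
    rw [h2]
    omega
  have hcov : partners G p μ ⊆ (partners G p μ \ nb G c) ∪ (partners G p μ \ nb G y) := by
    intro x hx
    obtain ⟨q, hq, rfl⟩ := mem_image.1 hx
    obtain ⟨f, hfQ, hqf⟩ := hnonadj q hq
    rw [mem_union, mem_sdiff, mem_sdiff, mem_nb, mem_nb]
    rcases hf q hq f hfQ hqf with rfl | rfl
    · exact Or.inl ⟨hx, fun h => hqf h.symm⟩
    · exact Or.inr ⟨hx, fun h => hqf h.symm⟩
  have h5 := (card_le_card hcov).trans (card_union_le _ _)
  rw [hone c y hc hy hcy hiso,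
    hone y c hy hc hcy.symm fun q hq h1 h2 => hiso q hq h2 h1] at h5
  omega

end RegularNearPM

/-- A regular stable graph of degree at most `|V| - 5` has no perfect matching missing exactly one
vertex. -/
lemma Stable.not_hasPM_compl_singleton (hG : Stable G Δ) (hreg : ∀ v, dg G v = Δ) (hΔ : 2 ≤ Δ)
    (hcard : Δ + 5 ≤ Fintype.card V) (p : V) : ¬ HasPM G {p}ᶜ := by
  rintro ⟨μ, hμ⟩
  have hT := hG.tripleDominated hreg hΔ
  have h : NearPM G p μ := ⟨hμ, by
      have := card_nonNb G p
      rw [hreg] at this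
      omega, fun {a b c} ha hb hc hab hac hbc hm => by
      rw [mem_nonNb] at ha hb hc
      rcases hT a b c p hab hac hbc ha.1.symm hb.1.symm hc.1.symm hm with h | h | h
      exacts [ha.2 h, hb.2 h, hc.2 h]⟩
  -- A single matching edge inside the non-neighbours of `p` forces all of them to be matched
  -- inside, and then the closed neighbourhood of `p` splits off.
  refine RegularNearPM.false ⟨⟨h, fun {q₁} h1 h1' => ?_⟩, hreg, hT⟩
  have hall : ∀ q ∈ nonNb G p, μ q ∈ nonNb G p := fun q hq => h.mu_mem_nonNb h1 h1' hq
  have hY : (insert p (nb G p))ᶜ = nonNb G p := by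
    ext x; simp
  refine hG.not_split (Y := insert p (nb G p)) (c := p) (by simp) ?_ ?_ ?_ ?_
    (fun v _ => hreg v)
  · intro y hy x hyx
    rw [mem_insert, mem_nb] at hy ⊢
    rcases hy with rfl | hy
    · exact Or.inr hyx
    · by_contra hcon
      push Not at hcon
      exact h.not_adj_of_mem hall hy (mem_nonNb.2 hcon) hyx
  · rw [erase_insert (by simp)]
    refine ⟨μ, h.pm.mono ?_ ?_⟩
    · intro x hx; simpa using (mem_nb.1 hx).ne'
    · intro x hx; rw [mem_nb] at hx ⊢; exact h.adj_mu_of_mem hall hx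
  · rw [hY]
    refine ⟨μ, h.pm.mono ?_ hall⟩
    intro x hx; simpa using (mem_nonNb.1 hx).1
  · rw [hY]; exact h.four_le

/-! ### Exactly one non-full vertex -/

variable {V : Type*} [Fintype V] {G : SimpleGraph V} {Δ : ℕ} {S : Finset V}

/-- Every vertex except `w` has full degree. -/
structure OneNonfull (G : SimpleGraph V) (Δ : ℕ) (w : V) : Prop where
  stable : Stable G Δ
  full : ∀ v, v ≠ w → dg G v = Δ
  lt : dg G w < Δ
  le : dg G w + 5 ≤ Fintype.card V

namespace OneNonfull

variable {w : V} {μ : V → V}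

/-- As `w` is not full, the missed triple is not a full triangle, and `w` cannot be the dominating
vertex. -/
lemma dominated (h : OneNonfull G Δ w) {x y v : V} (hx : x ≠ w) (hy : y ≠ w) (hxy : x ≠ y)
    (hm : HasPM G ({w, x, y}ᶜ)) (hvw : v ≠ w) (hvx : v ≠ x) (hvy : v ≠ y) :
    G.Adj v x ∨ G.Adj v y := by
  obtain ⟨z, hz, hzf, hvz⟩ := h.stable.exists_full_adj hm
    (card_compl_triple hx.symm hy.symm hxy) (p := v) (fun hcon => by
      have := (hcon w (by simp)).1
      have := h.lt
      omega) (by simp [*])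
  simp only [mem_compl, mem_insert, mem_singleton, not_not] at hz
  rcases hz with rfl | rfl | rfl
  · have := h.lt; omega
  · exact Or.inl hvz
  · exact Or.inr hvz

lemma pairDominated (h : OneNonfull G Δ w) : PairDominated G {w}ᶜ := by
  intro x hx y hy hxy hm v hv hvx hvy
  simp only [mem_compl, mem_singleton] at hx hy hv
  refine h.dominated hx hy hxy (hm.congr ?_) hv hvx hvy
  ext z
  simp only [mem_sdiff, mem_compl, mem_insert, mem_singleton]
  tauto

lemma mem_iff {a b z : V} : z ∈ ({w, a, b}ᶜ : Finset V) ↔ z ≠ w ∧ z ≠ a ∧ z ≠ b := by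
  simp

/-- Otherwise an alternating path from `a` to `b` would give a matching missing only `w`. The next
lemmas build on this as in the case of three cliques, with parts grown from `a` and `b`. -/
lemma not_adj_of_partner {a b : V} (hno : ¬ HasPM G {w}ᶜ) (ha : a ≠ w)
    (hb : b ≠ w) (hab : a ≠ b) (hμ : IsPM G ({w, a, b}ᶜ) μ) {x : V} (hxw : x ≠ w) (hxa : x ≠ a)
    (hxb : x ≠ b) (h1 : G.Adj x a) : ¬ G.Adj (μ x) b := by
  intro h2
  obtain ⟨m1, m2, m3⟩ := hμ x (mem_iff.2 ⟨hxw, hxa, hxb⟩)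
  rw [mem_iff] at m1
  obtain ⟨m4, m5, m6⟩ := m1
  have e1 := m3.ne
  refine hno (hμ.exchange (T := {x, μ x}) ?_ (hasPM_four h1 h2 e1 hxb m5.symm hab) ?_ ?_)
  · simp only [mem_insert, mem_singleton]; grind
  · simp only [mem_insert, mem_singleton, mem_compl]; grind
  · simp only [mem_insert, mem_singleton, mem_compl]; grind

lemma adj_partner (h : OneNonfull G Δ w) {a b : V} (hno : ¬ HasPM G {w}ᶜ) (ha : a ≠ w)
    (hb : b ≠ w) (hab : a ≠ b) (hμ : IsPM G ({w, a, b}ᶜ) μ) {x : V} (hxw : x ≠ w) (hxa : x ≠ a)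
    (hxb : x ≠ b) (h1 : G.Adj x a) : G.Adj (μ x) a := by
  have m1 := (hμ x (mem_iff.2 ⟨hxw, hxa, hxb⟩)).1
  rw [mem_iff] at m1
  exact (h.dominated ha hb hab ⟨μ, hμ⟩ m1.1 m1.2.1 m1.2.2).resolve_right
    (not_adj_of_partner hno ha hb hab hμ hxw hxa hxb h1)

lemma not_adj_both (h : OneNonfull G Δ w) {a b : V} (hno : ¬ HasPM G {w}ᶜ) (ha : a ≠ w)
    (hb : b ≠ w) (hab : a ≠ b) (hμ : IsPM G ({w, a, b}ᶜ) μ) {x : V} (hxw : x ≠ w) (hxa : x ≠ a)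
    (hxb : x ≠ b) (h1 : G.Adj x a) : ¬ G.Adj x b := by
  have m := hμ x (mem_iff.2 ⟨hxw, hxa, hxb⟩)
  have h2 := h.adj_partner hno ha hb hab hμ hxw hxa hxb h1
  have h3 := not_adj_of_partner hno ha hb hab hμ (mem_iff.1 m.1).1 (mem_iff.1 m.1).2.1
    (mem_iff.1 m.1).2.2 h2
  rwa [m.2.1] at h3

lemma not_adj_cross (h : OneNonfull G Δ w) {a b : V} (hno : ¬ HasPM G {w}ᶜ) (ha : a ≠ w)
    (hb : b ≠ w) (hab : a ≠ b) (hμ : IsPM G ({w, a, b}ᶜ) μ) {x y : V} (hxw : x ≠ w) (hxa : x ≠ a)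
    (hxb : x ≠ b) (hyw : y ≠ w) (hya : y ≠ a) (hyb : y ≠ b) (h1 : G.Adj x a) (h2 : G.Adj y b) :
    ¬ G.Adj x y := by
  intro hxy
  obtain ⟨m1, m2, m3⟩ := hμ x (mem_iff.2 ⟨hxw, hxa, hxb⟩)
  obtain ⟨m4, m5, m6⟩ := hμ y (mem_iff.2 ⟨hyw, hya, hyb⟩)
  have h1' := h.adj_partner hno ha hb hab hμ hxw hxa hxb h1
  have hμ' : IsPM G ({w, b, a}ᶜ) μ := by
    have : ({w, b, a} : Finset V) = {w, a, b} := by ext z; simp only [mem_insert, mem_singleton]; tauto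
    rwa [this]
  have h2' := h.adj_partner hno hb ha hab.symm hμ' hyw hyb hya h2
  have hyx : y ≠ μ x := by
    rintro rfl
    exact not_adj_of_partner hno ha hb hab hμ hxw hxa hxb h1 h2
  rw [mem_iff] at m1 m4
  obtain ⟨m7, m8, m9⟩ := m1
  obtain ⟨n7, n8, n9⟩ := m4
  have e1 := m3.ne
  have e2 := m6.ne
  have e3 := hxy.ne
  have e4 : x ≠ μ y := by grind
  have e5 : μ x ≠ μ y := by grind
  refine hno (hμ.exchange (T := {x, μ x, y, μ y}) ?_
    (hasPM_six hxy (hasPM_four h1' h2' e5 m9 n8.symm hab) e1 hxa e4 hxb hyx hya e2 hyb) ?_ ?_)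
  · simp only [mem_insert, mem_singleton]; grind
  · simp only [mem_insert, mem_singleton, mem_compl]; grind
  · simp only [mem_insert, mem_singleton, mem_compl]; grind

lemma not_adj_ends {a b : V} (hno : ¬ HasPM G {w}ᶜ) (ha : a ≠ w) (hb : b ≠ w)
    (hμ : IsPM G ({w, a, b}ᶜ) μ) : ¬ G.Adj a b := by
  intro hab
  refine hno (hμ.exchange (T := ∅) (by simp) (hasPM_pair hab) ?_ ?_)
  · simp only [mem_insert, mem_singleton, mem_compl]; grind
  · have := hab.ne
    simp only [mem_insert, mem_singleton, mem_compl, notMem_empty]; grind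

/-- Neighbours other than `w` belong to the same part. -/
lemma part_of_adj (h : OneNonfull G Δ w) {a b : V} (hno : ¬ HasPM G {w}ᶜ) (ha : a ≠ w)
    (hb : b ≠ w) (hab : a ≠ b) (hμ : IsPM G ({w, a, b}ᶜ) μ) {x y : V} (hxw : x ≠ w) (hyw : y ≠ w)
    (hx : x = a ∨ G.Adj x a) (hxy : G.Adj x y) : y = a ∨ G.Adj y a := by
  have hnab := not_adj_ends hno ha hb hμ
  rcases hx with rfl | hx
  · exact Or.inr hxy.symm
  by_cases hya : y = a
  · exact Or.inl hya
  have hxa := hx.ne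
  have hxb : x ≠ b := by rintro rfl; exact hnab hx.symm
  have hyb : y ≠ b := by
    rintro rfl
    exact h.not_adj_both hno ha hb hab hμ hxw hxa hxb hx hxy
  rcases h.dominated ha hb hab ⟨μ, hμ⟩ hyw hya hyb with h1 | h1
  · exact Or.inr h1
  · exact (h.not_adj_cross hno ha hb hab hμ hxw hxa hxb hyw hya hyb hx h1 hxy).elim

/-- If `a` is adjacent to `w`, its part has Δ vertices, each with degree Δ and with neighbours only
in the part and `w`. All of them are then adjacent to `w`, which would have degree at least Δ. -/
lemma not_adj_nonfull (h : OneNonfull G Δ w) {a b : V} (hno : ¬ HasPM G {w}ᶜ) (ha : a ≠ w)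
    (hb : b ≠ w) (hab : a ≠ b) (hμ : IsPM G ({w, a, b}ᶜ) μ) : ¬ G.Adj a w := by
  intro haw
  set A : Finset V := insert a ((nb G a).erase w) with hA
  have hAm : ∀ x, x ∈ A ↔ x ≠ w ∧ (x = a ∨ G.Adj x a) := by
    intro x
    rw [hA, mem_insert, mem_erase, mem_nb]
    constructor
    · rintro (rfl | ⟨h1, h2⟩)
      · exact ⟨ha, Or.inl rfl⟩
      · exact ⟨h1, Or.inr h2.symm⟩
    · rintro ⟨h1, rfl | h2⟩
      · exact Or.inl rfl
      · exact Or.inr ⟨h1, h2.symm⟩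
  have hAcard : A.card = Δ := by
    rw [hA, card_insert_of_notMem (by simp), card_erase_add_one (mem_nb.2 haw)]
    exact h.full a ha
  have hsub : A ⊆ nb G w := by
    intro x hx
    have hx' := (hAm x).1 hx
    have h1 : nb G x ⊆ insert w (A.erase x) := by
      intro y hy
      rw [mem_nb] at hy
      rw [mem_insert, mem_erase]
      by_cases hyw : y = w
      · exact Or.inl hyw
      · exact Or.inr ⟨hy.ne', (hAm y).2
          ⟨hyw, h.part_of_adj hno ha hb hab hμ hx'.1 hyw hx'.2 hy⟩⟩
    have h2 : (insert w (A.erase x)).card ≤ (nb G x).card := by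
      have h3 := h.full x hx'.1
      have h4 := card_erase_add_one hx
      have h5 := card_insert_le w (A.erase x)
      unfold dg at h3
      omega
    have h3 := eq_of_subset_of_card_le h1 h2
    have h4 : w ∈ nb G x := h3 ▸ mem_insert_self _ _
    exact mem_nb.2 (mem_nb.1 h4).symm
  have h1 := card_le_card hsub
  have h2 := h.lt
  unfold dg at h2
  omega

/-- Rematching `a` with the partner of `x` leaves `w`, `x`, `b` missed, so `x` takes over the role
of `a`. -/
lemma isolated (h : OneNonfull G Δ w) {a b : V} (hno : ¬ HasPM G {w}ᶜ) (ha : a ≠ w)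
    (hb : b ≠ w) (hab : a ≠ b) (hμ : IsPM G ({w, a, b}ᶜ) μ) {x : V} (hxw : x ≠ w)
    (hx : x = a ∨ G.Adj x a) : ¬ G.Adj x w := by
  have hnab := not_adj_ends hno ha hb hμ
  rcases hx with rfl | hx
  · exact h.not_adj_nonfull hno ha hb hab hμ
  have hxa := hx.ne
  have hxb : x ≠ b := by rintro rfl; exact hnab hx.symm
  have hx' := h.adj_partner hno ha hb hab hμ hxw hxa hxb hx
  obtain ⟨m1, m2, m3⟩ := hμ x (mem_iff.2 ⟨hxw, hxa, hxb⟩)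
  rw [mem_iff] at m1
  obtain ⟨m4, m5, m6⟩ := m1
  have e1 := m3.ne
  obtain ⟨ν, hν⟩ : HasPM G ({w, x, b}ᶜ) := by
    refine hμ.exchange (T := {x, μ x}) ?_ (hasPM_pair hx') ?_ ?_
    · simp only [mem_insert, mem_singleton]; grind
    · simp only [mem_insert, mem_singleton, mem_compl]; grind
    · simp only [mem_insert, mem_singleton, mem_compl]; grind
  exact h.not_adj_nonfull hno hxw hb hxb hν

/-- If no perfect matching misses only `w`, then `G` is a union of two cliques and `w`. -/
lemma two_cliques (h : OneNonfull G Δ w) (hS : S.card + 3 = Fintype.card V) (hm : HasPM G S)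
    (hwS : w ∉ S) (hno : ¬ HasPM G {w}ᶜ) :
    Even Δ ∧ ∃ π : V → Fin 3, (∀ x y, G.Adj x y ↔ x ≠ y ∧ π x = π y) ∧
      (univ.filter fun x => π x = 0).card = Δ + 1 ∧
      (univ.filter fun x => π x = 1).card = Δ + 1 ∧ (univ.filter fun x => π x = 2).card = 1 := by
  have hUcard : (Sᶜ).card = 3 := by rw [card_compl]; omega
  obtain ⟨a, haS, haw⟩ := exists_mem_ne (s := Sᶜ) (by omega) w
  obtain ⟨b, hbS, hbw, hba, hall⟩ := exists_third hUcard (mem_compl.2 hwS) haS haw.symm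
  have hS' : S = {w, a, b}ᶜ := by
    ext z
    rw [mem_iff]
    have := hall z
    rw [mem_compl] at this haS hbS
    grind
  subst hS'
  obtain ⟨μ, hμ⟩ := hm
  have hab := hba.symm
  have hμ' : IsPM G ({w, b, a}ᶜ) μ := by
    have : ({w, b, a} : Finset V) = {w, a, b} := by
      ext z; simp only [mem_insert, mem_singleton]; tauto
    rwa [this]
  have hnab := not_adj_ends hno haw hbw hμ
  have hor : ∀ x, x ≠ w → (x = a ∨ G.Adj x a) ∨ (x = b ∨ G.Adj x b) := by
    intro x hxw
    by_cases hxa : x = a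
    · exact Or.inl (Or.inl hxa)
    by_cases hxb : x = b
    · exact Or.inr (Or.inl hxb)
    rcases h.dominated haw hbw hab ⟨μ, hμ⟩ hxw hxa hxb with h1 | h1
    · exact Or.inl (Or.inr h1)
    · exact Or.inr (Or.inr h1)
  have hexcl : ∀ x, x ≠ w → (x = a ∨ G.Adj x a) → ¬ (x = b ∨ G.Adj x b) := by
    rintro x hxw (rfl | h1) (rfl | h2)
    · exact hab rfl
    · exact hnab h2
    · exact hnab h1.symm
    · refine h.not_adj_both hno haw hbw hab hμ hxw h1.ne ?_ h1 h2
      rintro rfl; exact hnab h1.symm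
  have hiso : ∀ x, ¬ G.Adj x w := by
    intro x hxw
    rcases hor x hxw.ne with h1 | h1
    · exact h.isolated hno haw hbw hab hμ hxw.ne h1 hxw
    · exact h.isolated hno hbw haw hba hμ' hxw.ne h1 hxw
  set π : V → Fin 3 := fun x => if x = w then 2 else if x = a ∨ G.Adj x a then 0 else 1 with hπ
  have hπ2 : ∀ x, π x = 2 ↔ x = w := by
    intro x; simp only [hπ]; split_ifs <;> simp [*]
  have hπ0 : ∀ x, π x = 0 ↔ x ≠ w ∧ (x = a ∨ G.Adj x a) := by
    intro x; simp only [hπ]; split_ifs <;> simp [*]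
  have hπ1 : ∀ x, π x = 1 ↔ x ≠ w ∧ (x = b ∨ G.Adj x b) := by
    intro x
    have h1 := hor x
    have h2 := hexcl x
    simp only [hπ]; split_ifs <;> simp <;> tauto
  have hfib : ∀ c, c ≠ w → ∀ i, (∀ x, π x = i ↔ x ≠ w ∧ (x = c ∨ G.Adj x c)) →
      (univ.filter fun x => π x = i).card = Δ + 1 := by
    intro c hcw i hi
    have h1 : (univ.filter fun x => π x = i) = insert c (nb G c) := by
      ext x
      simp only [mem_filter, mem_univ, true_and, hi, mem_insert, mem_nb]
      constructor
      · rintro ⟨-, h1⟩; exact h1.imp id fun h => h.symm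
      · intro h1
        refine ⟨?_, h1.imp id fun h => h.symm⟩
        rintro rfl
        rcases h1 with h1 | h1
        exacts [hcw h1.symm, hiso c h1]
    rw [h1, card_insert_of_notMem (by simp)]
    exact congrArg (· + 1) (h.full c hcw)
  have hc0 := hfib a haw 0 hπ0
  have hc1 := hfib b hbw 1 hπ1
  have hadj : ∀ x y, G.Adj x y → π x = π y := by
    intro x y hxy
    have hxw : x ≠ w := by rintro rfl; exact hiso _ hxy.symm
    have hyw : y ≠ w := by rintro rfl; exact hiso _ hxy
    rcases hor x hxw with h1 | h1
    · rw [(hπ0 x).2 ⟨hxw, h1⟩, (hπ0 y).2 ⟨hyw, h.part_of_adj hno haw hbw hab hμ hxw hyw h1 hxy⟩]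
    · rw [(hπ1 x).2 ⟨hxw, h1⟩, (hπ1 y).2 ⟨hyw, h.part_of_adj hno hbw haw hba hμ' hxw hyw h1 hxy⟩]
  -- The matching respects the parts, hence matches the neighbourhood of `a` within itself.
  have heven : Even Δ := by
    have h1 : IsPM G (nb G a) μ := by
      intro v hv
      rw [mem_nb] at hv
      have hvb : v ≠ b := by rintro rfl; exact hnab hv
      have hvw : v ≠ w := by rintro rfl; exact hiso _ hv
      obtain ⟨h1, h2, h3⟩ := hμ v (by simp [hvb, hvw, hv.ne'])
      refine ⟨?_, h2, h3⟩
      simp only [mem_compl, mem_insert, mem_singleton, not_or] at h1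
      have h4 := (hπ0 _).1 ((hadj v _ h3).symm.trans ((hπ0 v).2 ⟨hvw, Or.inr hv.symm⟩))
      rw [mem_nb]
      exact (h4.2.resolve_left h1.2.1).symm
    have h2 := h1.even_card
    have h3 : (nb G a).card = Δ := h.full a haw
    rwa [h3] at h2
  refine ⟨heven, π, fun x y => ⟨fun h => ⟨h.ne, hadj x y h⟩, ?_⟩, hc0, hc1, ?_⟩
  · rintro ⟨hne, hxy⟩
    have hxw : x ≠ w := by
      rintro rfl
      exact hne ((hπ2 y).1 (hxy ▸ (hπ2 x).2 rfl)).symm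
    have hcx : (univ.filter fun z => π z = π x).card = Δ + 1 := by
      rcases hor x hxw with h1 | h1
      · rw [(hπ0 x).2 ⟨hxw, h1⟩]; exact hc0
      · rw [(hπ1 x).2 ⟨hxw, h1⟩]; exact hc1
    have h1 : nb G x ⊆ (univ.filter fun z => π z = π x).erase x := by
      intro z hz
      rw [mem_nb] at hz
      rw [mem_erase, mem_filter]
      exact ⟨hz.ne', mem_univ _, (hadj x z hz).symm⟩
    have h2 := eq_of_subset_of_card_le h1 (by
      have h3 := card_erase_add_one (s := univ.filter fun z => π z = π x) (a := x) (by simp)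
      have h5 := h.full x hxw
      unfold dg at h5
      omega)
    rw [← mem_nb, h2, mem_erase, mem_filter]
    exact ⟨hne.symm, mem_univ _, hxy.symm⟩
  · rw [card_eq_one]
    exact ⟨w, by ext x; simp [hπ2]⟩

/-- There is no perfect matching missing only `w`. -/
lemma not_hasPM (h : OneNonfull G Δ w) : ¬ HasPM G {w}ᶜ := by
  intro hm
  have hE := h.pairDominated
  have htr : ∀ p q r, p ≠ w → q ≠ w → r ≠ w → ¬ G.Adj p q → ¬ G.Adj p r → ¬ G.Adj q r := by
    intro p q r hp hq hr h1 h2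
    by_cases hpq : p = q
    · exact hpq ▸ h2
    by_cases hpr : p = r
    · subst hpr; exact fun h => h1 h.symm
    by_cases hqr : q = r
    · subst hqr; exact G.irrefl
    exact nonadj_trans hm hE (by simpa) (by simpa) (by simpa) hpq hpr hqr h1 h2
  have hcQ := card_nonNb G w
  have hQ4 : 4 ≤ (nonNb G w).card := by have := h.le; omega
  set cls : V → Finset V := fun v => univ.filter fun x => x ≠ w ∧ ¬ G.Adj v x with hcls
  have hcm : ∀ v x, x ∈ cls v ↔ x ≠ w ∧ ¬ G.Adj v x := fun v x => by simp [hcls]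
  -- Non-adjacency is an equivalence away from `w`, and class sizes differ by one according to
  -- adjacency to `w`. A class therefore lies entirely inside or entirely outside the neighbourhood
  -- of `w`.
  have hcard : ∀ v, v ≠ w →
      (cls v).card + Δ + (if G.Adj v w then 0 else 1) = Fintype.card V := by
    intro v hv
    have h1 : (cls v)ᶜ = insert w (nb G v) := by
      ext x
      rw [mem_compl, hcm, mem_insert, mem_nb]; tauto
    have h2 := card_add_card_compl (cls v)
    have h3 := h.full v hv
    unfold dg at h3
    rw [h1] at h2
    split_ifs with h4
    · rw [insert_eq_of_mem (mem_nb.2 h4)] at h2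
      omega
    · rw [card_insert_of_notMem (by simpa using h4)] at h2
      omega
  have hself : ∀ v, v ≠ w → v ∈ cls v := fun v hv => (hcm v v).2 ⟨hv, G.irrefl⟩
  have heq : ∀ u v, u ≠ w → v ≠ w → ¬ G.Adj u v → cls u = cls v := by
    intro u v hu hv huv
    ext x
    rw [hcm, hcm]
    refine and_congr_right fun hx => ⟨fun h1 => htr u v x hu hv hx huv h1,
      fun h1 => htr v u x hv hu hx (fun h => huv h.symm) h1⟩
  have hcompl : ∀ q ∈ nonNb G w, ∀ x, G.Adj w x → G.Adj q x := by
    intro q hq x hx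
    rw [mem_nonNb] at hq
    by_contra hqx
    have h1 := hcard q hq.1
    have h2 := hcard x hx.ne'
    rw [heq q x hq.1 hx.ne' hqx, if_neg (fun h => hq.2 h.symm)] at h1
    rw [if_pos hx.symm] at h2
    omega
  by_cases hN : ∀ x, ¬ G.Adj w x
  · have hW : ({w} : Finset V)ᶜ = nonNb G w := by
      ext x; simp [hN]
    refine h.stable.not_split (Y := {w}) (c := w) (by simp) ?_ ?_ hm (by rw [hW]; exact hQ4)
      fun v hv => h.full v (by simpa using hv)
    · intro y hy x hyx
      rw [mem_singleton] at hy
      subst hy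
      exact (hN x hyx).elim
    · have : ({w} : Finset V).erase w = ∅ := by simp
      rw [this]; exact hasPM_empty
  push Not at hN
  obtain ⟨x₁, hx₁⟩ := hN
  obtain ⟨q₀, hq₀⟩ : (nonNb G w).Nonempty := by rw [← card_pos]; omega
  have hq₀' := mem_nonNb.1 hq₀
  have hclsN : ∀ x, G.Adj w x → ∀ z ∈ cls x, G.Adj w z := by
    intro x hx z hz
    rw [hcm] at hz
    by_contra hcon
    exact hz.2 (hcompl z (mem_nonNb.2 ⟨hz.1, hcon⟩) x hx).symm
  have hclsQ : ∀ q ∈ nonNb G w, cls q ⊆ nonNb G w := by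
    intro q hq z hz
    rw [hcm] at hz
    exact mem_nonNb.2 ⟨hz.1, fun h => hz.2 (hcompl q hq z h)⟩
  have hc₀ := hcard q₀ hq₀'.1
  rw [if_neg fun h => hq₀'.2 h.symm] at hc₀
  have hp₀ := card_pos.2 ⟨q₀, hself q₀ hq₀'.1⟩
  obtain ⟨x₂, hx₂, hx21⟩ : ∃ x₂, G.Adj w x₂ ∧ x₂ ≠ x₁ := by
    have h1 := hcard x₁ hx₁.ne'
    rw [if_pos hx₁.symm] at h1
    obtain ⟨z, hz, hne⟩ := exists_mem_ne (s := cls x₁) (by omega) x₁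
    exact ⟨z, hclsN x₁ hx₁ z hz, hne⟩
  obtain ⟨μ, hμ⟩ := hm
  -- A matching missing three non-neighbours of `w` would leave `w` undominated with two common
  -- neighbours `x₁`, `x₂`, one more than allowed.
  have hP : NearPM G w μ := by
    refine ⟨hμ, hQ4, fun {a b c} ha hb hc hab hac hbc hm => ?_⟩
    have hmem : ∀ u, u ∉ ({a, b, c}ᶜ : Finset V) → u ∈ nonNb G w := by
      intro u hu
      simp only [mem_compl, mem_insert, mem_singleton, not_not] at hu
      rcases hu with rfl | rfl | rfl <;> assumption
    have haS : a ∉ ({a, b, c}ᶜ : Finset V) := by simp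
    refine hx21 (h.stable.common_adj_unique hm (card_compl_triple hab hac hbc) (p := w) ?_
      (fun u hu => (mem_nonNb.1 (hmem u hu)).2) haS haS hx₂ hx₁ (hcompl a ha x₂ hx₂)
      (hcompl a ha x₁ hx₁))
    by_contra hw
    exact (mem_nonNb.1 (hmem w hw)).1 rfl
  have hC : CrossNearPM G w μ := ⟨hP, fun {q} hq hq' =>
    hP.not_adj_of_mem (fun q₂ hq₂ => hP.mu_mem_nonNb hq hq' hq₂) hx₁ hq (hcompl q hq x₁ hx₁).symm⟩
  have hr := hC.adj_mu hq₀
  -- The independent partners lie in one class, so `w` has at most n - Δ non-neighbours. They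
  -- contain two disjoint classes of size n - Δ - 1, which forces n - Δ ≤ 2, against the at least
  -- four non-neighbours.
  have hR : (nonNb G w).image μ ⊆ cls (μ q₀) := by
    intro x hx
    obtain ⟨q, hq, rfl⟩ := mem_image.1 hx
    exact (hcm _ _).2 ⟨(hC.adj_mu hq).ne', hC.not_adj_mu_mu hq₀ hq⟩
  have hRc := card_le_card hR
  rw [card_image_of_injOn fun x hx y hy => hμ.inj (by simpa using (mem_nonNb.1 hx).1)
    (by simpa using (mem_nonNb.1 hy).1)] at hRc
  have hcr := hcard _ hr.ne'
  rw [if_pos hr.symm] at hcr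
  have hlt := h.lt
  obtain ⟨q₁, hq₁, hq₁c⟩ : ∃ q₁ ∈ nonNb G w, q₁ ∉ cls q₀ := by
    by_contra hcon
    push Not at hcon
    have := card_le_card (show nonNb G w ⊆ cls q₀ from hcon)
    omega
  have hq₁' := mem_nonNb.1 hq₁
  have hc₁ := hcard q₁ hq₁'.1
  rw [if_neg fun h => hq₁'.2 h.symm] at hc₁
  have hd : Disjoint (cls q₀) (cls q₁) := by
    rw [Finset.disjoint_left]
    intro z hz hz'
    rw [hcm] at hz hz'
    refine hq₁c ((hcm _ _).2 ⟨hq₁'.1, ?_⟩)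
    exact htr z q₀ q₁ hz.1 hq₀'.1 hq₁'.1 (fun h => hz.2 h.symm) (fun h => hz'.2 h.symm)
  have h5 := card_le_card (union_subset (hclsQ q₀ hq₀) (hclsQ q₁ hq₁))
  rw [card_union_of_disjoint hd] at h5
  omega

end OneNonfull

/-! ### Reduction to at most two non-full vertices, and the case of exactly two -/

variable {V : Type*} [Fintype V] {G : SimpleGraph V} {Δ : ℕ} {S : Finset V}

/-- A perfect matching missing three vertices can be changed to cover full vertices only. -/
lemma Stable.exists_full_matching (hG : Stable G Δ) (hn : 5 ≤ Fintype.card V) :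
    ∀ (k : ℕ) (S : Finset V) (μ : V → V), (S.filter fun v => dg G v ≠ Δ).card = k → IsPM G S μ →
      S.card + 3 = Fintype.card V → EdgeColorable (cut G S μ) Δ →
      ∃ S', HasPM G S' ∧ S'.card + 3 = Fintype.card V ∧ (∀ v ∈ S', dg G v = Δ) ∧
        ∃ u ∉ S', dg G u = Δ := by
  intro k
  induction k with
  | zero =>
    intro S μ hk hμ hS hcol
    have hfull : ∀ v ∈ S, dg G v = Δ := by
      intro v hv
      by_contra h
      have h1 : v ∈ S.filter fun v => dg G v ≠ Δ := mem_filter.2 ⟨hv, h⟩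
      rw [card_eq_zero] at hk
      simp [hk] at h1
    refine ⟨S, ⟨μ, hμ⟩, hS, hfull, ?_⟩
    obtain ⟨p, hp⟩ : S.Nonempty := by rw [← card_pos]; omega
    have h1 := hG.dominated hμ hS hcol hp
    have h2 := hG.dg_le (μ p)
    obtain ⟨u, hu⟩ : ((nb G p).filter fun z => z ∉ S ∧ dg G z = Δ).Nonempty := by
      rw [← card_pos]; omega
    exact ⟨u, (mem_filter.1 hu).2⟩
  | succ k ih =>
    intro S μ hk hμ hS hcol
    obtain ⟨w, hw⟩ : (S.filter fun v => dg G v ≠ Δ).Nonempty := by rw [← card_pos]; omega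
    obtain ⟨hwS, hwf⟩ := mem_filter.1 hw
    obtain ⟨m1, m2, m3⟩ := hμ w hwS
    have h1 := hG.dominated hμ hS hcol m1
    rw [m2] at h1
    have h2 := hG.dg_le w
    obtain ⟨u, hu⟩ : ((nb G (μ w)).filter fun z => z ∉ S ∧ dg G z = Δ).Nonempty := by
      rw [← card_pos]; omega
    rw [mem_filter, mem_nb] at hu
    obtain ⟨hau, huS, huf⟩ := hu
    have e1 := m3.ne
    -- The partner of a non-full `w` has a full neighbour among the missed vertices and is rematched
    -- with it. The new missed triple contains `w`, so it is not a full triangle and colourability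
    -- is kept.
    obtain ⟨ν, hν⟩ : HasPM G (insert u (S.erase w)) := by
      refine hμ.exchange (T := {w, μ w}) ?_ (hasPM_pair hau) ?_ ?_
      · simp only [mem_insert, mem_singleton]; grind
      · simp only [mem_insert, mem_singleton]; grind
      · simp only [mem_insert, mem_singleton, mem_erase]; grind
    have hcard : (insert u (S.erase w)).card + 3 = Fintype.card V := by
      rw [card_insert_of_notMem (by simp [huS]), card_erase_add_one hwS, hS]
    have hwn : w ∉ insert u (S.erase w) := by
      rw [mem_insert, mem_erase]
      rintro (rfl | h)
      exacts [huS hwS, h.1 rfl]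
    refine ih _ ν ?_ hν hcard
      (colorable_of_not_triangle hG.dg_le hν hcard fun h => hwf (h w hwn).1)
    have h3 : (insert u (S.erase w)).filter (fun v => dg G v ≠ Δ) =
        (S.filter fun v => dg G v ≠ Δ).erase w := by
      ext x
      simp only [mem_filter, mem_insert, mem_erase]
      grind
    rw [h3, card_erase_of_mem hw, hk, Nat.add_sub_cancel]

lemma sum_dg_even (G : SimpleGraph V) : Even (∑ v, dg G v) := by
  have h1 : ∑ v, dg G v = ∑ v, G.degree v := sum_congr rfl fun v _ => dg_eq_degree G v
  rw [h1, G.sum_degrees_eq_twice_card_edges]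
  exact even_two_mul _

lemma sum_dg_of_full {W : Finset V} (h : ∀ v ∉ W, dg G v = Δ) :
    ∑ v, dg G v = (Wᶜ).card * Δ + ∑ v ∈ W, dg G v := by
  rw [← sum_compl_add_sum W, sum_const_nat fun v hv => h v (mem_compl.1 hv)]

/-- Every vertex except `w₁` and `w₂` has full degree, and some perfect matching misses these two
and one further vertex. -/
structure TwoNonfull (G : SimpleGraph V) (Δ : ℕ) (w₁ w₂ : V) : Prop where
  stable : Stable G Δ
  ne : w₁ ≠ w₂
  full : ∀ v, v ≠ w₁ → v ≠ w₂ → dg G v = Δ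
  lt₁ : dg G w₁ < Δ
  lt₂ : dg G w₂ < Δ
  pm : ∃ u, u ≠ w₁ ∧ u ≠ w₂ ∧ HasPM G ({u, w₁, w₂}ᶜ)

namespace TwoNonfull

variable {w₁ w₂ : V}

lemma symm (h : TwoNonfull G Δ w₁ w₂) : TwoNonfull G Δ w₂ w₁ := by
  refine ⟨h.stable, h.ne.symm, fun v h1 h2 => h.full v h2 h1, h.lt₂, h.lt₁, ?_⟩
  obtain ⟨u, h1, h2, h3⟩ := h.pm
  refine ⟨u, h2, h1, h3.congr ?_⟩
  ext z; simp only [mem_compl, mem_insert, mem_singleton]; tauto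

/-- In the missed triple only `c` is full, so `c` must dominate every matched vertex. -/
lemma dominated (h : TwoNonfull G Δ w₁ w₂) {c v : V} (hc1 : c ≠ w₁) (hc2 : c ≠ w₂)
    (hm : HasPM G ({c, w₁, w₂}ᶜ)) (hvc : v ≠ c) (hv1 : v ≠ w₁) (hv2 : v ≠ w₂) : G.Adj v c := by
  obtain ⟨z, hz, hzf, hvz⟩ := h.stable.exists_full_adj hm
    (card_compl_triple hc1 hc2 h.ne) (p := v) (fun hcon => by
      have := (hcon w₁ (by simp)).1
      have := h.lt₁
      omega) (by simp [*])
  simp only [mem_compl, mem_insert, mem_singleton, not_not] at hz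
  rcases hz with rfl | rfl | rfl
  · exact hvz
  · have := h.lt₁; omega
  · have := h.lt₂; omega

/-- The partner of `c` is adjacent to the full missed vertex `u` by domination, so `c` and `u` can
be exchanged. Every full vertex thus dominates all others. -/
lemma hasPM (h : TwoNonfull G Δ w₁ w₂) {c : V} (hc1 : c ≠ w₁) (hc2 : c ≠ w₂) :
    HasPM G ({c, w₁, w₂}ᶜ) := by
  obtain ⟨u, hu1, hu2, hm⟩ := h.pm
  by_cases hcu : c = u
  · exact hcu ▸ hm
  obtain ⟨μ, hμ⟩ := hm
  obtain ⟨m1, m2, m3⟩ := hμ c (by simp [*])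
  simp only [mem_compl, mem_insert, mem_singleton, not_or] at m1
  obtain ⟨m4, m5, m6⟩ := m1
  have ha := h.dominated hu1 hu2 ⟨μ, hμ⟩ m4 m5 m6
  have e1 := m3.ne
  refine hμ.exchange (T := {c, μ c}) ?_ (hasPM_pair ha) ?_ ?_
  · simp only [mem_insert, mem_singleton]; grind
  · simp only [mem_insert, mem_singleton, mem_compl]; grind
  · simp only [mem_insert, mem_singleton, mem_compl]; grind

lemma clique (h : TwoNonfull G Δ w₁ w₂) {x y : V} (hx1 : x ≠ w₁) (hx2 : x ≠ w₂) (hy1 : y ≠ w₁)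
    (hy2 : y ≠ w₂) (hxy : x ≠ y) : G.Adj x y :=
  h.dominated hy1 hy2 (h.hasPM hy1 hy2) hxy hx1 hx2

lemma degree_eq (h : TwoNonfull G Δ w₁ w₂) {c : V} (hc1 : c ≠ w₁) (hc2 : c ≠ w₂) :
    Δ + 3 = Fintype.card V + (if G.Adj c w₁ then 1 else 0) + (if G.Adj c w₂ then 1 else 0) := by
  have h1 : nb G c = ({c, w₁, w₂}ᶜ ∪ (if G.Adj c w₁ then {w₁} else ∅)) ∪
      (if G.Adj c w₂ then {w₂} else ∅) := by
    ext x
    rw [mem_nb, mem_union, mem_union]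
    by_cases hx1 : x = w₁
    · subst hx1
      by_cases ha : G.Adj c x <;> by_cases hb : G.Adj c w₂ <;> simp [ha, hb, h.ne]
    by_cases hx2 : x = w₂
    · subst hx2
      by_cases ha : G.Adj c x <;> by_cases hb : G.Adj c w₁ <;> simp [ha, hb, h.ne.symm]
    by_cases hxc : x = c
    · subst hxc
      by_cases ha : G.Adj x w₁ <;> by_cases hb : G.Adj x w₂ <;> simp [ha, hb, hx1, hx2]
    · have := h.clique hc1 hc2 hx1 hx2 (Ne.symm hxc)
      simp [this, hx1, hx2, hxc]
  have h2 := h.full c hc1 hc2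
  have h3 := card_compl_triple hc1 hc2 h.ne
  unfold dg at h2
  rw [h1, card_union_of_disjoint, card_union_of_disjoint] at h2
  · split_ifs at h2 ⊢ <;> simp only [card_singleton, card_empty] at h2 <;> omega
  · split_ifs <;> simp
  · have := h.ne
    split_ifs <;> simp [this.symm]

/-- From a matching missing a neighbour `b` of `w₁` and both non-full vertices, one pair is dropped.
The full vertices of the resulting critical graph are `b` and that pair, so it contains the edge
from `b` to `w₁`; the adjacency lemma there counts at most two full vertices. -/
lemma not_one (h : TwoNonfull G Δ w₁ w₂) (hn : 5 ≤ Fintype.card V)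
    (hΔ : Δ + 2 = Fintype.card V) : Δ ≤ dg G w₁ + 1 := by
  by_contra hlt
  push Not at hlt
  obtain ⟨b, hb1, hb2, hbw⟩ : ∃ b, b ≠ w₁ ∧ b ≠ w₂ ∧ G.Adj b w₁ := by
    by_contra hcon
    push Not at hcon
    have h1 : ({w₁, w₂} : Finset V)ᶜ ⊆ nb G w₂ := by
      intro c hc
      simp only [mem_compl, mem_insert, mem_singleton, not_or] at hc
      have h2 := h.degree_eq hc.1 hc.2
      rw [if_neg (hcon c hc.1 hc.2)] at h2
      rw [mem_nb]
      by_contra h3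
      rw [if_neg fun h => h3 h.symm] at h2
      omega
    have h2 := card_le_card h1
    have h3 := card_add_card_compl ({w₁, w₂} : Finset V)
    rw [card_pair h.ne] at h3
    have h4 := h.lt₂
    unfold dg at h4
    omega
  obtain ⟨ν, hν⟩ := h.hasPM hb1 hb2
  have hc3 := card_compl_triple hb1 hb2 h.ne
  obtain ⟨c, hc⟩ : (({b, w₁, w₂} : Finset V)ᶜ).Nonempty := by rw [← card_pos]; omega
  have hcard := card_erase_pair hν hc
  have hν' := hν.erase_pair hc
  obtain ⟨K, hK, hKc, hKΔ⟩ := h.stable.exists_critical hν' (by omega)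
  have hKG := hK.trans cut_le
  have hfull : ∀ z, dg K z = Δ → z ∈ ({b, c, ν c} : Finset V) := by
    intro z hz
    have h1 := not_mem_of_full hν' h.stable.dg_le hK hz
    have h2 := (full_of_le h.stable.dg_le hKG hz).1
    have h3 : z ≠ w₁ := by rintro rfl; have := h.lt₁; omega
    have h4 : z ≠ w₂ := by rintro rfl; have := h.lt₂; omega
    simp only [mem_sdiff, mem_compl, mem_insert, mem_singleton] at h1 ⊢
    tauto
  have hbf := (hKc.triangle hKΔ card_le_three hfull b (by simp)).1
  have hKbw := (full_of_le h.stable.dg_le hKG hbf).2 w₁ hbw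
  have h1 := hKc.vizing_adjacency hKΔ hKbw
  have h2 : ((nb K b).filter fun z => z ≠ w₁ ∧ dg K z = Δ) ⊆ {c, ν c} := by
    intro z hz
    rw [mem_filter, mem_nb] at hz
    have h3 := hfull z hz.2.2
    rw [mem_insert] at h3
    exact h3.resolve_left hz.1.ne'
  have h3 := (card_le_card h2).trans card_le_two
  have h4 := dg_mono hKG w₁
  omega

/-- All full vertices form a clique and are not adjacent to the other two vertices. -/
lemma clique_union (h : TwoNonfull G Δ w₁ w₂) (hn : 5 ≤ Fintype.card V)
    (hodd : Odd (Fintype.card V)) (ht : ∑ v, dg G v + 4 ≤ (Δ + 1) * (Fintype.card V - 1)) :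
    ∀ x, x ≠ w₁ → x ≠ w₂ → ¬ G.Adj x w₁ ∧ ¬ G.Adj x w₂ := by
  have hpair := card_pair h.ne
  have hc := card_add_card_compl ({w₁, w₂} : Finset V)
  rw [hpair] at hc
  have hsum := sum_dg_of_full (W := {w₁, w₂}) (Δ := Δ) (G := G) fun v hv => by
    simp only [mem_insert, mem_singleton, not_or] at hv
    exact h.full v hv.1 hv.2
  rw [sum_pair h.ne] at hsum
  -- Here every full vertex is adjacent to both non-full ones, which gives too many edges.
  have hne2 : Δ + 1 ≠ Fintype.card V := by
    intro hΔ
    have hall : ∀ c, c ≠ w₁ → c ≠ w₂ → G.Adj c w₁ ∧ G.Adj c w₂ := by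
      intro c h1 h2
      have h3 := h.degree_eq h1 h2
      split_ifs at h3 with h4 h5 h5
      · exact ⟨h4, h5⟩
      all_goals omega
    have hd : ∀ w, (∀ c, c ≠ w₁ → c ≠ w₂ → G.Adj c w) → Fintype.card V ≤ dg G w + 2 := by
      intro w hw
      have h1 : ({w₁, w₂} : Finset V)ᶜ ⊆ nb G w := by
        intro c hc
        simp only [mem_compl, mem_insert, mem_singleton, not_or] at hc
        exact mem_nb.2 (hw c hc.1 hc.2).symm
      have h2 := card_le_card h1
      unfold dg
      omega
    have h1 := hd w₁ fun c hc1 hc2 => (hall c hc1 hc2).1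
    have h2 := hd w₂ fun c hc1 hc2 => (hall c hc1 hc2).2
    obtain ⟨m, hm⟩ : ∃ m, Fintype.card V = m + 2 := ⟨_, (by omega : _ = Fintype.card V - 2 + 2)⟩
    have e1 : (({w₁, w₂} : Finset V)ᶜ).card = m := by omega
    have e2 : Δ = m + 1 := by omega
    rw [hsum, e1, hm, e2] at ht
    have e3 : m + 2 - 1 = m + 1 := by omega
    rw [e3] at ht
    nlinarith
  -- Both exceptional degrees would be Δ - 1 with Δ odd, making the degree sum Δ² + 2(Δ - 1) odd.
  have hne1 : Δ + 2 ≠ Fintype.card V := by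
    intro hΔ
    have h1 := h.not_one hn hΔ
    have h2 := h.symm.not_one hn hΔ
    have h3 := h.lt₁
    have h4 := h.lt₂
    have h5 := sum_dg_even G
    have e1 : (({w₁, w₂} : Finset V)ᶜ).card = Δ := by omega
    have e2 : dg G w₁ + dg G w₂ = 2 * (Δ - 1) := by omega
    have hΔodd : Odd Δ := by
      obtain ⟨k, hk⟩ := hodd
      exact ⟨k - 1, by omega⟩
    rw [hsum, e1, e2] at h5
    have h6 : Even (Δ * Δ) := by
      rwa [Nat.even_add, iff_true_right (even_two_mul _)] at h5
    exact Nat.not_even_iff_odd.2 (hΔodd.mul hΔodd) h6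
  intro x hx1 hx2
  have h3 := h.degree_eq hx1 hx2
  split_ifs at h3 with h4 h5 h5
  · omega
  · omega
  · omega
  · exact ⟨h4, h5⟩

end TwoNonfull

/-! ### Structure of stable graphs -/

/-- The extremal structures of a stable graph. -/
theorem Stable.structure (hG : Stable G Δ) (hn : 5 ≤ Fintype.card V)
    (hodd : Odd (Fintype.card V)) (ht : ∑ v, dg G v + 4 ≤ (Δ + 1) * (Fintype.card V - 1))
    {μ : V → V} (hμ : IsPM G S μ) (hS : S.card + 3 = Fintype.card V)
    (hcol : EdgeColorable (cut G S μ) Δ) :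
    (∃ w₁ w₂, w₁ ≠ w₂ ∧ (∀ x y, x ≠ w₁ → x ≠ w₂ → y ≠ w₁ → y ≠ w₂ → x ≠ y → G.Adj x y) ∧
      ∀ x, x ≠ w₁ → x ≠ w₂ → ¬ G.Adj x w₁ ∧ ¬ G.Adj x w₂) ∨
    (Even Δ ∧ ∃ π : V → Fin 3, (∀ x y, G.Adj x y ↔ x ≠ y ∧ π x = π y) ∧
      (univ.filter fun x => π x = 0).card = Δ + 1 ∧
      (univ.filter fun x => π x = 1).card = Δ + 1 ∧
      ((univ.filter fun x => π x = 2).card = 1 ∨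
        (univ.filter fun x => π x = 2).card = Δ + 1)) := by
  obtain ⟨S, hm, hS, hfull, u, huS, huf⟩ :=
    hG.exists_full_matching hn _ S μ rfl hμ hS hcol
  have hUcard : (Sᶜ).card = 3 := by rw [card_compl]; omega
  have hcV : Fintype.card V - 1 + 1 = Fintype.card V := by omega
  by_cases hreg : ∀ v, dg G v = Δ
  · right
    have hΔ0 : Δ ≠ 0 := by
      rintro rfl
      refine hG.not_colorable ∅ (by simpa using hn) ⟨fun _ => 0, fun a b hab => ?_, fun v a b hab => ?_⟩
      · have h1 := card_pos.2 ⟨b, mem_nb.2 ((SimpleGraph.deleteEdges_le _) hab)⟩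
        have h2 := hreg a
        unfold dg at h2; omega
      · have h1 := card_pos.2 ⟨a, mem_nb.2 ((SimpleGraph.deleteEdges_le _) hab)⟩
        have h2 := hreg v
        unfold dg at h2; omega
    have hsum : ∑ v, dg G v = Fintype.card V * Δ := by
      rw [sum_const_nat fun v _ => hreg v, card_univ]
    have hΔe : Even Δ := by
      have := sum_dg_even G
      rw [hsum, Nat.even_mul] at this
      exact this.resolve_left (Nat.not_even_iff_odd.2 hodd)
    have hΔ2 : 2 ≤ Δ := by
      obtain ⟨k, hk⟩ := hΔe
      omega
    -- For a regular graph the slack of 4 in the degree sum is precisely this inequality.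
    have hcard : Δ + 5 ≤ Fintype.card V := by
      rw [hsum] at ht
      rw [← hcV] at ht ⊢
      rw [Nat.add_sub_cancel] at ht
      nlinarith
    obtain ⟨π, h1, h2⟩ := three_cliques_of_forall_not_hasPM hreg (hG.tripleDominated hreg hΔ2) hS hm
      (hG.not_hasPM_compl_singleton hreg hΔ2 hcard)
    exact ⟨hΔe, π, h1, h2 0, h2 1, Or.inr (h2 2)⟩
  push Not at hreg
  obtain ⟨w, hw⟩ := hreg
  have hwS : w ∉ S := fun h => hw (hfull w h)
  have hwu : w ≠ u := by rintro rfl; exact hw huf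
  have hlt : ∀ v, dg G v ≠ Δ → dg G v < Δ := fun v hv => lt_of_le_of_ne (hG.dg_le v) hv
  obtain ⟨w', hw'S, hw'u, hw'w, hall⟩ :=
    exists_third hUcard (mem_compl.2 huS) (mem_compl.2 hwS) hwu.symm
  simp only [mem_compl] at hw'S hall
  by_cases hw' : dg G w' = Δ
  · right
    have hfull' : ∀ v, v ≠ w → dg G v = Δ := by
      intro v hv
      by_cases hvS : v ∈ S
      · exact hfull v hvS
      · rcases hall v hvS with rfl | rfl | rfl
        exacts [huf, (hv rfl).elim, hw']
    have hsum := sum_dg_of_full (W := {w}) (Δ := Δ) (G := G) fun v hv => hfull' v (by simpa using hv)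
    have hc1 := card_add_card_compl ({w} : Finset V)
    rw [card_singleton] at hc1
    have hle : dg G w + 5 ≤ Fintype.card V := by
      have e1 : (({w} : Finset V)ᶜ).card = Fintype.card V - 1 := by omega
      rw [sum_singleton, e1] at hsum
      rw [hsum] at ht
      rw [← hcV]
      nlinarith
    have h : OneNonfull G Δ w := ⟨hG, hfull', hlt w hw, hle⟩
    obtain ⟨he, π, h1, h2, h3, h4⟩ := h.two_cliques hS hm hwS h.not_hasPM
    exact ⟨he, π, h1, h2, h3, Or.inl h4⟩
  · left
    have hfull' : ∀ v, v ≠ w → v ≠ w' → dg G v = Δ := by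
      intro v hv hv'
      by_cases hvS : v ∈ S
      · exact hfull v hvS
      · rcases hall v hvS with rfl | rfl | rfl
        exacts [huf, (hv rfl).elim, (hv' rfl).elim]
    have h : TwoNonfull G Δ w w' := by
      refine ⟨hG, hw'w.symm, hfull', hlt w hw, hlt w' hw', u, hwu.symm, hw'u.symm, hm.congr ?_⟩
      ext z
      have := hall z
      simp only [mem_compl, mem_insert, mem_singleton]
      grind
    exact ⟨w, w', h.ne, fun x y h1 h2 h3 h4 h5 => h.clique h1 h2 h3 h4 h5,
      h.clique_union hn hodd ht⟩

/-! ### Chromatic index, and counting in colour classes -/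

variable {V : Type*} [Fintype V] {G : SimpleGraph V} {Δ : ℕ} {S : Finset V}

lemma EdgeColorable.mono_right {k l : ℕ} (h : EdgeColorable G k) (hkl : k ≤ l) :
    EdgeColorable G l := h.imp fun _ hφ => ⟨fun a b hab => (hφ.1 a b hab).trans_le hkl, hφ.2⟩

lemma exists_isProperEdgeColoring_iff {k : ℕ} :
    (∃ c : G.EdgeLabeling (Fin k), G.IsProperEdgeColoring c) ↔ EdgeColorable G k := by
  constructor
  · rintro ⟨c, hc⟩
    refine ⟨fun e => if h : e ∈ G.edgeSet then (c ⟨e, h⟩ : ℕ) else 0, fun a b hab => ?_,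
      fun v a b ha hb he => ?_⟩
    · have h : s(a, b) ∈ G.edgeSet := hab
      simp only [h, dif_pos]
      exact Fin.is_lt _
    · have h1 : s(v, a) ∈ G.edgeSet := ha
      have h2 : s(v, b) ∈ G.edgeSet := hb
      simp only [h1, h2, dif_pos] at he
      by_contra hne
      refine hc ⟨_, h1⟩ ⟨_, h2⟩ (fun h => hne ?_) ⟨v, by simp, by simp⟩ (Fin.ext he)
      exact sym2_eq_left.1 (congrArg Subtype.val h)
  · rintro ⟨φ, hφ⟩
    have hlt : ∀ e : G.edgeSet, φ e.1 < k := by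
      rintro ⟨e, he⟩
      induction e with
      | _ a b => exact hφ.1 a b he
    refine ⟨fun e => ⟨φ e.1, hlt e⟩, ?_⟩
    rintro ⟨e, he⟩ ⟨f, hf⟩ hne ⟨v, hv, hv'⟩ heq
    obtain ⟨a, rfl⟩ := hv
    obtain ⟨b, rfl⟩ := hv'
    have := hφ.2 v a b he hf (by simpa using heq)
    subst this
    exact hne rfl

/-- The hypothesis that some colouring exists keeps the infimum from being the default value 0 of an
empty set. -/
lemma chromaticIndex_le_iff {k l : ℕ} (h : EdgeColorable G l) :
    G.chromaticIndex ≤ k ↔ EdgeColorable G k := by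
  simp only [SimpleGraph.chromaticIndex, exists_isProperEdgeColoring_iff]
  exact ⟨fun hk => EdgeColorable.mono_right (Nat.sInf_mem (s := {k | EdgeColorable G k}) ⟨l, h⟩) hk,
    fun hk => Nat.sInf_le hk⟩

/-- The vertices having a neighbour in their part along an edge of a given colour. -/
noncomputable def colorClass {ι : Type*} (H : SimpleGraph V) (φ : Sym2 V → ℕ) (π : V → ι) (c : ℕ) :
    Finset V := univ.filter fun v => ∃ x, H.Adj v x ∧ π x = π v ∧ φ s(v, x) = c

section counting

variable {ι : Type*} {H : SimpleGraph V} {φ : Sym2 V → ℕ} {π : V → ι} {c : ℕ}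

lemma mem_colorClass {v : V} :
    v ∈ colorClass H φ π c ↔ ∃ x, H.Adj v x ∧ π x = π v ∧ φ s(v, x) = c := by
  simp [colorClass]

lemma exists_isPM_colorClass (hφ : ProperEdgeLabel H Δ φ) :
    ∃ μ, IsPM H (colorClass H φ π c) μ ∧
      ∀ v ∈ colorClass H φ π c, π (μ v) = π v ∧ φ s(v, μ v) = c := by
  have h1 : ∀ v, ∃ x, v ∈ colorClass H φ π c → H.Adj v x ∧ π x = π v ∧ φ s(v, x) = c := by
    intro v
    by_cases hv : v ∈ colorClass H φ π c
    · obtain ⟨x, hx⟩ := mem_colorClass.1 hv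
      exact ⟨x, fun _ => hx⟩
    · exact ⟨v, fun h => (hv h).elim⟩
  choose μ hμ using h1
  have hmem : ∀ v ∈ colorClass H φ π c, μ v ∈ colorClass H φ π c := fun v hv => by
    obtain ⟨h1, h2, h3⟩ := hμ v hv
    exact mem_colorClass.2 ⟨v, h1.symm, h2.symm, by rwa [Sym2.eq_swap]⟩
  refine ⟨μ, fun v hv => ⟨hmem v hv, ?_, (hμ v hv).1⟩, fun v hv => (hμ v hv).2⟩
  obtain ⟨h1, h2, h3⟩ := hμ v hv
  obtain ⟨h4, h5, h6⟩ := hμ _ (hmem v hv)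
  exact hφ.2 _ _ _ h4 h1.symm (by rw [h6, Sym2.eq_swap, h3])

variable [DecidableEq ι]

lemma even_card_colorClass_fiber (hφ : ProperEdgeLabel H Δ φ) (i : ι) :
    Even ((colorClass H φ π c).filter fun v => π v = i).card := by
  obtain ⟨μ, hμ, hμ'⟩ := exists_isPM_colorClass (H := H) (π := π) (c := c) hφ
  refine (hμ.mono (filter_subset _ _) fun v hv => ?_).even_card
  rw [mem_filter] at hv ⊢
  exact ⟨(hμ v hv.1).1, (hμ' v hv.1).1.trans hv.2⟩

lemma sum_card_colorClass (hφ : ProperEdgeLabel H Δ φ) :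
    ∑ c ∈ range Δ, (colorClass H φ π c).card =
      ∑ v, ((nb H v).filter fun x => π x = π v).card := by
  have h1 : ∀ v, ((nb H v).filter fun x => π x = π v).card =
      ((range Δ).filter fun c => v ∈ colorClass H φ π c).card := by
    intro v
    refine card_bij (fun x _ => φ s(v, x)) ?_ ?_ ?_
    · intro x hx
      rw [mem_filter, mem_nb] at hx
      rw [mem_filter, mem_range, mem_colorClass]
      exact ⟨hφ.1 _ _ hx.1, x, hx.1, hx.2, rfl⟩
    · intro x hx y hy he
      rw [mem_filter, mem_nb] at hx hy
      exact hφ.2 v x y hx.1 hy.1 he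
    · intro c hc
      rw [mem_filter, mem_colorClass] at hc
      obtain ⟨-, x, h1, h2, h3⟩ := hc
      exact ⟨x, by rw [mem_filter, mem_nb]; exact ⟨h1, h2⟩, h3⟩
  simp only [h1, card_filter]
  rw [sum_comm]
  refine sum_congr rfl fun c _ => ?_
  rw [← card_filter]
  congr 1
  ext v; simp

/-- A colour class restricted to edges inside the parts is a matching of each part, and so misses at
least one vertex of every odd part. Summing over the Δ colours counts every inner degree once. -/
lemma sum_inner_le [Fintype ι] (hφ : ProperEdgeLabel H Δ φ)
    (hodd : ∀ i, Odd (univ.filter fun v => π v = i).card) :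
    ∑ v, ((nb H v).filter fun x => π x = π v).card + Δ * Fintype.card ι ≤
      Δ * Fintype.card V := by
  rw [← sum_card_colorClass hφ]
  have h1 : ∀ c, (colorClass H φ π c).card + Fintype.card ι ≤ Fintype.card V := by
    intro c
    have h2 := card_eq_sum_card_fiberwise (s := colorClass H φ π c) (t := univ) (f := π)
      (fun _ _ => by simp)
    have h3 := card_eq_sum_card_fiberwise (s := (univ : Finset V)) (t := univ) (f := π)
      (fun _ _ => by simp)
    rw [card_univ] at h3
    rw [h2, h3, ← card_univ (α := ι), card_eq_sum_ones, ← sum_add_distrib]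
    refine sum_le_sum fun i _ => ?_
    have h4 := even_card_colorClass_fiber (H := H) (π := π) (c := c) hφ i
    have h5 : ((colorClass H φ π c).filter fun v => π v = i).card ≤
        (univ.filter fun v => π v = i).card := card_le_card (filter_subset_filter _ (subset_univ _))
    have h6 := hodd i
    rcases h5.lt_or_eq with h7 | h7
    · exact h7
    · rw [h7] at h4
      exact (Nat.not_even_iff_odd.2 h6 h4).elim
  have h2 := sum_le_sum fun c (_ : c ∈ range Δ) => h1 c
  rw [sum_add_distrib, sum_const, sum_const, card_range, smul_eq_mul, smul_eq_mul] at h2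
  exact h2

/-- Each deleted edge lowers at most two inner degrees by one. -/
lemma sum_inner_le_deleteEdges (G : SimpleGraph V) (F : Finset (Sym2 V)) (π : V → ι) :
    ∑ v, ((nb G v).filter fun x => π x = π v).card ≤
      ∑ v, ((nb (G.deleteEdges (F : Set (Sym2 V))) v).filter fun x => π x = π v).card
        + 2 * F.card := by
  have h1 : ∀ v, ((nb G v).filter fun x => π x = π v).card ≤
      ((nb (G.deleteEdges (F : Set (Sym2 V))) v).filter fun x => π x = π v).card
        + (F.filter fun e => v ∈ e).card := by
    intro v
    have h2 : ((nb G v).filter fun x => π x = π v) ⊆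
        ((nb (G.deleteEdges (F : Set (Sym2 V))) v).filter fun x => π x = π v) ∪
          univ.filter fun x => s(v, x) ∈ F := by
      intro x hx
      rw [mem_filter, mem_nb] at hx
      rw [mem_union, mem_filter, mem_filter, mem_nb, SimpleGraph.deleteEdges_adj]
      by_cases hxF : s(v, x) ∈ F
      · exact Or.inr ⟨mem_univ _, hxF⟩
      · exact Or.inl ⟨⟨hx.1, by simpa using hxF⟩, hx.2⟩
    refine (card_le_card h2).trans ((card_union_le _ _).trans (Nat.add_le_add_left ?_ _))
    refine card_le_card_of_injOn (fun x => s(v, x)) ?_ fun x _ y _ h => sym2_eq_left.1 h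
    intro x hx
    have hx' : s(v, x) ∈ F := by simpa using hx
    simp [hx']
  have h3 : ∑ v, (F.filter fun e => v ∈ e).card ≤ 2 * F.card := by
    simp only [card_filter]
    rw [sum_comm, mul_comm, ← smul_eq_mul]
    refine sum_le_card_nsmul _ _ _ fun e _ => ?_
    rw [← card_filter]
    induction e with
    | _ a b =>
      refine (card_le_card (t := {a, b}) fun v hv => ?_).trans card_le_two
      simpa using hv
  have h4 := sum_le_sum fun v (_ : v ∈ (univ : Finset V)) => h1 v
  rw [sum_add_distrib] at h4
  omega

/-- Some colour class of a colouring of a sparse graph misses three vertices. -/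
lemma exists_colorClass (hcol : EdgeColorable G (Δ + 1)) (hodd : Odd (Fintype.card V))
    (hsum : ∑ v, dg G v + 2 ≤ (Δ + 1) * (Fintype.card V - 1)) :
    ∃ S μ, IsPM G S μ ∧ S.card + 3 ≤ Fintype.card V ∧ EdgeColorable (cut G S μ) Δ := by
  obtain ⟨φ, hφ⟩ := hcol
  have h1 : ∑ c ∈ range (Δ + 1), (colorClass G φ (fun _ : V => ()) c).card = ∑ v, dg G v := by
    rw [sum_card_colorClass hφ]
    exact sum_congr rfl fun v _ => by simp [dg]
  -- The Δ + 1 classes cannot all cover n - 1 vertices. A class covering fewer covers at most n - 3,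
  -- by parity.
  obtain ⟨c, hc, hlt⟩ : ∃ c ∈ range (Δ + 1),
      (colorClass G φ (fun _ => ()) c).card < Fintype.card V - 1 := by
    by_contra hcon
    push Not at hcon
    have h3 := sum_le_sum hcon
    rw [sum_const, card_range, smul_eq_mul, h1] at h3
    omega
  obtain ⟨μ, hμ, hμc⟩ := exists_isPM_colorClass (H := G) (π := fun _ => ()) (c := c) hφ
  -- Once class `c` is deleted, its name is given to the last colour Δ.
  refine ⟨_, μ, hμ, ?_, fun e => if φ e = Δ then c else φ e, ?_⟩
  · obtain ⟨k, hk⟩ := hμ.even_card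
    obtain ⟨l, hl⟩ := hodd
    omega
  have hne : ∀ a b, (cut G (colorClass G φ (fun _ => ()) c) μ).Adj a b →
      G.Adj a b ∧ φ s(a, b) ≠ c := by
    intro a b hab
    rw [cut_adj hμ] at hab
    refine ⟨hab.1, fun he => hab.2 ?_⟩
    have ha : a ∈ colorClass G φ (fun _ => ()) c := mem_colorClass.2 ⟨b, hab.1, rfl, he⟩
    exact ⟨ha, hφ.2 a _ _ (hμ a ha).2.2 hab.1 ((hμc a ha).2.trans he.symm)⟩
  rw [mem_range] at hc
  constructor
  · intro a b hab
    obtain ⟨h3, h4⟩ := hne a b hab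
    have h5 := hφ.1 a b h3
    dsimp only
    split_ifs <;> omega
  · intro v a b ha hb he
    obtain ⟨h3, h4⟩ := hne v a ha
    obtain ⟨h5, h6⟩ := hne v b hb
    dsimp only at he
    refine hφ.2 v a b h3 h5 ?_
    split_ifs at he <;> omega

end counting

/-! ### Bounds for the stability index of Class 2 graphs -/

section classTwo

variable [DecidableRel G.Adj]

lemma dg_le_maxDegree (v : V) : dg G v ≤ G.maxDegree := by
  rw [dg_eq_degree]; exact G.degree_le_maxDegree v

lemma maxDegree_eq_of (h : ∀ v, dg G v ≤ Δ) {v : V} (hv : dg G v = Δ) : G.maxDegree = Δ := by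
  refine le_antisymm (G.maxDegree_le_of_forall_degree_le _ fun w => ?_) (hv ▸ dg_le_maxDegree v)
  rw [← dg_eq_degree]; exact h w

lemma edgeColorable_card_sym2 (G : SimpleGraph V) : EdgeColorable G (Fintype.card (Sym2 V)) :=
  ⟨fun e => Fintype.equivFin _ e, fun _ _ _ => Fin.is_lt _, fun _ _ _ _ _ h =>
    sym2_eq_left.1 ((Fintype.equivFin (Sym2 V)).injective (Fin.ext h))⟩

lemma not_edgeColorable (hG : G.IsClassTwo) : ¬ EdgeColorable G G.maxDegree := by
  rw [← chromaticIndex_le_iff (edgeColorable_card_sym2 G)]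
  have h : G.chromaticIndex = G.maxDegree + 1 := hG
  omega

lemma edgeColorable_succ (hG : G.IsClassTwo) : EdgeColorable G (G.maxDegree + 1) := by
  rw [← chromaticIndex_le_iff (edgeColorable_card_sym2 G)]
  exact le_of_eq hG

/-- Restoring one deleted edge costs at most one colour. -/
lemma EdgeColorable.of_erase {F : Finset (Sym2 V)} {e : Sym2 V}
    (h : EdgeColorable (G.deleteEdges (F : Set (Sym2 V))) Δ) :
    EdgeColorable (G.deleteEdges ((F.erase e : Finset (Sym2 V)) : Set (Sym2 V))) (Δ + 1) := by
  obtain ⟨φ, hφ⟩ := h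
  have hadj : ∀ a b, (G.deleteEdges ((F.erase e : Finset (Sym2 V)) : Set (Sym2 V))).Adj a b →
      s(a, b) ≠ e → (G.deleteEdges (F : Set (Sym2 V))).Adj a b := by
    intro a b hab hne
    rw [SimpleGraph.deleteEdges_adj] at hab ⊢
    refine ⟨hab.1, fun h => hab.2 ?_⟩
    simp only [mem_coe, mem_erase] at h ⊢
    exact ⟨hne, h⟩
  refine ⟨fun f => if f = e then Δ else φ f, fun a b hab => ?_, fun v a b ha hb he => ?_⟩
  · dsimp only
    split_ifs with h
    · omega
    · have := hφ.1 _ _ (hadj a b hab h); omega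
  · dsimp only at he
    split_ifs at he with h1 h2 h2
    · exact sym2_eq_left.1 (h1.trans h2.symm)
    · have := hφ.1 _ _ (hadj v b hb h2); omega
    · have := hφ.1 _ _ (hadj v a ha h1); omega
    · exact hφ.2 v a b (hadj v a ha h1) (hadj v b hb h2) he

/-- The stability index asks for edges of `G` and for an exact drop of the chromatic index, whereas
here only Δ-colourability is known. A minimal subset of `F` works: it has no superfluous pairs, and
if Δ - 1 colours sufficed, one deleted edge could be restored with colour to spare. -/
lemma exists_deletion (hG : G.IsClassTwo) {F : Finset (Sym2 V)}
    (hF : EdgeColorable (G.deleteEdges (F : Set (Sym2 V))) G.maxDegree) :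
    ∃ F' : Finset (Sym2 V), F' ⊆ F ∧ (F' : Set (Sym2 V)) ⊆ G.edgeSet ∧
      (G.deleteEdges (F' : Set (Sym2 V))).chromaticIndex + 1 = G.chromaticIndex := by
  obtain ⟨F', hF'F, hmin⟩ := exists_minimal_le_of_wellFoundedLT
    (fun F : Finset (Sym2 V) => EdgeColorable (G.deleteEdges (F : Set (Sym2 V))) G.maxDegree) F hF
  have herase : ∀ e ∈ F', ¬ EdgeColorable
      (G.deleteEdges ((F'.erase e : Finset (Sym2 V)) : Set (Sym2 V))) G.maxDegree := by
    intro e he h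
    exact (notMem_erase e F') ((hmin.2 h (erase_subset e F')) he)
  have hne : F'.Nonempty := by
    rw [nonempty_iff_ne_empty]
    rintro rfl
    refine not_edgeColorable hG ?_
    simpa using hmin.1
  refine ⟨F', hF'F, fun e he => ?_, ?_⟩
  · by_contra heG
    refine herase e he (hmin.1.mono ?_)
    intro a b hab
    rw [SimpleGraph.deleteEdges_adj] at hab ⊢
    refine ⟨hab.1, fun h => hab.2 ?_⟩
    simp only [mem_coe, mem_erase] at h ⊢
    refine ⟨?_, h⟩
    rintro rfl; exact heG hab.1
  · have h1 := (chromaticIndex_le_iff (k := G.maxDegree) (edgeColorable_card_sym2 _)).2 hmin.1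
    have h2 : G.chromaticIndex = G.maxDegree + 1 := hG
    rw [h2]
    by_contra hcon
    have h3 : (G.deleteEdges (F' : Set (Sym2 V))).chromaticIndex ≤ G.maxDegree - 1 := by omega
    rw [chromaticIndex_le_iff (edgeColorable_card_sym2 _)] at h3
    obtain ⟨e, he⟩ := hne
    refine herase e he ?_
    have h4 := h3.of_erase (e := e)
    have h5 : G.maxDegree - 1 + 1 = G.maxDegree := by omega
    rwa [h5] at h4

lemma chromaticEdgeStabilityIndex_le (hG : G.IsClassTwo) {F : Finset (Sym2 V)}
    (hF : EdgeColorable (G.deleteEdges (F : Set (Sym2 V))) G.maxDegree) :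
    G.chromaticEdgeStabilityIndex ≤ F.card := by
  obtain ⟨F', h1, h2, h3⟩ := exists_deletion hG hF
  have h4 : F'.card ∈ {k : ℕ | ∃ F : Finset (Sym2 V), (F : Set (Sym2 V)) ⊆ G.edgeSet ∧
      F.card = k ∧ (G.deleteEdges (F : Set (Sym2 V))).chromaticIndex + 1 = G.chromaticIndex} :=
    ⟨F', h2, rfl, h3⟩
  exact (Nat.sInf_le h4).trans (card_le_card h1)

lemma exists_chromaticEdgeStabilityIndex (hG : G.IsClassTwo) :
    ∃ F : Finset (Sym2 V), F.card = G.chromaticEdgeStabilityIndex ∧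
      EdgeColorable (G.deleteEdges (F : Set (Sym2 V))) G.maxDegree := by
  have h0 : EdgeColorable (G.deleteEdges ((univ : Finset (Sym2 V)) : Set (Sym2 V))) G.maxDegree :=
    ⟨fun _ => 0, fun _ _ hab => by simp at hab, fun _ _ _ hab => by simp at hab⟩
  obtain ⟨F', h1, h2, h3⟩ := exists_deletion hG h0
  have hne : {k : ℕ | ∃ F : Finset (Sym2 V), (F : Set (Sym2 V)) ⊆ G.edgeSet ∧ F.card = k ∧
      (G.deleteEdges (F : Set (Sym2 V))).chromaticIndex + 1 = G.chromaticIndex}.Nonempty :=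
    ⟨_, F', h2, rfl, h3⟩
  obtain ⟨F, h4, h5, h6⟩ := Nat.sInf_mem hne
  refine ⟨F, h5, ?_⟩
  rw [← chromaticIndex_le_iff (edgeColorable_card_sym2 _)]
  have h7 : G.chromaticIndex = G.maxDegree + 1 := hG
  omega

lemma chromaticEdgeStabilityIndex_pos (hG : G.IsClassTwo) : 0 < G.chromaticEdgeStabilityIndex := by
  obtain ⟨F, h1, h2⟩ := exists_chromaticEdgeStabilityIndex hG
  rw [← h1, card_pos, nonempty_iff_ne_empty]
  rintro rfl
  exact not_edgeColorable hG (by simpa using h2)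

lemma sum_inner_le_stabilityIndex {ι : Type*} [Fintype ι] [DecidableEq ι] (hG : G.IsClassTwo)
    (π : V → ι)
    (hodd : ∀ i, Odd (univ.filter fun v => π v = i).card) :
    ∑ v, ((nb G v).filter fun x => π x = π v).card + G.maxDegree * Fintype.card ι ≤
      2 * G.chromaticEdgeStabilityIndex + G.maxDegree * Fintype.card V := by
  obtain ⟨F, h1, φ, hφ⟩ := exists_chromaticEdgeStabilityIndex hG
  have h2 := sum_inner_le hφ hodd
  have h3 := sum_inner_le_deleteEdges G F π
  omega

lemma sum_dg_le_stabilityIndex (hG : G.IsClassTwo) (hodd : Odd (Fintype.card V)) :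
    ∑ v, dg G v + G.maxDegree ≤
      2 * G.chromaticEdgeStabilityIndex + G.maxDegree * Fintype.card V := by
  have h := sum_inner_le_stabilityIndex hG (fun _ => ()) (by simpa using hodd)
  simpa [dg] using h

/-- The deleted edges are a colour class that misses at least three vertices. -/
lemma stabilityIndex_le (hG : G.IsClassTwo) (hodd : Odd (Fintype.card V))
    (hsum : ∑ v, dg G v + 2 ≤ (G.maxDegree + 1) * (Fintype.card V - 1)) :
    2 * G.chromaticEdgeStabilityIndex + 3 ≤ Fintype.card V := by
  obtain ⟨S, μ, h1, h2, h3⟩ := exists_colorClass (edgeColorable_succ hG) hodd hsum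
  have h4 := chromaticEdgeStabilityIndex_le hG h3
  have h5 := two_mul_card_pmEdges_le h1
  omega

/-- The numerical form of the extremal property of a very dense graph. -/
lemma stabilityIndex_eq_of_sum (hG : G.IsClassTwo) (hodd : Odd (Fintype.card V))
    (hsum : ∑ v, dg G v + 2 = (G.maxDegree + 1) * (Fintype.card V - 1)) :
    2 * G.chromaticEdgeStabilityIndex + 3 = Fintype.card V := by
  have h1 := stabilityIndex_le hG hodd hsum.le
  have h2 := sum_dg_le_stabilityIndex hG hodd
  obtain ⟨m, hm⟩ : ∃ m, Fintype.card V = m + 1 := ⟨Fintype.card V - 1, by omega⟩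
  rw [hm] at hsum h2 h1 ⊢
  rw [Nat.add_sub_cancel, add_mul] at hsum
  rw [mul_add] at h2
  omega

/-- The dichotomy for graphs with the extremal stability index. -/
theorem structure_of_stabilityIndex_eq (hG : G.IsClassTwo) (hodd : Odd (Fintype.card V))
    (h : 2 * G.chromaticEdgeStabilityIndex + 3 = Fintype.card V) :
    ∑ v, dg G v + 2 = (G.maxDegree + 1) * (Fintype.card V - 1) ∨
    (∃ w₁ w₂, w₁ ≠ w₂ ∧ (∀ x y, x ≠ w₁ → x ≠ w₂ → y ≠ w₁ → y ≠ w₂ → x ≠ y → G.Adj x y) ∧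
      ∀ x, x ≠ w₁ → x ≠ w₂ → ¬ G.Adj x w₁ ∧ ¬ G.Adj x w₂) ∨
    (Even G.maxDegree ∧ ∃ π : V → Fin 3, (∀ x y, G.Adj x y ↔ x ≠ y ∧ π x = π y) ∧
      (univ.filter fun x => π x = 0).card = G.maxDegree + 1 ∧
      (univ.filter fun x => π x = 1).card = G.maxDegree + 1 ∧
      ((univ.filter fun x => π x = 2).card = 1 ∨
        (univ.filter fun x => π x = 2).card = G.maxDegree + 1)) := by
  have hpos := chromaticEdgeStabilityIndex_pos hG
  have hn : 5 ≤ Fintype.card V := by omega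
  have h1 := sum_dg_le_stabilityIndex hG hodd
  have hle : ∑ v, dg G v + 2 ≤ (G.maxDegree + 1) * (Fintype.card V - 1) := by
    obtain ⟨m, hm⟩ : ∃ m, Fintype.card V = m + 1 := ⟨Fintype.card V - 1, by omega⟩
    rw [hm] at h1 h ⊢
    rw [Nat.add_sub_cancel, add_mul]
    rw [mul_add] at h1
    omega
  by_cases heq : ∑ v, dg G v + 2 = (G.maxDegree + 1) * (Fintype.card V - 1)
  · exact Or.inl heq
  right
  have hst : Stable G G.maxDegree := ⟨dg_le_maxDegree, fun F hF hcol => by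
    have := chromaticEdgeStabilityIndex_le hG hcol
    omega⟩
  -- Both sides are even, so a strict inequality gains two.
  have ht : ∑ v, dg G v + 4 ≤ (G.maxDegree + 1) * (Fintype.card V - 1) := by
    have h2 : Even ((G.maxDegree + 1) * (Fintype.card V - 1)) := by
      refine Even.mul_left ?_ _
      obtain ⟨k, hk⟩ := hodd
      exact ⟨k, by omega⟩
    obtain ⟨a, ha⟩ := h2
    obtain ⟨b, hb⟩ := sum_dg_even G
    omega
  obtain ⟨S, μ, hμ, hS, hcol⟩ := exists_colorClass (edgeColorable_succ hG) hodd hle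
  refine hst.structure hn hodd ht hμ ?_ hcol
  -- Missing more than three vertices means missing at least five, by parity; that class would then
  -- be too small for stability.
  by_contra hne
  refine hst.not_colorable (pmEdges S μ) ?_ hcol
  have h2 := two_mul_card_pmEdges_le hμ
  obtain ⟨a, ha⟩ := hμ.even_card
  obtain ⟨b, hb⟩ := hodd
  omega

end classTwo

/-! ### Graphs given by labels, and the extremal property of the listed graphs -/

variable {V : Type*} [Fintype V] {G : SimpleGraph V}

section label

variable {W : Type*} [Fintype W] {T : SimpleGraph W} {ι : Type*} [DecidableEq ι]

/-- Isomorphism to a graph whose adjacency depends only on a vertex labelling. -/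
lemma nonempty_iso_iff_label {g : W → ι} {R : ι → ι → Prop}
    (hT : ∀ x y, T.Adj x y ↔ x ≠ y ∧ R (g x) (g y)) :
    Nonempty (G ≃g T) ↔ ∃ f : V → ι,
      (∀ i, (univ.filter fun v => f v = i).card = (univ.filter fun x => g x = i).card) ∧
      ∀ x y, G.Adj x y ↔ x ≠ y ∧ R (f x) (f y) := by
  constructor
  · rintro ⟨φ⟩
    refine ⟨fun v => g (φ v), fun i => ?_, fun x y => ?_⟩
    · exact card_bij (fun v _ => φ v) (fun v hv => by simpa using hv)
        (fun _ _ _ _ h => φ.injective h) fun x hx => ⟨φ.symm x, by simpa using hx, by simp⟩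
    · rw [← φ.map_adj_iff, hT, φ.injective.ne_iff]
  · rintro ⟨f, h1, h2⟩
    have h3 : ∀ i, Nonempty ({v // f v = i} ≃ {x // g x = i}) := fun i => by
      rw [← Fintype.card_eq, Fintype.card_subtype, Fintype.card_subtype]
      exact h1 i
    let e : V ≃ W := (Equiv.sigmaFiberEquiv f).symm.trans
      ((Equiv.sigmaCongrRight fun i => (h3 i).some).trans (Equiv.sigmaFiberEquiv g))
    have he : ∀ v, g (e v) = f v := fun v => ((h3 (f v)).some ⟨v, rfl⟩).2
    refine ⟨⟨e, fun {x y} => ?_⟩⟩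
    rw [hT, h2, he, he, e.injective.ne_iff]

end label

section cliqueUnion

variable {ι : Type*} [Fintype ι] [DecidableEq ι] {π : V → ι}

lemma sum_comp_eq_sum_card_fiber (π : V → ι) (h : ι → ℕ) :
    ∑ v, h (π v) = ∑ i, (univ.filter fun v => π v = i).card * h i := by
  rw [← sum_fiberwise univ π fun v => h (π v)]
  refine sum_congr rfl fun i _ => ?_
  rw [sum_congr rfl (g := fun _ => h i) fun v hv => by rw [(mem_filter.1 hv).2], sum_const,
    smul_eq_mul]

lemma card_inner_add_one (hcl : ∀ x y, x ≠ y → π x = π y → G.Adj x y) (v : V) :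
    ((nb G v).filter fun x => π x = π v).card + 1 = (univ.filter fun x => π x = π v).card := by
  have h1 : (univ.filter fun x => π x = π v) =
      insert v ((nb G v).filter fun x => π x = π v) := by
    ext x
    simp only [mem_filter, mem_univ, true_and, mem_insert, mem_nb]
    constructor
    · intro h
      by_cases hx : x = v
      · exact Or.inl hx
      · exact Or.inr ⟨hcl v x (Ne.symm hx) h.symm, h⟩
    · rintro (rfl | h)
      exacts [rfl, h.2]
  rw [h1, card_insert_of_notMem (by simp)]

end cliqueUnion

section classTwo

variable [DecidableRel G.Adj]

/-- The extremal property for three odd cliques, the first of which is large. -/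
lemma stabilityIndex_eq_of_label (hG : G.IsClassTwo) (hodd : Odd (Fintype.card V))
    {π : V → Fin 3} (hcl : ∀ x y, x ≠ y → π x = π y → G.Adj x y) {c d : Fin 3 → ℕ}
    (hc : ∀ i, (univ.filter fun v => π v = i).card = c i) (h0 : Odd (c 0)) (h3 : 3 ≤ c 0)
    (h1 : c 1 = 1 ∨ c 1 = c 0) (h2 : c 2 = 1 ∨ c 2 = c 0)
    (hdg : ∀ v, dg G v + 1 ≤ d (π v)) (hd : ∀ i, d i ≤ c 0)
    (hsum : ∑ i, c i * d i ≤ ∑ i, c i * c i + 2) :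
    2 * G.chromaticEdgeStabilityIndex + 3 = Fintype.card V := by
  have hin : ∀ v, ((nb G v).filter fun x => π x = π v).card + 1 = c (π v) := fun v => by
    rw [card_inner_add_one hcl, hc]
  have hΔ : G.maxDegree + 1 = c 0 := by
    obtain ⟨v, hv⟩ : (univ.filter fun v => π v = 0).Nonempty := by
      rw [← card_pos, hc]; omega
    have hv0 : π v = 0 := by simpa using hv
    have h4 := hin v
    have h5 : ((nb G v).filter fun x => π x = π v).card ≤ dg G v := card_filter_le _ _
    have h6 := hdg v
    have h7 := hd (π v)
    rw [hv0] at h4 h5 h6 h7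
    have h8 : ∀ w, dg G w ≤ c 0 - 1 := fun w => by
      have := hdg w; have := hd (π w); omega
    rw [maxDegree_eq_of h8 (v := v) (by omega)]
    omega
  have hcard : Fintype.card V = c 0 + c 1 + c 2 := by
    have := sum_comp_eq_sum_card_fiber π fun _ => 1
    simpa [Fin.sum_univ_three, hc] using this
  -- The bounds `d` give the upper estimate of the degree sum and the sizes `c` the inner one. Their
  -- difference of at most 2 leaves room for one edge between parts.
  have hsumdg : ∑ v, dg G v + Fintype.card V ≤ ∑ i, c i * d i := by
    have h4 := sum_le_sum fun v (_ : v ∈ (univ : Finset V)) => hdg v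
    rw [sum_comp_eq_sum_card_fiber π d, sum_add_distrib] at h4
    simpa [hc] using h4
  have hsumin : ∑ v, ((nb G v).filter fun x => π x = π v).card + Fintype.card V =
      ∑ i, c i * c i := by
    have h4 := sum_congr rfl fun v (_ : v ∈ (univ : Finset V)) => hin v
    rw [sum_comp_eq_sum_card_fiber π c, sum_add_distrib] at h4
    simpa [hc] using h4
  have hoddc : ∀ i, Odd (univ.filter fun v => π v = i).card := by
    intro i
    rw [hc]
    fin_cases i
    · exact h0
    · rcases h1 with h | h <;> simp [h, h0]
    · rcases h2 with h | h <;> simp [h, h0]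
  have hlow := sum_inner_le_stabilityIndex hG π hoddc
  rw [Fin.sum_univ_three, Fin.sum_univ_three] at hsum
  rw [Fin.sum_univ_three] at hsumdg hsumin
  rw [Fintype.card_fin] at hlow
  have hup := stabilityIndex_le hG hodd
  have hm : Fintype.card V - 1 + 1 = Fintype.card V := by omega
  generalize Fintype.card V - 1 = m at hup hm
  generalize ∑ v, ((nb G v).filter fun x => π x = π v).card = A at *
  generalize ∑ v, dg G v = B at *
  generalize G.maxDegree = D at *
  generalize G.chromaticEdgeStabilityIndex = s at *
  generalize c 0 = p at *
  generalize c 1 = q at *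
  generalize c 2 = r at *
  subst hΔ
  have hup' : 2 * s + 3 ≤ Fintype.card V := by
    refine hup ?_
    rcases h1 with rfl | rfl <;> rcases h2 with rfl | rfl <;> nlinarith
  refine le_antisymm hup' ?_
  rcases h1 with rfl | rfl <;> rcases h2 with rfl | rfl <;> nlinarith

/-- The extremal property for a clique and two further vertices. -/
lemma stabilityIndex_eq_of_clique_union (hG : G.IsClassTwo) (hodd : Odd (Fintype.card V))
    {w₁ w₂ : V} (hw : w₁ ≠ w₂)
    (hcl : ∀ x y, x ≠ w₁ → x ≠ w₂ → y ≠ w₁ → y ≠ w₂ → x ≠ y → G.Adj x y)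
    (hno : ∀ x, x ≠ w₁ → x ≠ w₂ → ¬ G.Adj x w₁ ∧ ¬ G.Adj x w₂) :
    2 * G.chromaticEdgeStabilityIndex + 3 = Fintype.card V := by
  have hdw : ∀ a b, (∀ x, G.Adj a x → x = b) → dg G a ≤ 1 := by
    intro a b h
    refine (card_le_card (t := {b}) fun x hx => ?_).trans_eq (card_singleton b)
    rw [mem_singleton]
    exact h x (mem_nb.1 hx)
  have hd1 : dg G w₁ ≤ 1 := hdw w₁ w₂ fun x hx => by
    by_contra h
    exact (hno x hx.ne' h).1 hx.symm
  have hd2 : dg G w₂ ≤ 1 := hdw w₂ w₁ fun x hx => by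
    by_contra h
    exact (hno x h hx.ne').2 hx.symm
  have hc0 : (({w₁, w₂} : Finset V)ᶜ).card + 2 = Fintype.card V := by
    rw [← card_add_card_compl ({w₁, w₂} : Finset V), card_pair hw, add_comm]
  have hdv : ∀ v, v ≠ w₁ → v ≠ w₂ → dg G v + 1 ≤ (({w₁, w₂} : Finset V)ᶜ).card := by
    intro v h1 h2
    rw [← card_erase_add_one (s := ({w₁, w₂} : Finset V)ᶜ) (a := v) (by simp [h1, h2])]
    refine Nat.add_le_add_right (card_le_card fun x hx => ?_) 1
    rw [mem_nb] at hx
    simp only [mem_erase, mem_compl, mem_insert, mem_singleton, not_or]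
    refine ⟨hx.ne', ?_, ?_⟩
    · rintro rfl; exact (hno v h1 h2).1 hx
    · rintro rfl; exact (hno v h1 h2).2 hx
  -- On three vertices the clique is a single vertex; the upper bound would make the stability index
  -- zero.
  by_cases hn : Fintype.card V = 3
  · exfalso
    have hpos := chromaticEdgeStabilityIndex_pos hG
    have hup := stabilityIndex_le hG hodd
    have hsum : ∑ v, dg G v ≤ 2 := by
      rw [← sum_add_sum_compl ({w₁, w₂} : Finset V), sum_pair hw]
      have : ∑ v ∈ ({w₁, w₂} : Finset V)ᶜ, dg G v = 0 := by
        refine sum_eq_zero fun v hv => ?_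
        simp only [mem_compl, mem_insert, mem_singleton, not_or] at hv
        have := hdv v hv.1 hv.2
        omega
      omega
    by_cases hΔ : G.maxDegree = 0
    · have h0 : ∑ v, dg G v = 0 := sum_eq_zero fun v _ => by
        have := dg_le_maxDegree (G := G) v; omega
      rw [hΔ, hn, h0] at hup
      omega
    · have : 2 * 2 ≤ (G.maxDegree + 1) * (Fintype.card V - 1) := by
        rw [hn]; exact Nat.mul_le_mul_right 2 (by omega)
      have := hup (by omega)
      omega
  have hn5 : 5 ≤ Fintype.card V := by
    obtain ⟨k, hk⟩ := hodd; omega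
  set π : V → Fin 3 := fun v => if v = w₁ then 1 else if v = w₂ then 2 else 0 with hπ
  have hπ1 : ∀ v, π v = 1 ↔ v = w₁ := by intro v; simp only [hπ]; split_ifs <;> simp [*, hw.symm]
  have hπ2 : ∀ v, π v = 2 ↔ v = w₂ := by
    intro v; simp only [hπ]; split_ifs with h1 h2
    · simp [h1, hw]
    · simp [h2]
    · simp [h2]
  have hπ0 : ∀ v, π v = 0 ↔ v ≠ w₁ ∧ v ≠ w₂ := by
    intro v; simp only [hπ]; split_ifs <;> simp [*]
  -- The non-clique vertices are parts of size 1. The bound 2 for them admits the edge between them,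
  -- so both unions are treated at once.
  refine stabilityIndex_eq_of_label hG hodd (π := π) ?_ (c := ![Fintype.card V - 2, 1, 1])
    (d := ![Fintype.card V - 2, 2, 2]) ?_ ?_ ?_ (Or.inl rfl) (Or.inl rfl) ?_ ?_ ?_
  · intro x y hxy he
    by_cases h1 : x = w₁
    · exact (hxy (h1.trans ((hπ1 y).1 (he.symm.trans ((hπ1 x).2 h1))).symm)).elim
    by_cases h2 : x = w₂
    · exact (hxy (h2.trans ((hπ2 y).1 (he.symm.trans ((hπ2 x).2 h2))).symm)).elim
    have h3 := (hπ0 y).1 (he.symm.trans ((hπ0 x).2 ⟨h1, h2⟩))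
    exact hcl x y h1 h2 h3.1 h3.2 hxy
  · intro i
    fin_cases i
    · have : (univ.filter fun v => π v = 0) = ({w₁, w₂} : Finset V)ᶜ := by ext v; simp [hπ0]
      simp only [Fin.zero_eta, this, Matrix.cons_val_zero]
      omega
    · have : (univ.filter fun v => π v = 1) = {w₁} := by ext v; simp [hπ1]
      simp [this]
    · have : (univ.filter fun v => π v = 2) = {w₂} := by ext v; simp [hπ2]
      simp [this]
  · obtain ⟨k, hk⟩ := hodd
    exact ⟨k - 1, by simp only [Matrix.cons_val_zero]; omega⟩
  · simp only [Matrix.cons_val_zero]; omega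
  · intro v
    by_cases h1 : v = w₁
    · rw [(hπ1 v).2 h1, h1]; simpa using hd1
    by_cases h2 : v = w₂
    · rw [(hπ2 v).2 h2, h2]; simpa using hd2
    rw [(hπ0 v).2 ⟨h1, h2⟩]
    have := hdv v h1 h2
    simp only [Matrix.cons_val_zero]
    omega
  · intro i
    fin_cases i <;> simp <;> omega
  · simp [Fin.sum_univ_three]

/-- The extremal property for three odd cliques, the last of which may be trivial. -/
lemma stabilityIndex_eq_of_three_cliques (hG : G.IsClassTwo) (hodd : Odd (Fintype.card V))
    {π : V → Fin 3} (hadj : ∀ x y, G.Adj x y ↔ x ≠ y ∧ π x = π y) {m : ℕ} (hm : 1 ≤ m)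
    (h0 : (univ.filter fun v => π v = 0).card = 2 * m + 1)
    (h1 : (univ.filter fun v => π v = 1).card = 2 * m + 1)
    (h2 : (univ.filter fun v => π v = 2).card = 1 ∨
      (univ.filter fun v => π v = 2).card = 2 * m + 1) :
    2 * G.chromaticEdgeStabilityIndex + 3 = Fintype.card V := by
  refine stabilityIndex_eq_of_label hG hodd (π := π) (fun x y h h' => (hadj x y).2 ⟨h, h'⟩)
    (c := fun i => (univ.filter fun v => π v = i).card)
    (d := fun i => (univ.filter fun v => π v = i).card) (fun _ => rfl)
    (by rw [h0]; exact ⟨m, rfl⟩) (by omega) (Or.inr (h1.trans h0.symm)) ?_ ?_ ?_ (by omega)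
  · rw [h0]; exact h2
  · intro v
    rw [← card_inner_add_one fun x y h h' => (hadj x y).2 ⟨h, h'⟩]
    refine Nat.add_le_add_right (card_le_card fun x hx => ?_) 1
    rw [mem_filter]
    exact ⟨hx, ((hadj v x).1 (mem_nb.1 hx)).2.symm⟩
  · intro i
    fin_cases i
    · exact le_rfl
    · exact (h1.trans h0.symm).le
    · show (univ.filter fun v => π v = 2).card ≤ (univ.filter fun v => π v = 0).card
      omega

/-- The extremal property for graphs whose complement has degrees close to `s`. -/
lemma stabilityIndex_eq_of_nonNb (hG : G.IsClassTwo) (hodd : Odd (Fintype.card V)) {s : ℕ}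
    (hle : ∀ v, s ≤ (nonNb G v).card) {u : V} (hu : (nonNb G u).card = s)
    (hsum : ∑ v, (nonNb G v).card + s = s * Fintype.card V + 2) :
    2 * G.chromaticEdgeStabilityIndex + 3 = Fintype.card V := by
  refine stabilityIndex_eq_of_sum hG hodd ?_
  have hΔ : G.maxDegree = dg G u := by
    refine maxDegree_eq_of (fun v => ?_) rfl
    have := card_nonNb G v; have := card_nonNb G u; have := hle v
    omega
  have h1 := sum_congr rfl fun v (_ : v ∈ (univ : Finset V)) => card_nonNb G v
  rw [sum_add_distrib, sum_add_distrib] at h1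
  simp only [sum_const, smul_eq_mul, card_univ, mul_one] at h1
  have h2 := card_nonNb G u
  rw [hΔ]
  obtain ⟨m, hm⟩ : ∃ m, Fintype.card V = m + 1 := ⟨Fintype.card V - 1, by omega⟩
  rw [hm] at h1 h2 hsum ⊢
  rw [hu] at h2
  rw [Nat.add_sub_cancel]
  have h3 : m = s + dg G u := by omega
  subst h3
  nlinarith

/-- The degrees of the complement of a dense graph with the extremal property. -/
lemma nonNb_of_sum (hn : 5 ≤ Fintype.card V)
    (hsum : ∑ v, dg G v + 2 = (G.maxDegree + 1) * (Fintype.card V - 1)) :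
    ∃ s, (∀ v, s ≤ (nonNb G v).card) ∧
      ∑ v, (nonNb G v).card + s = s * Fintype.card V + 2 ∧ s ≤ 2 := by
  have h1 := sum_congr rfl fun v (_ : v ∈ (univ : Finset V)) => card_nonNb G v
  rw [sum_add_distrib, sum_add_distrib] at h1
  simp only [sum_const, smul_eq_mul, card_univ, mul_one] at h1
  have hlt : G.maxDegree < Fintype.card V := by
    have : Nonempty V := Fintype.card_pos_iff.1 (by omega)
    exact G.maxDegree_lt_card_verts
  have h2 : ∀ v, Fintype.card V - 1 - G.maxDegree ≤ (nonNb G v).card := fun v => by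
    have := card_nonNb G v; have := dg_le_maxDegree (G := G) v
    omega
  have h4 := sum_le_sum fun v (_ : v ∈ (univ : Finset V)) => h2 v
  rw [sum_const, smul_eq_mul, card_univ] at h4
  have h3 : ∑ v, (nonNb G v).card + (Fintype.card V - 1 - G.maxDegree) =
      (Fintype.card V - 1 - G.maxDegree) * Fintype.card V + 2 := by
    obtain ⟨s, hs⟩ : ∃ s, Fintype.card V = G.maxDegree + 1 + s := ⟨_, (Nat.add_sub_of_le hlt).symm⟩
    rw [hs] at hsum h1 ⊢
    have e1 : G.maxDegree + 1 + s - 1 = G.maxDegree + s := by omega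
    rw [e1] at hsum ⊢
    rw [Nat.add_sub_cancel_left]
    nlinarith
  -- Since every complement degree is at least `s`, the sum sn - s + 2 is at least sn.
  refine ⟨_, h2, h3, ?_⟩
  rw [mul_comm] at h4
  omega

end classTwo

/-! ### Isomorphism types in terms of adjacency: clique unions and one deleted edge -/

variable {V : Type*} [Fintype V] {G : SimpleGraph V}

lemma card_filter_sumElim {α β ι : Type*} [Fintype α] [Fintype β] [DecidableEq ι] (f : α → ι)
    (g : β → ι) (i : ι) : (univ.filter fun x => Sum.elim f g x = i).card =
      (univ.filter fun x => f x = i).card + (univ.filter fun x => g x = i).card := by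
  rw [card_filter, Fintype.sum_sum_type, card_filter, card_filter]
  rfl

open SimpleGraph in
lemma nonempty_iso_three_cliques_iff {a b c : ℕ} :
    Nonempty (G ≃g completeGraph (Fin a) ⊕g completeGraph (Fin b) ⊕g completeGraph (Fin c)) ↔
      ∃ π : V → Fin 3, (∀ x y, G.Adj x y ↔ x ≠ y ∧ π x = π y) ∧
        (univ.filter fun v => π v = 0).card = a ∧ (univ.filter fun v => π v = 1).card = b ∧
        (univ.filter fun v => π v = 2).card = c := by
  rw [nonempty_iso_iff_label (ι := Fin 3)
    (g := Sum.elim (Sum.elim (fun _ => 0) fun _ => 1) fun _ => 2) (R := fun i j => i = j)]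
  · refine exists_congr fun π => ?_
    rw [and_comm]
    refine and_congr_right fun _ => ?_
    constructor
    · intro h
      refine ⟨(h 0).trans ?_, (h 1).trans ?_, (h 2).trans ?_⟩ <;>
        simp [card_filter_sumElim]
    · rintro ⟨h0, h1, h2⟩ i
      fin_cases i
      · refine h0.trans ?_
        simp [card_filter_sumElim]
      · refine h1.trans ?_
        simp [card_filter_sumElim]
      · refine h2.trans ?_
        simp [card_filter_sumElim]
  · rintro ((x | x) | x) ((y | y) | y) <;> simp

-- The proposition `p` records whether the two extra vertices are joined, so that one lemma serves
-- both `K_2` and its complement.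
open SimpleGraph in
lemma nonempty_iso_clique_union_iff {a : ℕ} {K : SimpleGraph (Fin 2)} {p : Prop}
    (hK : ∀ x y, K.Adj x y ↔ x ≠ y ∧ p) (ha : a + 2 = Fintype.card V) :
    Nonempty (G ≃g completeGraph (Fin a) ⊕g K) ↔ ∃ w₁ w₂, w₁ ≠ w₂ ∧
      (∀ x y, x ≠ w₁ → x ≠ w₂ → y ≠ w₁ → y ≠ w₂ → x ≠ y → G.Adj x y) ∧
      (∀ x, x ≠ w₁ → x ≠ w₂ → ¬ G.Adj x w₁ ∧ ¬ G.Adj x w₂) ∧ (G.Adj w₁ w₂ ↔ p) := by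
  rw [nonempty_iso_iff_label (ι := Fin 2) (g := Sum.elim (fun _ => 0) fun _ => 1)
    (R := fun i j => i = j ∧ (i = 0 ∨ p))]
  · constructor
    · rintro ⟨f, h1, h2⟩
      have h3 : (univ.filter fun v => f v = 1).card = 2 := by
        refine (h1 1).trans ?_
        simp [card_filter_sumElim]
      obtain ⟨w₁, w₂, hw, h4⟩ := card_eq_two.1 h3
      have h5 : ∀ x, f x = 1 ↔ x = w₁ ∨ x = w₂ := fun x => by
        simpa using congrArg (x ∈ ·) h4
      have h6 : ∀ x, x ≠ w₁ → x ≠ w₂ → f x = 0 := fun x hx hx' => by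
        have := (h5 x).not.2 (by tauto)
        omega
      have h7 := (h5 w₁).2 (Or.inl rfl)
      have h8 := (h5 w₂).2 (Or.inr rfl)
      refine ⟨w₁, w₂, hw, fun x y a1 a2 a3 a4 hxy => ?_, fun x a1 a2 => ?_, ?_⟩
      · simp [h2, h6 x a1 a2, h6 y a3 a4, hxy]
      · simp [h2, h6 x a1 a2, h7, h8]
      · simp [h2, h7, h8, hw]
    · rintro ⟨w₁, w₂, hw, h1, h2, h3⟩
      set f : V → Fin 2 := fun x => if x = w₁ ∨ x = w₂ then 1 else 0 with hf
      have hf1 : ∀ x, f x = 1 ↔ x = w₁ ∨ x = w₂ := fun x => by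
        simp only [hf]; split_ifs with h <;> simp [h]
      have hf0 : ∀ x, f x = 0 ↔ ¬ (x = w₁ ∨ x = w₂) := fun x => by
        simp only [hf]; split_ifs with h <;> simp [h]
      refine ⟨f, fun i => ?_, fun x y => ?_⟩
      · have h4 : (univ.filter fun x => f x = 1) = {w₁, w₂} := by ext x; simp [hf1]
        have h5 : (univ.filter fun x => f x = 0) = ({w₁, w₂} : Finset V)ᶜ := by ext x; simp [hf0]
        fin_cases i
        · show (univ.filter fun x => f x = 0).card = _
          rw [h5, card_compl, card_pair hw]
          simp [card_filter_sumElim]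
          omega
        · show (univ.filter fun x => f x = 1).card = _
          rw [h4, card_pair hw]
          simp [card_filter_sumElim]
      · by_cases hx : x = w₁ ∨ x = w₂ <;> by_cases hy : y = w₁ ∨ y = w₂
        · rw [(hf1 x).2 hx, (hf1 y).2 hy]
          rcases hx with rfl | rfl <;> rcases hy with rfl | rfl
          · simp
          · simp [h3, hw]
          · simp [G.adj_comm x y, h3, hw.symm]
          · simp
        · rw [(hf1 x).2 hx, (hf0 y).2 hy]
          push Not at hy
          have := h2 y hy.1 hy.2
          rcases hx with rfl | rfl <;> simp [G.adj_comm _ y, this]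
        · rw [(hf0 x).2 hx, (hf1 y).2 hy]
          push Not at hx
          have := h2 x hx.1 hx.2
          rcases hy with rfl | rfl <;> simp [this]
        · rw [(hf0 x).2 hx, (hf0 y).2 hy]
          push Not at hx hy
          constructor
          · intro h; exact ⟨h.ne, rfl, Or.inl rfl⟩
          · intro h; exact h1 x y hx.1 hx.2 hy.1 hy.2 h.1
  · rintro (x | x) (y | y) <;> simp [hK]

open SimpleGraph in
lemma exists_iso_deleteEdge_iff :
    (∃ e ∈ (completeGraph (Fin (Fintype.card V))).edgeSet,
      Nonempty (G ≃g (completeGraph (Fin (Fintype.card V))).deleteEdges {e})) ↔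
    ∃ a b, a ≠ b ∧ ∀ x y, G.Adj x y ↔ x ≠ y ∧ s(x, y) ≠ s(a, b) := by
  constructor
  · rintro ⟨e, he, ⟨φ⟩⟩
    induction e with
    | _ i j =>
      refine ⟨φ.symm i, φ.symm j, fun h => he (φ.symm.injective h), fun x y => ?_⟩
      rw [← φ.map_adj_iff, deleteEdges_adj]
      have h1 : s(x, y) = s(φ.symm i, φ.symm j) ↔ s(φ x, φ y) = s(i, j) := by
        rw [Sym2.eq_iff, Sym2.eq_iff]
        simp only [← RelIso.eq_symm_apply]
      rw [Ne, Ne, h1]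
      simp [φ.injective.eq_iff]
  · rintro ⟨a, b, hab, h⟩
    let ε := Fintype.equivFin V
    refine ⟨s(ε a, ε b), fun h => hab (ε.injective h), ⟨⟨ε, fun {x y} => ?_⟩⟩⟩
    rw [deleteEdges_adj, h]
    simp [ε.injective.eq_iff]

/-! ### The complement of a matching and a path -/

variable {V : Type*} [Fintype V] {G : SimpleGraph V}

/-- Index the pairs of a fixed-point-free involution. -/
lemma exists_pair_index {W : Finset V} (hW : W.Nonempty) {ν : V → V}
    (hν : ∀ v ∈ W, ν v ∈ W ∧ ν (ν v) = v ∧ ν v ≠ v) :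
    ∃ k, 1 ≤ k ∧ ∃ idx : V → Fin k, (∀ i, (W.filter fun v => idx v = i).card = 2) ∧
      ∀ u ∈ W, ∀ v ∈ W, idx u = idx v ↔ v = u ∨ v = ν u := by
  set P := W.image fun v => s(v, ν v) with hP
  have hmem : ∀ v ∈ W, s(v, ν v) ∈ P := fun v hv => mem_image_of_mem _ hv
  obtain ⟨v₀, hv₀⟩ := hW
  have hidx : ∀ v, ∃ i, v ∈ W → (P.equivFin.symm i).1 = s(v, ν v) := by
    intro v
    by_cases hv : v ∈ W
    · exact ⟨P.equivFin ⟨_, hmem v hv⟩, fun _ => by simp⟩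
    · exact ⟨P.equivFin ⟨_, hmem v₀ hv₀⟩, fun h => (hv h).elim⟩
  choose idx hidx using hidx
  have heq : ∀ u ∈ W, ∀ v ∈ W, idx u = idx v ↔ v = u ∨ v = ν u := by
    intro u hu v hv
    rw [← P.equivFin.symm.injective.eq_iff, ← Subtype.val_injective.eq_iff, hidx u hu, hidx v hv,
      Sym2.eq_iff]
    constructor
    · rintro (h | h)
      exacts [Or.inl h.1.symm, Or.inr h.2.symm]
    · rintro (rfl | rfl)
      · exact Or.inl ⟨rfl, rfl⟩
      · exact Or.inr ⟨(hν u hu).2.1.symm, rfl⟩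
  refine ⟨P.card, card_pos.2 ⟨_, hmem v₀ hv₀⟩, idx, fun i => ?_, heq⟩
  obtain ⟨v, hv, hvi⟩ := mem_image.1 (P.equivFin.symm i).2
  have hi : idx v = i := P.equivFin.symm.injective (Subtype.ext ((hidx v hv).trans hvi))
  have hfil : (W.filter fun u => idx u = i) = {v, ν v} := by
    ext u
    rw [mem_filter, mem_insert, mem_singleton]
    constructor
    · rintro ⟨hu, h⟩
      exact (heq v hv u hu).1 (hi.trans h.symm)
    · intro h
      have hu : u ∈ W := by
        rcases h with rfl | rfl
        exacts [hv, (hν v hv).1]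
      exact ⟨hu, ((heq v hv u hu).2 h).symm.trans hi⟩
  rw [hfil, card_pair (hν v hv).2.2.symm]

/-- The complement of a matching and a path, described by labels. -/
def matchingPathRel (k : ℕ) : Fin k ⊕ Fin 2 → Fin k ⊕ Fin 2 → Prop
  | .inl i, .inl j => i ≠ j
  -- Label `inr 0` is the centre of the path and `inr 1` its two ends, which are adjacent in the
  -- complement.
  | .inr i, .inr j => i = 1 ∧ j = 1
  | _, _ => True

open SimpleGraph in
lemma exists_iso_compl_matching_path_iff_label {k : ℕ} :
    Nonempty (G ≃g (disjointCopies k (completeGraph (Fin 2)) ⊕g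
        completeBipartiteGraph (Fin 1) (Fin 2))ᶜ) ↔
      ∃ f : V → Fin k ⊕ Fin 2, ((∀ i, (univ.filter fun v => f v = .inl i).card = 2) ∧
        (univ.filter fun v => f v = .inr 0).card = 1 ∧
        (univ.filter fun v => f v = .inr 1).card = 2) ∧
        ∀ x y, G.Adj x y ↔ x ≠ y ∧ matchingPathRel k (f x) (f y) := by
  rw [nonempty_iso_iff_label (ι := Fin k ⊕ Fin 2) (g := Sum.elim (fun p => .inl p.1)
    (Sum.elim (fun _ => .inr 0) fun _ => .inr 1)) (R := matchingPathRel k)]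
  · refine exists_congr fun f => and_congr_left fun _ => ?_
    have hl : ∀ i : Fin k, (univ.filter fun p : Fin k × Fin 2 => p.1 = i).card = 2 := by
      intro i
      have : (univ.filter fun p : Fin k × Fin 2 => p.1 = i) = {i} ×ˢ univ := by
        ext p; rw [mem_filter, mem_product, mem_singleton]; simp
      rw [this, card_product]; simp
    constructor
    · intro h
      refine ⟨fun i => (h _).trans ?_, (h _).trans ?_, (h _).trans ?_⟩ <;>
        simp [card_filter_sumElim, hl]
    · rintro ⟨h1, h2, h3⟩ (i | i)
      · refine (h1 i).trans ?_
        simp [card_filter_sumElim, hl]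
      · fin_cases i
        · refine h2.trans ?_
          simp [card_filter_sumElim]
        · refine h3.trans ?_
          simp [card_filter_sumElim]
  · rintro (⟨i, a⟩ | a | a) (⟨j, b⟩ | b | b) <;>
      simp [matchingPathRel, disjointCopies, Fin.eq_zero]
    tauto

open SimpleGraph in
lemma exists_iso_compl_matching_path_iff :
    (∃ k : ℕ, 1 ≤ k ∧ Nonempty (G ≃g (disjointCopies k (completeGraph (Fin 2)) ⊕g
        completeBipartiteGraph (Fin 1) (Fin 2))ᶜ)) ↔
      5 ≤ Fintype.card V ∧
        ∃ w, (nonNb G w).card = 2 ∧ ∀ v, v ≠ w → (nonNb G v).card = 1 := by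
  constructor
  · rintro ⟨k, hk, hiso⟩
    have hcard : Fintype.card V = k * 2 + (1 + 2) := by
      obtain ⟨φ⟩ := hiso
      simpa using Fintype.card_congr φ.toEquiv
    refine ⟨by omega, ?_⟩
    obtain ⟨f, ⟨h1, h2, h3⟩, hadj⟩ := exists_iso_compl_matching_path_iff_label.1 hiso
    obtain ⟨w, hw⟩ := card_eq_one.1 h2
    have hw' : ∀ x, f x = .inr 0 ↔ x = w := fun x => by simpa using congrArg (x ∈ ·) hw
    have hnon : ∀ v x, x ∈ nonNb G v ↔ x ≠ v ∧ ¬ matchingPathRel k (f v) (f x) := by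
      intro v x
      rw [mem_nonNb, hadj]
      have := @ne_comm _ x v
      tauto
    have hfw := (hw' w).2 rfl
    refine ⟨w, ?_, fun v hv => ?_⟩
    · rw [← h3]
      congr 1
      ext x
      rw [hnon, hfw, mem_filter, Ne, ← hw' x]
      rcases f x with i | i
      · simp [matchingPathRel]
      · simp [matchingPathRel]; omega
    · have hfv : f v ≠ .inr 0 := (hw' v).not.2 hv
      rcases hfv' : f v with i | i
      · have h4 : nonNb G v = (univ.filter fun x => f x = .inl i).erase v := by
          ext x
          rw [hnon, hfv', mem_erase, mem_filter]
          rcases f x with j | j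
          · simp [matchingPathRel, eq_comm]
          · simp [matchingPathRel]
        rw [h4, card_erase_of_mem (by simp [hfv']), h1]
      · have hi : i = 1 := by
          have : i ≠ 0 := by rintro rfl; exact hfv hfv'
          omega
        subst hi
        rw [← h2]
        congr 1
        ext x
        rw [hnon, hfv', mem_filter]
        constructor
        · rintro ⟨-, h⟩
          rcases hx : f x with j | j
          · simp [hx, matchingPathRel] at h
          · simp [hx, matchingPathRel] at h ⊢; omega
        · rintro ⟨-, h⟩
          refine ⟨?_, by simp [h, matchingPathRel]⟩
          rintro rfl; exact hfv h
  · rintro ⟨hn, w, hw, hone⟩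
    obtain ⟨x, y, hxy, hwxy⟩ := card_eq_two.1 hw
    have hν : ∀ v, ∃ u, v ≠ w → nonNb G v = {u} := by
      intro v
      by_cases hv : v = w
      · exact ⟨v, fun h => (h hv).elim⟩
      · obtain ⟨u, hu⟩ := card_eq_one.1 (hone v hv)
        exact ⟨u, fun _ => hu⟩
    choose ν hν using hν
    have hsymm : ∀ u v, u ∈ nonNb G v → v ∈ nonNb G u := by
      intro u v h
      rw [mem_nonNb] at h ⊢
      exact ⟨h.1.symm, fun h' => h.2 h'.symm⟩
    have hνmem : ∀ v, v ≠ w → ∀ u, u ∈ nonNb G v ↔ u = ν v := fun v hv u => by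
      rw [hν v hv, mem_singleton]
    have hwmem : ∀ u, u ∈ nonNb G w ↔ u = x ∨ u = y := fun u => by
      rw [hwxy, mem_insert, mem_singleton]
    have hxw : x ≠ w := (mem_nonNb.1 ((hwmem x).2 (Or.inl rfl))).1
    have hyw : y ≠ w := (mem_nonNb.1 ((hwmem y).2 (Or.inr rfl))).1
    have hνx : w = ν x := (hνmem x hxw w).1 (hsymm _ _ ((hwmem x).2 (Or.inl rfl)))
    have hνy : w = ν y := (hνmem y hyw w).1 (hsymm _ _ ((hwmem y).2 (Or.inr rfl)))
    -- Outside the path formed by `w` and its two non-neighbours, the unique non-neighbour is a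
    -- fixed-point-free involution, and its pairs are the copies of `K_2`.
    set W : Finset V := {w, x, y}ᶜ with hW
    have hWmem : ∀ v, v ∈ W ↔ v ≠ w ∧ v ≠ x ∧ v ≠ y := fun v => by simp [hW]
    have hWne : W.Nonempty := by
      rw [← card_pos, hW, card_compl]
      have := card_le_three (a := w) (b := x) (c := y)
      omega
    have hinv : ∀ v ∈ W, ν v ∈ W ∧ ν (ν v) = v ∧ ν v ≠ v := by
      intro v hv
      obtain ⟨h1, h2, h3⟩ := (hWmem v).1 hv
      have h4 := (hνmem v h1 (ν v)).2 rfl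
      have h5 : ν v ≠ w := by
        intro h
        rw [h] at h4
        rcases (hwmem v).1 (hsymm _ _ h4) with h | h
        exacts [h2 h, h3 h]
      have h6 : v = ν (ν v) := (hνmem _ h5 v).1 (hsymm _ _ h4)
      refine ⟨(hWmem _).2 ⟨h5, ?_, ?_⟩, h6.symm, (mem_nonNb.1 h4).1⟩
      · intro h; exact h1 (by rw [h6, h, ← hνx])
      · intro h; exact h1 (by rw [h6, h, ← hνy])
    obtain ⟨k, hk, idx, hidx, hidx'⟩ := exists_pair_index hWne hinv
    refine ⟨k, hk, exists_iso_compl_matching_path_iff_label.2 ?_⟩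
    set f : V → Fin k ⊕ Fin 2 := fun v =>
      if v = w then .inr 0 else if v = x ∨ v = y then .inr 1 else .inl (idx v) with hf
    have hfw : f w = .inr 0 := by simp [hf]
    have hfx : f x = .inr 1 := by simp [hf, hxw]
    have hfy : f y = .inr 1 := by simp [hf, hyw]
    have hfv : ∀ v ∈ W, f v = .inl (idx v) := by
      intro v hv
      obtain ⟨h1, h2, h3⟩ := (hWmem v).1 hv
      simp [hf, h1, h2, h3]
    have hcases : ∀ v, v = w ∨ v = x ∨ v = y ∨ v ∈ W := by
      intro v; rw [hWmem]; tauto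
    refine ⟨f, ⟨fun i => ?_, ?_, ?_⟩, fun u v => ?_⟩
    · refine Eq.trans ?_ (hidx i)
      congr 1
      ext v
      rw [mem_filter, mem_filter]
      rcases hcases v with rfl | rfl | rfl | hv
      · simp [hfw, hWmem]
      · simp [hfx, hWmem]
      · simp [hfy, hWmem]
      · simp [hfv v hv, hv]
    · rw [card_eq_one]
      refine ⟨w, ?_⟩
      ext v
      rw [mem_filter, mem_singleton]
      rcases hcases v with rfl | rfl | rfl | hv
      · simp [hfw]
      · simp [hfx, hxw]
      · simp [hfy, hyw]
      · simp [hfv v hv, ((hWmem v).1 hv).1]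
    · refine Eq.trans ?_ (card_pair hxy)
      congr 1
      ext v
      rw [mem_filter, mem_insert, mem_singleton]
      rcases hcases v with rfl | rfl | rfl | hv
      · simp [hfw, hxw.symm, hyw.symm]
      · simp [hfx]
      · simp [hfy]
      · simp [hfv v hv, ((hWmem v).1 hv).2]
    · have hadj : G.Adj u v ↔ u ≠ v ∧ v ∉ nonNb G u := by
        rw [mem_nonNb]
        constructor
        · intro h; exact ⟨h.ne, fun h' => h'.2 h⟩
        · rintro ⟨h1, h2⟩
          by_contra h; exact h2 ⟨h1.symm, h⟩
      rw [hadj]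
      refine and_congr_right fun huv => ?_
      rcases hcases u with rfl | hu
      · rw [hwmem, hfw]
        rcases hcases v with rfl | rfl | rfl | hv
        · exact (huv rfl).elim
        · simp [hfx, matchingPathRel]
        · simp [hfy, matchingPathRel]
        · simp [hfv v hv, matchingPathRel, ((hWmem v).1 hv).2]
      · have huw : u ≠ w := by
          rcases hu with rfl | rfl | hu
          exacts [hxw, hyw, ((hWmem u).1 hu).1]
        rw [hνmem u huw]
        rcases hu with rfl | rfl | hu
        · rw [hfx, ← hνx]
          rcases hcases v with rfl | rfl | rfl | hv
          · simp [hfw, matchingPathRel]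
          · exact (huv rfl).elim
          · simp [hfy, matchingPathRel, hyw]
          · simp [hfv v hv, matchingPathRel, ((hWmem v).1 hv).1]
        · rw [hfy, ← hνy]
          rcases hcases v with rfl | rfl | rfl | hv
          · simp [hfw, matchingPathRel]
          · simp [hfx, matchingPathRel, hxw]
          · exact (huv rfl).elim
          · simp [hfv v hv, matchingPathRel, ((hWmem v).1 hv).1]
        · rw [hfv u hu]
          have h1 := (hWmem _).1 (hinv u hu).1
          rcases hcases v with rfl | rfl | rfl | hv
          · simp [hfw, matchingPathRel, h1.1.symm]
          · simp [hfx, matchingPathRel, h1.2.1.symm]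
          · simp [hfy, matchingPathRel, h1.2.2.symm]
          · rw [hfv v hv]
            simp only [matchingPathRel, Ne, hidx' u hu v hv]
            have := huv.symm
            tauto

/-! ### Complement degrees and the final equivalence -/

variable {V : Type*} [Fintype V] {G : SimpleGraph V}

/-- Non-adjacency is symmetric, so one non-adjacent pair already uses up the sum. -/
lemma two_nonneighbours_of_sum (h : ∑ v, (nonNb G v).card = 2) :
    ∃ a b, a ≠ b ∧ ∀ x y, G.Adj x y ↔ x ≠ y ∧ s(x, y) ≠ s(a, b) := by
  obtain ⟨a, -, ha⟩ := exists_ne_zero_of_sum_ne_zero (s := (univ : Finset V))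
    (f := fun v => (nonNb G v).card) (by omega)
  obtain ⟨b, hb⟩ := card_pos.1 (Nat.pos_of_ne_zero ha)
  have hba := mem_nonNb.1 hb
  have hab : a ∈ nonNb G b := mem_nonNb.2 ⟨hba.1.symm, fun h => hba.2 h.symm⟩
  have hb0 := card_pos.2 ⟨a, hab⟩
  rw [← sum_add_sum_compl ({a, b} : Finset V), sum_pair hba.1.symm] at h
  have hz : ∀ v, v ≠ a → v ≠ b → nonNb G v = ∅ := by
    intro v h1 h2
    have h3 : ∑ v ∈ ({a, b} : Finset V)ᶜ, (nonNb G v).card = 0 := by omega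
    exact card_eq_zero.1 (sum_eq_zero_iff.1 h3 v (by simp [h1, h2]))
  have hae : nonNb G a = {b} := (eq_of_subset_of_card_le (singleton_subset_iff.2 hb)
    (by rw [card_singleton]; omega)).symm
  have hbe : nonNb G b = {a} := (eq_of_subset_of_card_le (singleton_subset_iff.2 hab)
    (by rw [card_singleton]; omega)).symm
  refine ⟨a, b, hba.1.symm, fun x y => ⟨fun hxy => ⟨hxy.ne, ?_⟩, ?_⟩⟩
  · rw [Ne, Sym2.eq_iff]
    rintro (⟨rfl, rfl⟩ | ⟨rfl, rfl⟩)
    exacts [hba.2 hxy, hba.2 hxy.symm]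
  · rintro ⟨h1, h2⟩
    by_contra h3
    have h4 : y ∈ nonNb G x := mem_nonNb.2 ⟨h1.symm, h3⟩
    rw [Ne, Sym2.eq_iff] at h2
    by_cases hxa : x = a
    · subst hxa
      rw [hae, mem_singleton] at h4
      exact h2 (Or.inl ⟨rfl, h4⟩)
    by_cases hxb : x = b
    · subst hxb
      rw [hbe, mem_singleton] at h4
      exact h2 (Or.inr ⟨rfl, h4⟩)
    rw [hz x hxa hxb] at h4
    exact notMem_empty _ h4

lemma sum_nonNb_of_deleteEdge {a b : V} (hab : a ≠ b)
    (h : ∀ x y, G.Adj x y ↔ x ≠ y ∧ s(x, y) ≠ s(a, b)) :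
    ∑ v, (nonNb G v).card = 2 ∧ ∀ v, v ≠ a → v ≠ b → (nonNb G v).card = 0 := by
  have hnon : ∀ v x, x ∈ nonNb G v ↔ x ≠ v ∧ s(v, x) = s(a, b) := by
    intro v x
    rw [mem_nonNb, h]
    have := @ne_comm _ x v
    tauto
  have ha : nonNb G a = {b} := by
    ext x
    rw [hnon, mem_singleton, sym2_eq_left]
    exact ⟨fun h => h.2, fun h => ⟨h ▸ hab.symm, h⟩⟩
  have hb : nonNb G b = {a} := by
    ext x
    rw [hnon, mem_singleton, Sym2.eq_swap, Sym2.eq_swap (a := a), Sym2.eq_swap, sym2_eq_left]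
    exact ⟨fun h => h.2, fun h => ⟨h ▸ hab, h⟩⟩
  have hz : ∀ v, v ≠ a → v ≠ b → (nonNb G v).card = 0 := by
    intro v h1 h2
    rw [card_eq_zero, eq_empty_iff_forall_notMem]
    intro x hx
    rw [hnon, Sym2.eq_iff] at hx
    rcases hx.2 with h | h
    exacts [h1 h.1, h2 h.1]
  refine ⟨?_, hz⟩
  rw [← sum_add_sum_compl ({a, b} : Finset V), sum_pair hab, ha, hb, sum_eq_zero]
  · simp
  · intro v hv
    simp only [mem_compl, mem_insert, mem_singleton, not_or] at hv
    exact hz v hv.1 hv.2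

lemma one_exception_of_sum (h1 : ∀ v, 1 ≤ (nonNb G v).card)
    (h : ∑ v, (nonNb G v).card = Fintype.card V + 1) :
    ∃ w, (nonNb G w).card = 2 ∧ ∀ v, v ≠ w → (nonNb G v).card = 1 := by
  obtain ⟨w, hw⟩ : ∃ w, 2 ≤ (nonNb G w).card := by
    by_contra hcon
    push Not at hcon
    have h2 := sum_le_sum fun v (_ : v ∈ (univ : Finset V)) => Nat.le_of_lt_succ (hcon v)
    simp only [sum_const, smul_eq_mul, card_univ, mul_one] at h2
    omega
  have h3 : ∑ v ∈ univ.erase w, ((nonNb G v).card - 1) + (nonNb G w).card = 2 := by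
    have h4 : ∑ v ∈ univ.erase w, ((nonNb G v).card - 1) + (univ.erase w).card =
        ∑ v ∈ univ.erase w, (nonNb G v).card := by
      rw [card_eq_sum_ones, ← sum_add_distrib]
      exact sum_congr rfl fun v _ => Nat.sub_add_cancel (h1 v)
    have h5 := sum_erase_add (s := univ) (f := fun v => (nonNb G v).card) (mem_univ w)
    have h6 := card_erase_add_one (mem_univ w)
    rw [card_univ] at h6
    omega
  refine ⟨w, by omega, fun v hv => ?_⟩
  have h4 : ∑ v ∈ univ.erase w, ((nonNb G v).card - 1) = 0 := by omega
  have h5 := sum_eq_zero_iff.1 h4 v (mem_erase.2 ⟨hv, mem_univ v⟩)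
  have := h1 v
  omega

lemma sum_nonNb_of_one_exception {w : V} (hw : (nonNb G w).card = 2)
    (h : ∀ v, v ≠ w → (nonNb G v).card = 1) : ∑ v, (nonNb G v).card = Fintype.card V + 1 := by
  rw [← sum_erase_add _ _ (mem_univ w), hw, sum_congr rfl fun v hv => h v (ne_of_mem_erase hv),
    ← card_eq_sum_ones, ← card_univ, ← card_erase_add_one (mem_univ w)]

lemma card_nonNb_eq_of_sum {s : ℕ} (h1 : ∀ v, s ≤ (nonNb G v).card)
    (h : ∑ v, (nonNb G v).card = s * Fintype.card V) (v : V) : (nonNb G v).card = s := by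
  have h2 : ∑ _v : V, s = ∑ v, (nonNb G v).card := by
    rw [h, sum_const, smul_eq_mul, card_univ, mul_comm]
  exact ((sum_eq_sum_iff_of_le fun v _ => h1 v).1 h2 v (mem_univ v)).symm

variable [DecidableRel G.Adj]

lemma three_le_card (hG : G.IsClassTwo) (hodd : Odd (Fintype.card V)) : 3 ≤ Fintype.card V := by
  by_contra hcon
  have h1 : Fintype.card V = 1 := by obtain ⟨k, hk⟩ := hodd; omega
  have := (Fintype.card_le_one_iff_subsingleton.1 h1.le)
  exact not_edgeColorable hG ⟨fun _ => 0, fun a b h => (h.ne (Subsingleton.elim a b)).elim,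
    fun _ a b _ _ _ => Subsingleton.elim a b⟩

/-- The class 2 graphs of odd order with the extremal stability index. -/
theorem stabilityIndex_eq_iff (hG : G.IsClassTwo) (hodd : Odd (Fintype.card V)) :
    2 * G.chromaticEdgeStabilityIndex + 3 = Fintype.card V ↔
      (∃ a b, a ≠ b ∧ ∀ x y, G.Adj x y ↔ x ≠ y ∧ s(x, y) ≠ s(a, b)) ∨
      (∃ w₁ w₂, w₁ ≠ w₂ ∧ (∀ x y, x ≠ w₁ → x ≠ w₂ → y ≠ w₁ → y ≠ w₂ → x ≠ y → G.Adj x y) ∧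
        ∀ x, x ≠ w₁ → x ≠ w₂ → ¬ G.Adj x w₁ ∧ ¬ G.Adj x w₂) ∨
      (5 ≤ Fintype.card V ∧
        ∃ w, (nonNb G w).card = 2 ∧ ∀ v, v ≠ w → (nonNb G v).card = 1) ∨
      (5 ≤ Fintype.card V ∧ ∀ v, dg G v = Fintype.card V - 3) ∨
      ∃ m, 1 ≤ m ∧ ∃ π : V → Fin 3, (∀ x y, G.Adj x y ↔ x ≠ y ∧ π x = π y) ∧
        (univ.filter fun v => π v = 0).card = 2 * m + 1 ∧
        (univ.filter fun v => π v = 1).card = 2 * m + 1 ∧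
        ((univ.filter fun v => π v = 2).card = 1 ∨
          (univ.filter fun v => π v = 2).card = 2 * m + 1) := by
  have hn3 := three_le_card hG hodd
  constructor
  · intro h
    have hpos := chromaticEdgeStabilityIndex_pos hG
    have hn : 5 ≤ Fintype.card V := by omega
    rcases structure_of_stabilityIndex_eq hG hodd h with hsum | hw | ⟨⟨k, hk⟩, π, h1, h2, h3, h4⟩
    · obtain ⟨s, h1, h2, h3⟩ := nonNb_of_sum hn hsum
      -- Here `s` is a lower bound for the complement degrees, whose sum is sn - s + 2: a single
      -- missing edge, one vertex exceeding degree 1, or constant degree 2.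
      interval_cases s
      · exact Or.inl (two_nonneighbours_of_sum (by omega))
      · exact Or.inr (Or.inr (Or.inl ⟨hn, one_exception_of_sum h1 (by omega)⟩))
      · refine Or.inr (Or.inr (Or.inr (Or.inl ⟨hn, fun v => ?_⟩)))
        have h4 := card_nonNb_eq_of_sum h1 (by omega) v
        have h5 := card_nonNb G v
        omega
    · exact Or.inr (Or.inl hw)
    · have e : G.maxDegree + 1 = 2 * k + 1 := by omega
      refine Or.inr (Or.inr (Or.inr (Or.inr ⟨k, ?_, π, h1, h2.trans e, h3.trans e, e ▸ h4⟩)))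
      -- For `k = 0` all three parts are single vertices, contradicting n ≥ 5.
      by_contra hk0
      have h5 := sum_comp_eq_sum_card_fiber π fun _ => 1
      simp only [sum_const, smul_eq_mul, card_univ, mul_one, Fin.sum_univ_three] at h5
      have : Fintype.card V = 3 := by omega
      omega
  · rintro (⟨a, b, hab, h⟩ | ⟨w₁, w₂, hw, h1, h2⟩ | ⟨-, w, hw, h⟩ | ⟨hn, h⟩ |
      ⟨m, hm, π, h1, h2, h3, h4⟩)
    · obtain ⟨h1, h2⟩ := sum_nonNb_of_deleteEdge hab h
      obtain ⟨u, hu⟩ : (({a, b} : Finset V)ᶜ).Nonempty := by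
        rw [← card_pos, card_compl, card_pair hab]; omega
      simp only [mem_compl, mem_insert, mem_singleton, not_or] at hu
      exact stabilityIndex_eq_of_nonNb hG hodd (s := 0) (fun _ => Nat.zero_le _) (h2 u hu.1 hu.2)
        (by omega)
    · exact stabilityIndex_eq_of_clique_union hG hodd hw h1 h2
    · have h1 : ∀ v, 1 ≤ (nonNb G v).card := fun v => by
        by_cases hv : v = w
        · rw [hv]; omega
        · exact (h v hv).ge
      obtain ⟨u, hu⟩ := Fintype.exists_ne_of_one_lt_card (by omega) w
      have h2 := sum_nonNb_of_one_exception hw h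
      exact stabilityIndex_eq_of_nonNb hG hodd h1 (h u hu) (by omega)
    · have h1 : ∀ v, (nonNb G v).card = 2 := fun v => by
        have := card_nonNb G v; have := h v
        omega
      obtain ⟨u⟩ : Nonempty V := Fintype.card_pos_iff.1 (by omega)
      refine stabilityIndex_eq_of_nonNb hG hodd (fun v => (h1 v).ge) (h1 u) ?_
      rw [sum_congr rfl fun v _ => h1 v, sum_const, smul_eq_mul, card_univ]
      omega
    · exact stabilityIndex_eq_of_three_cliques hG hodd h1 hm h2 h3 h4

end EdgeStability

theorem mainTheorem8 {V : Type*} [Fintype V] (G : SimpleGraph V) [DecidableRel G.Adj]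
    (n : ℕ) (hn : Fintype.card V = n) (hodd : Odd n) (hG : G.IsClassTwo) :
    (G.chromaticEdgeStabilityIndex : ℚ) = ((n : ℚ) - 3) / 2 ↔
      -- `K_n` minus one edge
      (∃ e ∈ (SimpleGraph.completeGraph (Fin n)).edgeSet,
        Nonempty (G ≃g (SimpleGraph.completeGraph (Fin n)).deleteEdges {e})) ∨
      -- `K_{n-2} ∪ K_2`
      Nonempty (G ≃g SimpleGraph.completeGraph (Fin (n - 2)) ⊕g SimpleGraph.completeGraph (Fin 2)) ∨
      -- `K_{n-2}` together with two isolated vertices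
      Nonempty (G ≃g SimpleGraph.completeGraph (Fin (n - 2)) ⊕g (SimpleGraph.completeGraph (Fin 2))ᶜ) ∨
      -- the complement of `K_2 ∪ ⋯ ∪ K_2 ∪ K_{1,2}`
      (∃ k : ℕ, 1 ≤ k ∧
        Nonempty (G ≃g (SimpleGraph.disjointCopies k (SimpleGraph.completeGraph (Fin 2)) ⊕g
          completeBipartiteGraph (Fin 1) (Fin 2))ᶜ)) ∨
      -- an `(n-3)`-regular graph
      (5 ≤ n ∧ G.IsRegularOfDegree (n - 3)) ∨
      -- `K_{2m+1} ∪ K_{2m+1} ∪ K_1`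
      (∃ m : ℕ, 1 ≤ m ∧
        Nonempty (G ≃g SimpleGraph.completeGraph (Fin (2 * m + 1)) ⊕g SimpleGraph.completeGraph (Fin (2 * m + 1)) ⊕g
          SimpleGraph.completeGraph (Fin 1))) ∨
      -- `K_{2m+1} ∪ K_{2m+1} ∪ K_{2m+1}`
      (∃ m : ℕ, 1 ≤ m ∧
        Nonempty (G ≃g SimpleGraph.completeGraph (Fin (2 * m + 1)) ⊕g SimpleGraph.completeGraph (Fin (2 * m + 1)) ⊕g
          SimpleGraph.completeGraph (Fin (2 * m + 1)))) := by
  subst hn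
  have hn3 := EdgeStability.three_le_card hG hodd
  have ha : Fintype.card V - 2 + 2 = Fintype.card V := by omega
  have hes : (G.chromaticEdgeStabilityIndex : ℚ) = ((Fintype.card V : ℚ) - 3) / 2 ↔
      2 * G.chromaticEdgeStabilityIndex + 3 = Fintype.card V := by
    rw [eq_div_iff two_ne_zero, eq_sub_iff_add_eq, mul_comm]
    norm_cast
  have hreg : G.IsRegularOfDegree (Fintype.card V - 3) ↔
      ∀ v, EdgeStability.dg G v = Fintype.card V - 3 := by
    simp only [EdgeStability.dg_eq_degree]
    rfl
  rw [hes, EdgeStability.stabilityIndex_eq_iff hG hodd, EdgeStability.exists_iso_deleteEdge_iff,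
    EdgeStability.nonempty_iso_clique_union_iff (p := True) (by simp) ha,
    EdgeStability.nonempty_iso_clique_union_iff (p := False) (by simp) ha,
    EdgeStability.exists_iso_compl_matching_path_iff, hreg]
  simp only [EdgeStability.nonempty_iso_three_cliques_iff]
  constructor
  · rintro (h | ⟨w₁, w₂, hw, h1, h2⟩ | h | h | ⟨m, hm, π, h1, h2, h3, h4 | h4⟩)
    · exact Or.inl h
    · by_cases hadj : G.Adj w₁ w₂
      · exact Or.inr (Or.inl ⟨w₁, w₂, hw, h1, h2, iff_true_intro hadj⟩)
      · exact Or.inr (Or.inr (Or.inl ⟨w₁, w₂, hw, h1, h2, iff_false_intro hadj⟩))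
    · exact Or.inr (Or.inr (Or.inr (Or.inl h)))
    · exact Or.inr (Or.inr (Or.inr (Or.inr (Or.inl h))))
    · exact Or.inr (Or.inr (Or.inr (Or.inr (Or.inr (Or.inl ⟨m, hm, π, h1, h2, h3, h4⟩)))))
    · exact Or.inr (Or.inr (Or.inr (Or.inr (Or.inr (Or.inr ⟨m, hm, π, h1, h2, h3, h4⟩)))))
  · rintro (h | ⟨w₁, w₂, hw, h1, h2, -⟩ | ⟨w₁, w₂, hw, h1, h2, -⟩ | h | h |
      ⟨m, hm, π, h1, h2, h3, h4⟩ | ⟨m, hm, π, h1, h2, h3, h4⟩)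
    · exact Or.inl h
    · exact Or.inr (Or.inl ⟨w₁, w₂, hw, h1, h2⟩)
    · exact Or.inr (Or.inl ⟨w₁, w₂, hw, h1, h2⟩)
    · exact Or.inr (Or.inr (Or.inl h))
    · exact Or.inr (Or.inr (Or.inr (Or.inl h)))
    · exact Or.inr (Or.inr (Or.inr (Or.inr ⟨m, hm, π, h1, h2, h3, Or.inl h4⟩)))
    · exact Or.inr (Or.inr (Or.inr (Or.inr ⟨m, hm, π, h1, h2, h3, Or.inr h4⟩)))
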